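/- Let $X$ be an oriented smooth manifold (Hausdorff, second countable, without boundary) of dimension $n$, let $\mathbb K=\mathbb R$ or $\mathbb C$, and let $1\le k\le n$. A current of degree $k$ on an open set $U\subset X$ is a continuous $\mathbb K$-linear functional on the smooth $\mathbb K$-valued $(n-k)$-forms with compact support in $U$; a smooth $k$-form $\alpha$ is regarded as the current $\beta\mapsto(-1)^{\binom{k+1}{2}}\int_U\alpha\wedge\beta$, and $\langle dC,\phi\rangle=\langle C,d\phi\rangle$. A sheaf of degree $k$ currents is a subsheaf of $\mathbb K$-modules of the sheaf of all degree $k$ currents on $X$. An $n$-box $U\subset X$ is an open set which in some smooth chart is a product $\prod_i(a_i,b_i)$ of bounded nonempty open intervals whose closure is contained in the image of the chart. A smear on $U$ is given by a smaller or equal box $\prod_i(c_i,d_i)\subset\prod_i(a_i,b_i)$, the flows $h_i(x,t)$ on $\mathbb R$ of vector fields $\sigma_i(s)\frac{\partial}{\partial s}$ with $\sigma_i$ smooth, positive on $(c_i,d_i)$ and zero elsewhere, and a compactly supported smooth $n$-form $\rho(t)\,dt$ on $\mathbb R^n$. With $h_t(x)=(h_1(x_1,t_1),\dots,h_n(x_n,t_n))$,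 the smear of a current $C$ on $U$ is the current $\phi\mapsto\bigl\langle C,\int_{\mathbb R^n}h_{-t}^*(\phi)\,\rho(t)\,dt\bigr\rangle$ on $U$, computed in the coordinates of the chart. Proposition. Let $\mathscr B$ be a sheaf of degree $k$ currents on $X$ which contains the sheaf of smooth $k$-forms, and such that $\mathscr B(U)$ is closed under all smears on $U$, for every $n$-box $U\subset X$. Let $\mathscr B'$ be the preimage of $\mathscr B$ under $d$ in the sheaf of degree $k-1$ currents, $\mathscr B'(U)=\{C : dC\in\mathscr B(U)\}$. Then $\mathscr B'$ is a sheaf, it is soft (for every closed $K\subset X$, every section of $\mathscr B'$ over $K$ extends to a global section), and it is $\Gamma$-acyclic: $H^j(X,\mathscr B')=0$ for all $j\ge1$. -/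

import Mathlib

open CategoryTheory TopologicalSpace Opposite MeasureTheory
open scoped Manifold ContDiff

universe u

noncomputable section

/-- The model space `ℝⁿ`. -/
abbrev Rn (n : ℕ) : Type := EuclideanSpace ℝ (Fin n)

/-- The smooth charts of `X`: all charts of the maximal `C^∞` atlas. -/
abbrev SmoothCharts (n : ℕ) (X : Type u) [TopologicalSpace X] [ChartedSpace (Rn n) X] :
    Set (OpenPartialHomeomorph X (Rn n)) :=
  IsManifold.maximalAtlas 𝓘(ℝ, Rn n) ∞ X

section Forms

variable (n : ℕ) (𝕜 : Type) [RCLike 𝕜] (X : Type u) [TopologicalSpace X] [ChartedSpace (Rn n) X]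

/-- Not necessarily continuous `𝕜`-valued differential `m`-forms on `X`. -/
abbrev DForm (m : ℕ) : Type u :=
  ∀ x : X, (TangentSpace 𝓘(ℝ, Rn n) x) [⋀^Fin m]→L[ℝ] 𝕜

variable {n 𝕜 X} {m k : ℕ}

/-- The coordinate expression `(e⁻¹)^* η` of a form in the chart `e`, meaningful on `e.target`. -/
def DForm.inChart (e : OpenPartialHomeomorph X (Rn n)) (η : DForm n 𝕜 X m) (y : Rn n) :
    (Rn n) [⋀^Fin m]→L[ℝ] 𝕜 :=
  (η (e.symm y)).compContinuousLinearMap (mfderiv 𝓘(ℝ, Rn n) 𝓘(ℝ, Rn n) e.symm y)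

/-- `η` is a smooth form on the open set `U`. -/
def DForm.IsSmoothOn (η : DForm n 𝕜 X m) (U : Opens X) : Prop :=
  ∀ e ∈ SmoothCharts n X, ContDiffOn ℝ ∞ (η.inChart e) (e.target ∩ e.symm ⁻¹' U)

/-- `η` vanishes outside some compact subset of `S`. -/
def DForm.CompactlySupportedIn (η : DForm n 𝕜 X m) (S : Set X) : Prop :=
  ∃ K : Set X, IsCompact K ∧ K ⊆ S ∧ ∀ x ∉ K, η x = 0

/-- The exterior derivative, computed at `x` in the preferred chart at `x`. -/
def DForm.extD (η : DForm n 𝕜 X m) : DForm n 𝕜 X (m + 1) := fun x =>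
  (extDeriv (η.inChart (chartAt (Rn n) x)) (chartAt (Rn n) x x)).compContinuousLinearMap
    (mfderiv 𝓘(ℝ, Rn n) 𝓘(ℝ, Rn n) (chartAt (Rn n) x) x)

theorem DForm.inChart_eq_of_mfderiv (η : DForm n 𝕜 X m) {e e' : OpenPartialHomeomorph X (Rn n)}
    {y y' : Rn n} (h : e'.symm y' = e.symm y) (A : Rn n →L[ℝ] Rn n)
    (hA : mfderiv 𝓘(ℝ, Rn n) 𝓘(ℝ, Rn n) e.symm y =
      (show Rn n →L[ℝ] Rn n from mfderiv 𝓘(ℝ, Rn n) 𝓘(ℝ, Rn n) e'.symm y').comp A) :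
    η.inChart e y = (η.inChart e' y').compContinuousLinearMap A := by
  have key : ∀ (x x' : X) (_ : x' = x) (B : Rn n →L[ℝ] Rn n),
      ((show (Rn n) [⋀^Fin m]→L[ℝ] 𝕜 from η x).compContinuousLinearMap (B.comp A)) =
      (((show (Rn n) [⋀^Fin m]→L[ℝ] 𝕜 from η x').compContinuousLinearMap B)).compContinuousLinearMap
        A := by
    rintro x x' rfl B
    rfl
  have := key _ _ h (mfderiv 𝓘(ℝ, Rn n) 𝓘(ℝ, Rn n) e'.symm y')
  unfold DForm.inChart
  rw [hA]
  exact this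

theorem DForm.inChart_change [IsManifold 𝓘(ℝ, Rn n) ∞ X] (η : DForm n 𝕜 X m)
    {e e' : OpenPartialHomeomorph X (Rn n)}
    (he : e ∈ SmoothCharts n X) (he' : e' ∈ SmoothCharts n X) {y : Rn n} (hy : y ∈ e.target)
    (hy' : e.symm y ∈ e'.source) :
    η.inChart e y = (η.inChart e' (e' (e.symm y))).compContinuousLinearMap
      (fderiv ℝ (fun z => e' (e.symm z)) y) := by
  apply η.inChart_eq_of_mfderiv (e'.left_inv hy')
  have h1 : MDifferentiableAt 𝓘(ℝ, Rn n) 𝓘(ℝ, Rn n) e.symm y :=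
    (contMDiffAt_symm_of_mem_maximalAtlas he hy).mdifferentiableAt (by simp)
  have h2 : MDifferentiableAt 𝓘(ℝ, Rn n) 𝓘(ℝ, Rn n) e' (e.symm y) :=
    (contMDiffAt_of_mem_maximalAtlas he' hy').mdifferentiableAt (by simp)
  have h3 : MDifferentiableAt 𝓘(ℝ, Rn n) 𝓘(ℝ, Rn n) e'.symm (e' (e.symm y)) :=
    (contMDiffAt_symm_of_mem_maximalAtlas he' (e'.map_source hy')).mdifferentiableAt (by simp)
  have h4 : (e.symm : Rn n → X) =ᶠ[nhds y] (e'.symm ∘ fun z => e' (e.symm z)) := by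
    have : ∀ᶠ z in nhds y, e.symm z ∈ e'.source :=
      (e.symm.continuousAt hy).eventually (e'.open_source.mem_nhds hy')
    filter_upwards [this] with z hz
    exact (e'.left_inv hz).symm
  rw [h4.mfderiv_eq, ← mfderiv_eq_fderiv]
  exact mfderiv_comp y h3 (h2.comp y h1)

theorem DForm.contDiffAt_transition [IsManifold 𝓘(ℝ, Rn n) ∞ X]
    {e e' : OpenPartialHomeomorph X (Rn n)}
    (he : e ∈ SmoothCharts n X) (he' : e' ∈ SmoothCharts n X) {y : Rn n} (hy : y ∈ e.target)
    (hy' : e.symm y ∈ e'.source) : ContDiffAt ℝ ∞ (fun z => e' (e.symm z)) y := by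
  rw [← contMDiffAt_iff_contDiffAt]
  exact (contMDiffAt_of_mem_maximalAtlas he' hy').comp y
    (contMDiffAt_symm_of_mem_maximalAtlas he hy)

theorem DForm.inChart_extD [IsManifold 𝓘(ℝ, Rn n) ∞ X] {η : DForm n 𝕜 X m} (hη : η.IsSmoothOn ⊤)
    {e : OpenPartialHomeomorph X (Rn n)} (he : e ∈ SmoothCharts n X) {y : Rn n}
    (hy : y ∈ e.target) : η.extD.inChart e y = extDeriv (η.inChart e) y := by
  set e' := chartAt (Rn n) (e.symm y) with he'_def
  have he' : e' ∈ SmoothCharts n X := IsManifold.chart_mem_maximalAtlas _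
  have hy' : e.symm y ∈ e'.source := mem_chart_source _ _
  have h4 : η.inChart e =ᶠ[nhds y] fun z => (η.inChart e' (e' (e.symm z))).compContinuousLinearMap
      (fderiv ℝ (fun z => e' (e.symm z)) z) := by
    have : ∀ᶠ z in nhds y, e.symm z ∈ e'.source :=
      (e.symm.continuousAt hy).eventually (e'.open_source.mem_nhds hy')
    filter_upwards [this, e.open_target.mem_nhds hy] with z hz hz'
    exact η.inChart_change he he' hz' hz
  have hd : DifferentiableAt ℝ (η.inChart e') (e' (e.symm y)) := by
    have := hη e' he'
    simp only [Opens.coe_top, Set.preimage_univ, Set.inter_univ] at this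
    exact (this.contDiffAt (e'.open_target.mem_nhds (e'.map_source hy'))).differentiableAt (by simp)
  have h6 := extDeriv_pullback (f := fun z => e' (e.symm z)) (x := y) hd
    (DForm.contDiffAt_transition he he' hy hy')
    (by simp only [minSmoothness_of_isRCLikeNormedField]; exact WithTop.coe_le_coe.2 le_top)
  rw [h4.extDeriv_eq]
  refine Eq.trans ?_ h6.symm
  have h1 : MDifferentiableAt 𝓘(ℝ, Rn n) 𝓘(ℝ, Rn n) e.symm y :=
    (contMDiffAt_symm_of_mem_maximalAtlas he hy).mdifferentiableAt (by simp)
  have h2 : MDifferentiableAt 𝓘(ℝ, Rn n) 𝓘(ℝ, Rn n) e' (e.symm y) :=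
    (contMDiffAt_of_mem_maximalAtlas he' hy').mdifferentiableAt (by simp)
  have h5 : fderiv ℝ (fun z => e' (e.symm z)) y =
      (show Rn n →L[ℝ] Rn n from mfderiv 𝓘(ℝ, Rn n) 𝓘(ℝ, Rn n) e' (e.symm y)).comp
      (show Rn n →L[ℝ] Rn n from mfderiv 𝓘(ℝ, Rn n) 𝓘(ℝ, Rn n) e.symm y) := by
    rw [← mfderiv_eq_fderiv]
    exact mfderiv_comp y h2 h1
  rw [h5]
  rfl

theorem DForm.IsSmoothOn.extD [IsManifold 𝓘(ℝ, Rn n) ∞ X] {η : DForm n 𝕜 X m}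
    (hη : η.IsSmoothOn ⊤) : η.extD.IsSmoothOn ⊤ := by
  intro e he
  have := hη e he
  simp only [Opens.coe_top, Set.preimage_univ, Set.inter_univ] at this ⊢
  have h2 : ContDiffOn ℝ ∞ (extDeriv (η.inChart e)) e.target := by
    have h3 : ContDiffOn ℝ ∞ (fderiv ℝ (η.inChart e)) e.target :=
      this.fderiv_of_isOpen e.open_target (by simp)
    exact (ContinuousAlternatingMap.alternatizeUncurryFinCLM ℝ (Rn n) 𝕜).contDiff.comp_contDiffOn h3
  exact h2.congr fun y hy => DForm.inChart_extD hη he hy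

theorem DForm.inChart_add (η ζ : DForm n 𝕜 X m) (e : OpenPartialHomeomorph X (Rn n)) :
    (η + ζ).inChart e = η.inChart e + ζ.inChart e := rfl

theorem DForm.inChart_smul (c : 𝕜) (η : DForm n 𝕜 X m) (e : OpenPartialHomeomorph X (Rn n)) :
    (c • η).inChart e = c • η.inChart e := rfl

theorem DForm.inChart_zero (e : OpenPartialHomeomorph X (Rn n)) :
    (0 : DForm n 𝕜 X m).inChart e = 0 := rfl


end Forms
section Currents

variable {n : ℕ} {𝕜 : Type} [RCLike 𝕜] {X : Type u} [TopologicalSpace X] [ChartedSpace (Rn n) X]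
  {m k : ℕ}

variable (n 𝕜) in
/-- The space of smooth `m`-forms on `X` with compact support in the open set `U`. -/
def testForms (m : ℕ) (U : Opens X) : Submodule 𝕜 (DForm n 𝕜 X m) where
  carrier := {φ | φ.IsSmoothOn ⊤ ∧ φ.CompactlySupportedIn U}
  zero_mem' := ⟨fun e _ => by rw [DForm.inChart_zero]; exact contDiffOn_const,
    ∅, isCompact_empty, Set.empty_subset _, fun _ _ => rfl⟩
  add_mem' := by
    rintro φ ψ ⟨h1, K, hK, hKU, h2⟩ ⟨h3, L, hL, hLU, h4⟩
    refine ⟨fun e he => ?_, K ∪ L, hK.union hL, Set.union_subset hKU hLU, fun x hx => ?_⟩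
    · rw [DForm.inChart_add]
      exact (h1 e he).add (h3 e he)
    · rw [Set.mem_union, not_or] at hx
      rw [Pi.add_apply, h2 x hx.1, h4 x hx.2, add_zero]
  smul_mem' := by
    rintro c φ ⟨h1, K, hK, hKU, h2⟩
    refine ⟨fun e he => ?_, K, hK, hKU, fun x hx => ?_⟩
    · rw [DForm.inChart_smul]
      exact (h1 e he).const_smul c
    · rw [Pi.smul_apply, h2 x hx]
      exact smul_zero (A := (TangentSpace 𝓘(ℝ, Rn n) x) [⋀^Fin m]→L[ℝ] 𝕜) c

variable (n 𝕜) in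
/-- The test forms on the open set `U`: smooth `m`-forms with compact support in `U`
(extended by zero to `X`). -/
def TestForm (m : ℕ) (U : Opens X) : Type u := testForms n 𝕜 m U

instance (U : Opens X) : AddCommGroup (TestForm n 𝕜 m U) :=
  inferInstanceAs (AddCommGroup (testForms n 𝕜 m U))

instance (U : Opens X) : Module 𝕜 (TestForm n 𝕜 m U) :=
  inferInstanceAs (Module 𝕜 (testForms n 𝕜 m U))

/-- Extension by zero of test forms along `V ⊆ U`. -/
def TestForm.extend {U V : Opens X} (h : V ≤ U) : TestForm n 𝕜 m V →ₗ[𝕜] TestForm n 𝕜 m U where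
  toFun φ := Subtype.mk φ.1 ⟨φ.2.1, φ.2.2.imp fun _ hK => ⟨hK.1, hK.2.1.trans h, hK.2.2⟩⟩
  map_add' _ _ := rfl
  map_smul' _ _ := rfl

theorem DForm.extD_eq_zero [IsManifold 𝓘(ℝ, Rn n) ∞ X] [T2Space X] {η : DForm n 𝕜 X m} {K : Set X}
    (hK : IsCompact K) (h : ∀ x ∉ K, η x = 0) {x : X} (hx : x ∉ K) : η.extD x = 0 := by
  set e := chartAt (Rn n) x with he
  have h1 : η.inChart e =ᶠ[nhds (e x)] 0 := by
    have h2 : ∀ᶠ z in nhds (e x), e.symm z ∈ Kᶜ := by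
      apply (e.symm.continuousAt (e.map_source (mem_chart_source _ x))).eventually
      rw [e.left_inv (mem_chart_source _ x)]
      exact hK.isClosed.isOpen_compl.mem_nhds hx
    filter_upwards [h2] with z hz
    simp only [DForm.inChart, h _ hz]
    rfl
  have h3 : extDeriv (η.inChart e) (e x) = 0 := by
    rw [h1.extDeriv_eq, extDeriv]
    have : fderiv ℝ (0 : Rn n → (Rn n) [⋀^Fin m]→L[ℝ] 𝕜) (e x) = 0 := by simp
    rw [this]
    exact map_zero (ContinuousAlternatingMap.alternatizeUncurryFinCLM ℝ (Rn n) 𝕜)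
  unfold DForm.extD
  rw [← he, h3]
  rfl

theorem DForm.differentiableAt_chart [IsManifold 𝓘(ℝ, Rn n) ∞ X] {η : DForm n 𝕜 X m}
    (hη : η.IsSmoothOn ⊤) (x : X) :
    DifferentiableAt ℝ (η.inChart (chartAt (Rn n) x)) (chartAt (Rn n) x x) := by
  have := hη (chartAt (Rn n) x) (IsManifold.chart_mem_maximalAtlas _)
  simp only [Opens.coe_top, Set.preimage_univ, Set.inter_univ] at this
  exact (this.contDiffAt ((chartAt (Rn n) x).open_target.mem_nhds
    ((chartAt (Rn n) x).map_source (mem_chart_source _ x)))).differentiableAt (by simp)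

/-- The exterior derivative on test forms. -/
def TestForm.d [IsManifold 𝓘(ℝ, Rn n) ∞ X] [T2Space X] {U : Opens X} :
    TestForm n 𝕜 m U →ₗ[𝕜] TestForm n 𝕜 (m + 1) U where
  toFun φ := Subtype.mk φ.1.extD ⟨φ.2.1.extD, φ.2.2.imp fun _ hK =>
    ⟨hK.1, hK.2.1, fun _ hx => DForm.extD_eq_zero hK.1 hK.2.2 hx⟩⟩
  map_add' φ ψ := by
    refine Subtype.ext (funext fun x => ?_)
    change DForm.extD (φ.1 + ψ.1) x = DForm.extD φ.1 x + DForm.extD ψ.1 x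
    simp only [DForm.extD, DForm.inChart_add]
    rw [extDeriv_add (DForm.differentiableAt_chart φ.2.1 x) (DForm.differentiableAt_chart ψ.2.1 x)]
    rfl
  map_smul' c φ := by
    refine Subtype.ext (funext fun x => ?_)
    change DForm.extD (c • φ.1) x = c • DForm.extD φ.1 x
    simp only [DForm.extD, DForm.inChart_smul]
    rw [extDeriv, fderiv_const_smul (DForm.differentiableAt_chart φ.2.1 x),
      ContinuousAlternatingMap.alternatizeUncurryFin_smul]
    rfl

/-- Continuity of a linear functional on test forms for the usual topology of uniform convergence
of all derivatives with supports in a fixed compact set: on test forms supported in a compact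
subset of a chart, the functional is bounded by finitely many sup norms of derivatives in that
chart. -/
def IsContinuousFunctional {U : Opens X} (T : TestForm n 𝕜 m U →ₗ[𝕜] 𝕜) : Prop :=
  ∀ e ∈ SmoothCharts n X, ∀ K : Set X, IsCompact K → K ⊆ e.source → K ⊆ U →
    ∃ (C : ℝ) (N : ℕ), ∀ φ : TestForm n 𝕜 m U, (∀ x ∉ K, φ.1 x = 0) → ∀ M : ℝ, 0 ≤ M →
      (∀ i ≤ N, ∀ y ∈ e.target, ‖iteratedFDeriv ℝ i (φ.1.inChart e) y‖ ≤ M) → ‖T φ‖ ≤ C * M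

variable (n 𝕜) in
/-- The space of continuous linear functionals on the test forms of degree `m` on `U`. -/
def currents (m : ℕ) (U : Opens X) : Submodule 𝕜 (TestForm n 𝕜 m U →ₗ[𝕜] 𝕜) where
  carrier := {T | IsContinuousFunctional T}
  zero_mem' := fun e _ K _ _ _ => ⟨0, 0, fun φ _ M _ _ => by simp⟩
  add_mem' := by
    intro S T hS hT e he K hK hKe hKU
    obtain ⟨C, N, h⟩ := hS e he K hK hKe hKU
    obtain ⟨C', N', h'⟩ := hT e he K hK hKe hKU
    refine ⟨C + C', max N N', fun φ hφ M hM hb => ?_⟩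
    have h1 := h φ hφ M hM fun i hi => hb i (hi.trans (le_max_left _ _))
    have h2 := h' φ hφ M hM fun i hi => hb i (hi.trans (le_max_right _ _))
    calc ‖(S + T) φ‖ ≤ ‖S φ‖ + ‖T φ‖ := norm_add_le _ _
      _ ≤ (C + C') * M := by linarith
  smul_mem' := by
    intro c T hT e he K hK hKe hKU
    obtain ⟨C, N, h⟩ := hT e he K hK hKe hKU
    refine ⟨‖c‖ * C, N, fun φ hφ M hM hb => ?_⟩
    have h1 := h φ hφ M hM hb
    calc ‖(c • T) φ‖ = ‖c‖ * ‖T φ‖ := norm_smul c (T φ)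
      _ ≤ ‖c‖ * (C * M) := by gcongr
      _ = ‖c‖ * C * M := by ring

variable (n 𝕜) in
/-- The currents of dimension `m` (of degree `n - m`) on the open set `U`: continuous linear
functionals on the test forms of degree `m` on `U`. -/
def Current (m : ℕ) (U : Opens X) : Type u := currents n 𝕜 m U

instance (U : Opens X) : AddCommGroup (Current n 𝕜 m U) :=
  inferInstanceAs (AddCommGroup (currents n 𝕜 m U))

instance (U : Opens X) : Module 𝕜 (Current n 𝕜 m U) :=
  inferInstanceAs (Module 𝕜 (currents n 𝕜 m U))

/-- Restriction of currents to a smaller open set. -/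
def Current.res {U V : Opens X} (h : V ≤ U) : Current n 𝕜 m U →ₗ[𝕜] Current n 𝕜 m V where
  toFun T := Subtype.mk (T.1.comp (TestForm.extend h)) fun e he K hK hKe hKV => by
    obtain ⟨C, N, hC⟩ := T.2 e he K hK hKe (hKV.trans h)
    exact ⟨C, N, fun φ hφ M hM hb => hC (TestForm.extend h φ) hφ M hM hb⟩
  map_add' _ _ := rfl
  map_smul' _ _ := rfl

/-- `D = dT` in the sense of currents: `⟨D, φ⟩ = ⟨T, dφ⟩` for all test forms `φ`. -/
def Current.IsExtDeriv [IsManifold 𝓘(ℝ, Rn n) ∞ X] [T2Space X] {U : Opens X}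
    (T : Current n 𝕜 (m + 1) U) (D : Current n 𝕜 m U) : Prop :=
  ∀ φ : TestForm n 𝕜 m U, D.1 φ = T.1 (TestForm.d φ)

/-! ### Smooth forms as currents -/

variable (n X) in
/-- An orientation of `X`, given by an atlas of smooth charts whose transition maps have positive
Jacobian determinants. -/
structure OrientedAtlas where
  charts : Set (OpenPartialHomeomorph X (Rn n))
  subset : charts ⊆ SmoothCharts n X
  cover : ∀ x : X, ∃ e ∈ charts, x ∈ e.source
  det_pos : ∀ e ∈ charts, ∀ e' ∈ charts, ∀ x ∈ e.source ∩ e'.source,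
    0 < (fderiv ℝ (fun z => e' (e.symm z)) (e x)).det

/-- The wedge product of a `k`-form and an `m`-form on `ℝⁿ` (sum over shuffles). -/
def wedge (a : (Rn n) [⋀^Fin k]→L[ℝ] 𝕜) (b : (Rn n) [⋀^Fin m]→L[ℝ] 𝕜) :
    (Rn n) [⋀^Fin k ⊕ Fin m]→ₗ[ℝ] 𝕜 :=
  (LinearMap.mul' ℝ 𝕜).compAlternatingMap (a.toAlternatingMap.domCoprod b.toAlternatingMap)

/-- For `k + m = n`, the coefficient `c` in `a ∧ b = c dx₁ ∧ ⋯ ∧ dxₙ`. -/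
def wedgeCoeff (h : k + m = n) (a : (Rn n) [⋀^Fin k]→L[ℝ] 𝕜) (b : (Rn n) [⋀^Fin m]→L[ℝ] 𝕜) : 𝕜 :=
  wedge a b fun i => EuclideanSpace.basisFun (Fin n) ℝ (finCongr h (finSumFinEquiv i))

/-- The current `T` on `U` is integration against the smooth `k`-form `α`:
`⟨T, β⟩ = (-1)^{k(k+1)/2} ∫ α ∧ β`. It is enough to say so for the test forms `β` supported
in the domain of an oriented chart, as these span all test forms. -/
def Current.IsIntegrationAgainst (𝒪 : OrientedAtlas n X) (h : k + m = n) {U : Opens X}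
    (T : Current n 𝕜 m U) (α : DForm n 𝕜 X k) : Prop :=
  ∀ e ∈ 𝒪.charts, ∀ β : TestForm n 𝕜 m U, β.1.CompactlySupportedIn e.source →
    T.1 β = (-1) ^ (k + 1).choose 2 *
      ∫ y in e.target, wedgeCoeff h (α.inChart e y) (β.1.inChart e y)

/-! ### Subsheaves of the sheaf of currents -/

variable (n 𝕜 X m) in
/-- A sheaf of currents of dimension `m`: a subsheaf (of `𝕜`-modules) of the sheaf of all
currents of dimension `m` on `X`. -/
structure CurrentSubsheaf where
  sections : ∀ U : Opens X, Submodule 𝕜 (Current n 𝕜 m U)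
  res_mem : ∀ {U V : Opens X} (h : V ≤ U) {T : Current n 𝕜 m U},
    T ∈ sections U → Current.res h T ∈ sections V
  of_locally : ∀ {U : Opens X} {T : Current n 𝕜 m U},
    (∀ x ∈ U, ∃ (V : Opens X) (h : V ≤ U), x ∈ V ∧ Current.res h T ∈ sections V) →
    T ∈ sections U

/-- `B` contains the sheaf of smooth `k`-forms. -/
def CurrentSubsheaf.ContainsSmoothForms (B : CurrentSubsheaf n 𝕜 X m) (𝒪 : OrientedAtlas n X)
    (h : k + m = n) : Prop :=
  ∀ (U : Opens X) (T : Current n 𝕜 m U) (α : DForm n 𝕜 X k),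
    α.IsSmoothOn U → T.IsIntegrationAgainst 𝒪 h α → T ∈ B.sections U

/-! ### Smears -/

/-- The open box `∏ (aᵢ, bᵢ)`. -/
def openBox (a b : Fin n → ℝ) : Set (Rn n) := {y | ∀ i, y i ∈ Set.Ioo (a i) (b i)}

/-- The closed box `∏ [aᵢ, bᵢ]`. -/
def closedBox (a b : Fin n → ℝ) : Set (Rn n) := {y | ∀ i, y i ∈ Set.Icc (a i) (b i)}

/-- `U` is the `n`-box in `X` which is `∏ (aᵢ, bᵢ)` in the coordinates `e`, relatively compact
in the domain of `e`. -/
structure IsNBox (e : OpenPartialHomeomorph X (Rn n)) (a b : Fin n → ℝ) (U : Opens X) : Prop where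
  chart : e ∈ SmoothCharts n X
  lt : ∀ i, a i < b i
  closedBox_subset : closedBox a b ⊆ e.target
  eq_image : (U : Set X) = e.symm '' openBox a b

/-- `h x t` is the flow of a vector field `σ ∂/∂t` on `ℝ` with `σ` smooth, positive on `(a, b)`
and zero elsewhere. -/
def IsIntervalFlow (a b : ℝ) (h : ℝ → ℝ → ℝ) : Prop :=
  ∃ σ : ℝ → ℝ, ContDiff ℝ ∞ σ ∧ (∀ s ∈ Set.Ioo a b, 0 < σ s) ∧ (∀ s ∉ Set.Ioo a b, σ s = 0) ∧
    ∀ x, h x 0 = x ∧ ∀ t, HasDerivAt (h x) (σ (h x t)) t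

/-- The box flow `h_t(x) = (h₁(x₁, t₁), …, hₙ(xₙ, tₙ))`. -/
def boxFlow (h : Fin n → ℝ → ℝ → ℝ) (t x : Rn n) : Rn n :=
  WithLp.toLp 2 fun i => h i (x i) (t i)

/-- The smear `∫ h_t^* η ρ(t) dt` of a form `η` on (a part of) `ℝⁿ`. -/
def smearForm (h : Fin n → ℝ → ℝ → ℝ) (ρ : Rn n → ℝ) (η : Rn n → (Rn n) [⋀^Fin m]→L[ℝ] 𝕜)
    (y : Rn n) : (Rn n) [⋀^Fin m]→L[ℝ] 𝕜 :=
  ∫ t, ρ t • (η (boxFlow h t y)).compContinuousLinearMap (fderiv ℝ (boxFlow h t) y)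

/-- `T'` is the smear of `T`, a current on an `n`-box `U` with coordinates `e`: it is given by
`⟨T', φ⟩ = ⟨T, ψ⟩` where `ψ` is the smear of `φ` for the flow `h` with the parameter negated. -/
def Current.IsSmear {U : Opens X} (e : OpenPartialHomeomorph X (Rn n)) (h : Fin n → ℝ → ℝ → ℝ)
    (ρ : Rn n → ℝ) (T T' : Current n 𝕜 m U) : Prop :=
  ∀ φ : TestForm n 𝕜 m U, ∃ ψ : TestForm n 𝕜 m U,
    (∀ y ∈ e.target, e.symm y ∈ U →
      ψ.1.inChart e y = smearForm (fun i x s => h i x (-s)) ρ (φ.1.inChart e) y) ∧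
    T'.1 φ = T.1 ψ

/-- For every `n`-box `U` in `X`, `B(U)` is closed under all smears on `U`. -/
def CurrentSubsheaf.ClosedUnderSmears (B : CurrentSubsheaf n 𝕜 X m) : Prop :=
  ∀ (U : Opens X) (e : OpenPartialHomeomorph X (Rn n)) (a b : Fin n → ℝ), IsNBox e a b U →
    ∀ (c d : Fin n → ℝ) (h : Fin n → ℝ → ℝ → ℝ) (ρ : Rn n → ℝ),
      (∀ i, a i ≤ c i ∧ c i < d i ∧ d i ≤ b i) → (∀ i, IsIntervalFlow (c i) (d i) (h i)) →
      ContDiff ℝ ∞ ρ → HasCompactSupport ρ →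
      ∀ T ∈ B.sections U, ∀ T' : Current n 𝕜 m U, T.IsSmear e h ρ T' → T' ∈ B.sections U

section Preimage

variable [IsManifold 𝓘(ℝ, Rn n) ∞ X] [T2Space X]

/-- The sections over `U` of the preimage of `B` under `d`. -/
def CurrentSubsheaf.dPreimage (B : CurrentSubsheaf n 𝕜 X m) (U : Opens X) :
    Submodule 𝕜 (Current n 𝕜 (m + 1) U) where
  carrier := {T | ∃ D ∈ B.sections U, T.IsExtDeriv D}
  zero_mem' := ⟨0, Submodule.zero_mem _, fun _ => rfl⟩
  add_mem' := by
    rintro S T ⟨D, hD, h⟩ ⟨D', hD', h'⟩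
    exact ⟨D + D', Submodule.add_mem _ hD hD', fun φ => congrArg₂ (· + ·) (h φ) (h' φ)⟩
  smul_mem' := by
    rintro c T ⟨D, hD, h⟩
    exact ⟨c • D, Submodule.smul_mem _ c hD, fun φ => congrArg (c • ·) (h φ)⟩

theorem CurrentSubsheaf.res_mem_dPreimage (B : CurrentSubsheaf n 𝕜 X m) {U V : Opens X} (h : V ≤ U)
    {T : Current n 𝕜 (m + 1) U} (hT : T ∈ B.dPreimage U) : Current.res h T ∈ B.dPreimage V := by
  obtain ⟨D, hD, hTD⟩ := hT
  exact ⟨Current.res h D, B.res_mem h hD, fun φ => hTD (TestForm.extend h φ)⟩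

/-- The restriction maps of `B'`. -/
def CurrentSubsheaf.dPreimageRes (B : CurrentSubsheaf n 𝕜 X m) {U V : Opens X} (h : V ≤ U) :
    B.dPreimage U →ₗ[𝕜] B.dPreimage V :=
  (Current.res h).restrict fun _ hT => B.res_mem_dPreimage h hT

/-- The presheaf `B'`, the preimage of `B` under `d`. -/
def CurrentSubsheaf.dPreimagePresheaf (B : CurrentSubsheaf n 𝕜 X m) :
    TopCat.Presheaf AddCommGrpCat.{u} (TopCat.of X) where
  obj U := AddCommGrpCat.of (B.dPreimage U.unop)
  map i := AddCommGrpCat.ofHom (B.dPreimageRes i.unop.le).toAddMonoidHom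
  map_id _ := rfl
  map_comp _ _ := rfl

end Preimage

end Currents

/-! ### Soft and acyclic sheaves -/

/-- `F` is soft: for every closed `K`, every section of `F` over `K`, that is, every family
of germs at the points of `K` which near each point of `K` is induced by a section of `F` over an
open set, is induced by a global section. -/
def IsSoft {X : TopCat.{u}} (F : TopCat.Sheaf AddCommGrpCat.{u} X) : Prop :=
  ∀ K : Set X, IsClosed K → ∀ s : (∀ x ∈ K, F.presheaf.stalk x),
    (∀ x ∈ K, ∃ U : Opens X, x ∈ U ∧ ∃ t : F.presheaf.obj (op U),
      ∀ (y : X) (hy : y ∈ K) (hU : y ∈ U), F.presheaf.germ U y hU t = s y hy) →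
    ∃ g : F.presheaf.obj (op ⊤), ∀ (x : X) (hx : x ∈ K), F.presheaf.germ ⊤ x trivial g = s x hx

/-- `F` is `Γ`-acyclic: its sheaf cohomology vanishes in all positive degrees. -/
def IsGammaAcyclic {X : TopCat.{u}} (F : TopCat.Sheaf AddCommGrpCat.{u} X) : Prop :=
  ∀ j : ℕ, 1 ≤ j → Subsingleton (F.H j)

end

/-!
The preimage `B'` of `B` under `d` is a sheaf because currents glue along partitions of unity
(`Current.exists_glue`) and membership of `dT` in `B` is a local condition
(`CurrentSubsheaf.isSheaf_dPreimagePresheaf`).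

Acyclicity follows from softness (`IsSoft.isGammaAcyclic`). On a `σ`-compact locally compact
Hausdorff space a section of the quotient by a soft subsheaf lifts over closed sets
(`exists_lift_sectionOver`): local lifts along a locally finite cover are corrected one after the
other. Hence global sections are exact on sequences with soft kernel, and quotients of soft sheaves
by soft subsheaves are soft. Injective sheaves are flasque, flasque sheaves are soft, and one
shifts dimensions.

Softness in turn follows once sections can be cut off around each point (`HasCutoff`,
`isSoft_of_hasCutoff`): a section over a neighbourhood `U` should agree on a smaller
neighbourhood `N` with a global section which vanishes outside `U` and wherever, on a given closed
set, the original section does. The last clause makes it possible to extend a section over a closed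
set as a locally finite sum of cut-offs.

A current `T` with `dT ∈ B` cannot be multiplied by a cut-off function `χ`, since
`d(χT) = dχ ∧ T + χ dT` need not belong to `B`. It can where `T` is smooth, because `B` contains
the smooth forms. So `T` is first made smooth where `χ` varies, by a smear:
* smears commute with `d`, so they preserve `B'` (`SmearData.smear_mem_dPreimage`);
* where no coordinate lies in its interval of the flow, the smear of `T` is equal to `T`, if the
  weight `ρ` has integral `1` (`SmearData.res_smear_eq_self`);
* inside the box the flow is simply transitive, so that the smear is an integral operator with a
  smooth kernel, and the smear of `T` is given by a smooth density (`SmearData.exists_density`).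
  By the perfectness of the wedge pairing (`exists_wedgeCoeff_linear`) and integration by parts
  (`exists_adjoint_extDeriv`), a current with a smooth density belongs to `B'`
  (`CurrentSubsheaf.mem_dPreimage_of_density`), also after multiplication by `χ`;
* if the support of `ρ` is small, zeros of `T` on a compact set are preserved
  (`SmearData.vanishesAt_smear`, `eventually_backFlow`).

Each coordinate has its own flow. Where some coordinates lie in the intervals of the flow and others
do not, the smear need be neither smooth nor equal to `T`, and `χ` has to be constant. In the tilted
coordinates `zᵢ = ± yᵢ`, `zⱼ = ± yᵢ + ε yⱼ` all coordinates are close to `± yᵢ` on a smaller cube.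
With the same interval for every coordinate, the bad region within this cube is confined to values
of `± yᵢ` near the ends of the interval, and `χ` may vary in the middle. This cuts off `T` along one
face of a cube (`exists_cut_hyperplane`, `exists_cut_cube`). After the `2n` faces a current is left
which vanishes near the boundary of a cube, and which extends by zero (`exists_cut_list`,
`exists_cutoff`).
-/

noncomputable section

/-! ### Covers -/

/-- On a `σ`-compact locally compact Hausdorff space, arbitrarily small pairs `N ≤ U` of open
neighbourhoods satisfying a property `P` can be arranged into a sequence such that the `N i`
cover the space and the `U i` are locally finite and subordinate to given neighbourhoods. -/
theorem exists_locallyFinite_seq_of_small_pairs {X : Type u} [TopologicalSpace X] [T2Space X]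
    [LocallyCompactSpace X] [SigmaCompactSpace X] (P : Opens X → Opens X → Prop)
    (hbot : P ⊥ ⊥) (hP : ∀ (x : X) (W : Opens X), x ∈ W → ∃ N U : Opens X,
      x ∈ N ∧ N ≤ U ∧ U ≤ W ∧ P N U) (W : X → Opens X) (hW : ∀ x, x ∈ W x) :
    ∃ N U : ℕ → Opens X, (∀ i, P (N i) (U i)) ∧ (∀ i, N i ≤ U i) ∧
      (∀ i, U i = ⊥ ∨ ∃ x, U i ≤ W x) ∧
      LocallyFinite (fun i => (U i : Set X)) ∧ ∀ x, ∃ i, x ∈ N i := by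
  classical
  let K : CompactExhaustion X := default
  -- The shells of the exhaustion; the shell of index `0` is `K 0` itself.
  let C : ℕ → Set X := fun n => if n = 0 then K 0 else K n \ interior (K (n - 1))
  have hCc : ∀ n, IsCompact (C n) := by
    intro n
    by_cases h : n = 0
    · simp only [C, h, if_true]; exact K.isCompact 0
    · simp only [C, h, if_false]; exact (K.isCompact _).diff isOpen_interior
  let V : ℕ → X → Opens X := fun n x =>
    W x ⊓ ⟨interior (K (n + 1)) ∩ (if n ≤ 1 then Set.univ else (K (n - 2))ᶜ),
      isOpen_interior.inter (by
        split_ifs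
        · exact isOpen_univ
        · exact (K.isCompact _).isClosed.isOpen_compl)⟩
  have hV : ∀ n, ∀ x ∈ C n, x ∈ V n x := by
    intro n x hx
    have hxn : x ∈ K n := by
      by_cases h : n = 0
      · simp only [C, h, if_true] at hx; rw [h]; exact hx
      · simp only [C, h, if_false] at hx; exact hx.1
    refine ⟨hW x, K.subset_interior_succ _ hxn, ?_⟩
    split_ifs with h
    · trivial
    · intro h2
      simp only [C, show n ≠ 0 by omega, if_false] at hx
      apply hx.2
      have := K.subset_interior_succ (n - 2) h2
      rwa [show n - 2 + 1 = n - 1 by omega] at this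
  have hch : ∀ n x, ∃ N U : Opens X, (x ∈ C n → x ∈ N) ∧ N ≤ U ∧ U ≤ V n x ∧ P N U := by
    intro n x
    by_cases hx : x ∈ C n
    · obtain ⟨N, U, h1, h2, h3, h4⟩ := hP x (V n x) (hV n x hx)
      exact ⟨N, U, fun _ => h1, h2, h3, h4⟩
    · exact ⟨⊥, ⊥, fun h => absurd h hx, le_rfl, bot_le, hbot⟩
  choose N U hxN hNU hUV hPNU using hch
  have hfin : ∀ n, ∃ t : Finset X, C n ⊆ ⋃ x ∈ t, (N n x : Set X) := by
    intro n
    obtain ⟨t, -, ht⟩ := (hCc n).elim_nhds_subcover (fun x => (N n x : Set X))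
      (fun x hx => (N n x).isOpen.mem_nhds (hxN n x hx))
    exact ⟨t, ht⟩
  choose t ht using hfin
  have : Countable (Σ n, t n) := inferInstance
  obtain ⟨enc⟩ := nonempty_encodable (Σ n, t n)
  let N' : ℕ → Opens X := fun i => ((Encodable.decode₂ (Σ n, t n) i).elim ⊥ fun p => N p.1 p.2)
  let U' : ℕ → Opens X := fun i => ((Encodable.decode₂ (Σ n, t n) i).elim ⊥ fun p => U p.1 p.2)
  refine ⟨N', U', fun i => ?_, fun i => ?_, fun i => ?_, ?_, ?_⟩
  · rcases h : Encodable.decode₂ (Σ n, t n) i with - | p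
    · simp only [N', U', h]; exact hbot
    · simp only [N', U', h]; exact hPNU _ _
  · rcases h : Encodable.decode₂ (Σ n, t n) i with - | p
    · simp only [N', U', h]; exact le_rfl
    · simp only [N', U', h]; exact hNU _ _
  · rcases h : Encodable.decode₂ (Σ n, t n) i with - | p
    · simp only [U', h]; exact Or.inl rfl
    · simp only [U', h]; exact Or.inr ⟨p.2, (hUV _ _).trans inf_le_left⟩
  · intro x
    obtain ⟨m, hm⟩ := K.exists_mem x
    refine ⟨interior (K (m + 1)), isOpen_interior.mem_nhds (K.subset_interior_succ _ hm), ?_⟩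
    have hfin : {p : Σ n, t n | p.1 ≤ m + 2}.Finite := by
      have : {p : Σ n, t n | p.1 ≤ m + 2} =
          ⋃ n ∈ Set.Iic (m + 2), (fun q : t n => (⟨n, q⟩ : Σ n, t n)) '' Set.univ := by
        ext ⟨n, q⟩
        simp only [Set.mem_ofPred_eq, Set.image_univ, Set.mem_Iic, Set.mem_iUnion, Set.mem_range]
        exact ⟨fun h => ⟨n, h, q, rfl⟩, by rintro ⟨n', h, q', e⟩; cases e; exact h⟩
      rw [this]
      exact (Set.finite_Iic _).biUnion fun n _ => Set.toFinite _
    refine (hfin.image (Encodable.encode)).subset ?_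
    rintro i ⟨y, hy, hy'⟩
    rcases h : Encodable.decode₂ (Σ n, t n) i with - | p
    · simp only [U', h] at hy; exact absurd hy (by simp)
    · simp only [U', h] at hy
      refine ⟨p, ?_, Encodable.mem_decode₂.1 h⟩
      by_contra hp
      simp only [Set.mem_ofPred_eq, not_le] at hp
      have h3 := (hUV _ _ hy).2.2
      rw [if_neg (by omega)] at h3
      exact h3 (K.subset (by omega) (interior_subset hy'))
  · intro x
    have hex := K.exists_mem x
    have h1 := Nat.find_spec hex
    set n := Nat.find hex with hn
    have hxC : x ∈ C n := by
      by_cases h : n = 0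
      · simp only [C, h, if_true]; rw [h] at h1; exact h1
      · simp only [C, h, if_false]
        exact ⟨h1, fun h2 => Nat.find_min hex (m := n - 1) (by omega) (interior_subset h2)⟩
    obtain ⟨y, hy, hxy⟩ := Set.mem_iUnion₂.1 (ht n hxC)
    refine ⟨Encodable.encode (⟨n, ⟨y, hy⟩⟩ : Σ n, t n), ?_⟩
    simp only [N', Encodable.decode₂_encode]
    exact hxy

/-! ### Sections over arbitrary subsets -/

section Germs

variable {X : TopCat.{u}}

/-- A family of germs is a section of `F` over the set `K` if near each point of `K` it is
induced on `K` by a section over an open set. The values outside `K` are irrelevant. -/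
def IsSectionOver (F : TopCat.Sheaf AddCommGrpCat.{u} X) (K : Set X)
    (s : ∀ x, F.presheaf.stalk x) : Prop :=
  ∀ x ∈ K, ∃ U : Opens X, x ∈ U ∧ ∃ t : F.presheaf.obj (op U),
    ∀ (y : X) (_ : y ∈ K) (hU : y ∈ U), F.presheaf.germ U y hU t = s y

variable {F G : TopCat.Sheaf AddCommGrpCat.{u} X}

theorem germ_map (F : TopCat.Sheaf AddCommGrpCat.{u} X) {U V : Opens X} (h : V ≤ U) (x : X)
    (hx : x ∈ V) (t : F.presheaf.obj (op U)) :
    F.presheaf.germ V x hx (F.presheaf.map (homOfLE h).op t) = F.presheaf.germ U x (h hx) t :=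
  TopCat.Presheaf.germ_res_apply _ _ _ _ _

/-- The homomorphism of stalks induced by a morphism of sheaves. -/
def stalkMap (f : F ⟶ G) (x : X) : F.presheaf.stalk x →+ G.presheaf.stalk x :=
  ((TopCat.Presheaf.stalkFunctor AddCommGrpCat x).map f.hom).hom

theorem germ_app (f : F ⟶ G) {U : Opens X} (x : X) (hx : x ∈ U) (t : F.presheaf.obj (op U)) :
    G.presheaf.germ U x hx (f.hom.app (op U) t) = stalkMap f x (F.presheaf.germ U x hx t) :=
  (TopCat.Presheaf.stalkFunctor_map_germ_apply U x hx f.hom t).symm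

theorem exists_map_eq_of_germ_eq (F : TopCat.Sheaf AddCommGrpCat.{u} X) {U V : Opens X} {x : X}
    (hU : x ∈ U) (hV : x ∈ V) {s : F.presheaf.obj (op U)} {t : F.presheaf.obj (op V)}
    (h : F.presheaf.germ U x hU s = F.presheaf.germ V x hV t) :
    ∃ (W : Opens X) (hWU : W ≤ U) (hWV : W ≤ V), x ∈ W ∧
      F.presheaf.map (homOfLE hWU).op s = F.presheaf.map (homOfLE hWV).op t := by
  obtain ⟨W, hW, i, j, h⟩ := TopCat.Presheaf.germ_eq F.presheaf x hU hV s t h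
  exact ⟨W, i.le, j.le, hW, h⟩

/-- Sections with the same germ at a point have the same germs nearby. -/
theorem exists_germ_eqOn (F : TopCat.Sheaf AddCommGrpCat.{u} X) {U V : Opens X} {x : X}
    (hU : x ∈ U) (hV : x ∈ V) {s : F.presheaf.obj (op U)} {t : F.presheaf.obj (op V)}
    (h : F.presheaf.germ U x hU s = F.presheaf.germ V x hV t) :
    ∃ (W : Opens X) (hWU : W ≤ U) (hWV : W ≤ V), x ∈ W ∧ ∀ (y : X) (hy : y ∈ W),
      F.presheaf.germ U y (hWU hy) s = F.presheaf.germ V y (hWV hy) t := by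
  obtain ⟨W, i, j, hx, h⟩ := exists_map_eq_of_germ_eq F hU hV h
  refine ⟨W, i, j, hx, fun y hy => ?_⟩
  rw [← germ_map F i y hy, h, germ_map]

/-- Over an open set, a section in the sense of germs is given by a section. -/
theorem IsSectionOver.exists_section {W : Opens X} {s : ∀ x, F.presheaf.stalk x}
    (hs : IsSectionOver F W s) :
    ∃ t : F.presheaf.obj (op W), ∀ (x : X) (hx : x ∈ W), F.presheaf.germ W x hx t = s x := by
  choose U hxU t ht using hs
  let ι := {x // x ∈ W}
  let U' : ι → Opens X := fun i => U i.1 i.2 ⊓ W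
  have hU' : iSup U' = W := by
    refine le_antisymm (iSup_le fun i => inf_le_right) fun x hx => ?_
    exact Opens.mem_iSup.2 ⟨⟨x, hx⟩, hxU x hx, hx⟩
  let t' : ∀ i : ι, F.presheaf.obj (op (U' i)) :=
    fun i => F.presheaf.map (homOfLE inf_le_left).op (t i.1 i.2)
  have ht' : ∀ (i : ι) (y : X) (hy : y ∈ U' i), F.presheaf.germ (U' i) y hy (t' i) = s y := by
    intro i y hy
    exact (germ_map F inf_le_left y hy _).trans (ht i.1 i.2 y hy.2 hy.1)
  have hcomp : TopCat.Presheaf.IsCompatible F.1 U' t' := by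
    intro i j
    refine TopCat.Presheaf.section_ext F _ _ _ fun y hy => ?_
    have h1 := germ_map F (Opens.infLELeft (U' i) (U' j)).le y hy (t' i)
    have h2 := germ_map F (Opens.infLERight (U' i) (U' j)).le y hy (t' j)
    refine h1.trans (Eq.trans ?_ h2.symm)
    rw [ht', ht']
  obtain ⟨g, hg, -⟩ := F.existsUnique_gluing U' t' hcomp
  refine ⟨F.presheaf.map (eqToHom hU'.symm).op g, fun x hx => ?_⟩
  have hx' : x ∈ U' ⟨x, hx⟩ := ⟨hxU x hx, hx⟩
  rw [← ht' ⟨x, hx⟩ x hx', ← hg ⟨x, hx⟩]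
  refine (germ_map F hU'.ge x hx g).trans ?_
  exact (germ_map F (Opens.leSupr U' ⟨x, hx⟩).le x hx' g).symm

/-- Softness in terms of families of germs, which may be prescribed off the closed set at will. -/
theorem isSoft_iff (F : TopCat.Sheaf AddCommGrpCat.{u} X) :
    IsSoft F ↔ ∀ K : Set X, IsClosed K → ∀ s : ∀ x, F.presheaf.stalk x, IsSectionOver F K s →
      ∃ g : F.presheaf.obj (op ⊤), ∀ x ∈ K, F.presheaf.germ ⊤ x trivial g = s x := by
  classical
  refine ⟨fun h K hK s hs => ?_, fun h K hK s hs => ?_⟩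
  · exact h K hK (fun x _ => s x) hs
  · obtain ⟨g, hg⟩ := h K hK (fun x => if hx : x ∈ K then s x hx else 0) (by
      intro x hx
      obtain ⟨U, hU, t, ht⟩ := hs x hx
      refine ⟨U, hU, t, fun y hy hyU => ?_⟩
      exact (ht y hy hyU).trans (dif_pos hy).symm)
    refine ⟨g, fun x hx => ?_⟩
    exact (hg x hx).trans (dif_pos hx)

/-! ### Sheaves whose sections can be cut off -/

/-- Sections over `U` can be cut off outside of `N`: they agree on `N` with a global section
which vanishes outside `U`, and also at the points of a prescribed closed set at which the given
section vanishes. -/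
def HasCutoff (F : TopCat.Sheaf AddCommGrpCat.{u} X) (N U : Opens X) : Prop :=
  ∀ t : F.presheaf.obj (op U), ∀ L : Set X, IsClosed L →
    (∀ (y : X) (hU : y ∈ U), y ∈ L → F.presheaf.germ U y hU t = 0) →
    ∃ g : F.presheaf.obj (op ⊤),
      (∀ (y : X) (hU : y ∈ U), y ∈ N → F.presheaf.germ ⊤ y trivial g = F.presheaf.germ U y hU t) ∧
      (∀ y ∈ L, F.presheaf.germ ⊤ y trivial g = 0) ∧
      ∀ y ∉ U, F.presheaf.germ ⊤ y trivial g = 0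

theorem hasCutoff_bot (F : TopCat.Sheaf AddCommGrpCat.{u} X) : HasCutoff F ⊥ ⊥ :=
  fun _ _ _ _ => ⟨0, fun _ hU => absurd hU (by simp), fun _ _ => map_zero _, fun _ _ => map_zero _⟩

/-- A sequence of sections over closed sets, each of which changes the previous one only in a
member of a locally finite family, is eventually constant near every point. -/
theorem exists_eventual_section {K : Set X} {U : ℕ → Opens X}
    (hU : LocallyFinite fun i => (U i : Set X)) {B : ℕ → Set X} (T : ℕ → ∀ x, F.presheaf.stalk x)
    (hT : ∀ i, IsSectionOver F (K ∩ B i) (T i)) (hTU : ∀ i, ∀ x ∉ U i, T (i + 1) x = T i x)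
    (hB : ∀ x, ∃ O : Opens X, x ∈ O ∧ ∃ m, ∀ i ≥ m, ∀ y ∈ O, y ∈ B i) :
    ∃ s : ∀ x, F.presheaf.stalk x, IsSectionOver F K s ∧ ∀ x, ∃ m, ∀ i ≥ m, s x = T i x := by
  have key : ∀ x, ∃ O : Opens X, x ∈ O ∧ ∃ m, ∀ i ≥ m, ∀ y ∈ O, T i y = T m y := by
    intro x
    obtain ⟨O, hO, hfin⟩ := hU x
    obtain ⟨O', hO', ho, hx⟩ := mem_nhds_iff.1 hO
    obtain ⟨m, hm⟩ := hfin.bddAbove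
    refine ⟨⟨O', ho⟩, hx, m + 1, fun i hi y hy => ?_⟩
    induction i, hi using Nat.le_induction with
    | base => rfl
    | succ i hi ih =>
      rw [← ih]
      refine hTU i y fun hyU => ?_
      have := hm (show i ∈ _ from ⟨y, hyU, hO' hy⟩)
      omega
  choose O hxO m hm using key
  refine ⟨fun x => T (m x) x, fun x hx => ?_,
    fun x => ⟨m x, fun i hi => (hm x i hi x (hxO x)).symm⟩⟩
  obtain ⟨O', hxO', m', hm'⟩ := hB x
  set M := max (m x) m'
  obtain ⟨V, hxV, t, ht⟩ := hT M x ⟨hx, hm' M (le_max_right _ _) x hxO'⟩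
  refine ⟨V ⊓ O x ⊓ O', ⟨⟨hxV, hxO x⟩, hxO'⟩,
    F.presheaf.map (homOfLE (inf_le_left.trans inf_le_left)).op t, fun y hy hyV => ?_⟩
  rw [germ_map F (inf_le_left.trans inf_le_left) y hyV t,
    ht y ⟨hy, hm' M (le_max_right _ _) y hyV.2⟩]
  have h1 := hm x (max M (m y)) ((le_max_left _ _).trans (le_max_left _ _)) y hyV.1.2
  have h2 := hm y (max M (m y)) (le_max_right _ _) y (hxO y)
  have h3 := hm x M (le_max_left _ _) y hyV.1.2
  rw [h3, ← h1, h2]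

variable [T2Space X] [LocallyCompactSpace X] [SigmaCompactSpace X]

/-- A sheaf with arbitrarily small cut-offs is soft: a section over a closed set is the sum of a
locally finite series of cut-offs, each of which corrects the error of the preceding ones near one
more piece of the closed set without destroying what has been achieved. -/
theorem isSoft_of_hasCutoff (F : TopCat.Sheaf AddCommGrpCat.{u} X)
    (hF : ∀ (x : X) (W : Opens X), x ∈ W → ∃ N U : Opens X,
      x ∈ N ∧ N ≤ U ∧ U ≤ W ∧ HasCutoff F N U) : IsSoft F := by
  rw [isSoft_iff]
  intro K hK s hs
  have hloc : ∀ x, ∃ W : Opens X, x ∈ W ∧ ∃ t : F.presheaf.obj (op W),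
      ∀ (y : X) (_ : y ∈ K) (hU : y ∈ W), F.presheaf.germ W y hU t = s y := by
    intro x
    by_cases hx : x ∈ K
    · exact hs x hx
    · exact ⟨⟨Kᶜ, hK.isOpen_compl⟩, hx, 0, fun y hy hy' => absurd hy hy'⟩
  choose W hxW t ht using hloc
  obtain ⟨N, U, hcut, hNU, hUW, hfin, hcov⟩ :=
    exists_locallyFinite_seq_of_small_pairs (HasCutoff F) (hasCutoff_bot F) hF W hxW
  have hloc' : ∀ i, ∃ t : F.presheaf.obj (op (U i)),
      ∀ (y : X) (_ : y ∈ K) (hU : y ∈ U i), F.presheaf.germ (U i) y hU t = s y := by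
    intro i
    rcases hUW i with h | ⟨x, h⟩
    · exact ⟨0, fun y _ hy => by rw [h] at hy; exact absurd hy (by simp)⟩
    · exact ⟨F.presheaf.map (homOfLE h).op (t x), fun y hy hU =>
        (germ_map F h y hU _).trans (ht x y hy _)⟩
  choose t' ht' using hloc'
  obtain ⟨A, hAcov, hAc, hAN⟩ := exists_iUnion_eq_closed_subset (fun i => (N i).isOpen)
    (fun x => (hfin.subset hNU).point_finite x)
    (Set.eq_univ_of_forall fun x => Set.mem_iUnion.2 (hcov x))
  have step : ∀ (i : ℕ) (g : F.presheaf.obj (op ⊤)),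
      ∃ g' : F.presheaf.obj (op ⊤),
        (∀ y ∉ U i, F.presheaf.germ ⊤ y trivial g' = F.presheaf.germ ⊤ y trivial g) ∧
        ((∀ y ∈ K, (∃ j < i, y ∈ A j) → F.presheaf.germ ⊤ y trivial g = s y) →
          ∀ y ∈ K, (∃ j < i + 1, y ∈ A j) → F.presheaf.germ ⊤ y trivial g' = s y) := by
    intro i g
    by_cases hg : ∀ y ∈ K, (∃ j < i, y ∈ A j) → F.presheaf.germ ⊤ y trivial g = s y
    swap
    · exact ⟨g, fun _ _ => rfl, fun h => absurd h hg⟩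
    set r := t' i - F.presheaf.map (homOfLE le_top).op g with hr
    have hrg : ∀ (y : X) (hU : y ∈ U i), y ∈ K →
        F.presheaf.germ (U i) y hU r = s y - F.presheaf.germ ⊤ y trivial g := by
      intro y hU hyK
      rw [hr, map_sub, ht' i y hyK hU, germ_map]
    obtain ⟨c, hc1, hc2, hc3⟩ := hcut i r (K ∩ ⋃ j ∈ Set.Iio i, A j)
      (hK.inter ((Set.finite_Iio i).isClosed_biUnion fun j _ => hAc j)) (by
        rintro y hU ⟨hyK, hy⟩
        rw [hrg y hU hyK, hg y hyK, sub_self]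
        simpa using hy)
    refine ⟨g + c, fun y hy => by rw [map_add, hc3 y hy, add_zero], fun _ y hyK hy => ?_⟩
    rw [map_add]
    by_cases hy' : ∃ j < i, y ∈ A j
    · rw [hc2 y ⟨hyK, by simpa using hy'⟩, add_zero, hg y hyK hy']
    · obtain ⟨j, hj, hyA⟩ := hy
      have hji : j = i := by
        by_contra hne
        exact hy' ⟨j, by omega, hyA⟩
      subst hji
      have hyN := hAN j hyA
      rw [hc1 y (hNU j hyN) hyN, hrg y (hNU j hyN) hyK, add_sub_cancel]
  choose nxt hn1 hn2 using step
  let g : ℕ → F.presheaf.obj (op ⊤) := fun i => Nat.rec 0 nxt i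
  have hgA : ∀ i, ∀ y ∈ K, (∃ j < i, y ∈ A j) → F.presheaf.germ ⊤ y trivial (g i) = s y := by
    intro i
    induction i with
    | zero => rintro y - ⟨j, hj, -⟩; omega
    | succ i ih => exact hn2 i (g i) ih
  obtain ⟨s', hs', hs'T⟩ := exists_eventual_section (F := F) (K := Set.univ)
    (B := fun _ => Set.univ) hfin (fun i x => F.presheaf.germ ⊤ x trivial (g i))
    (fun i x _ => ⟨⊤, trivial, g i, fun _ _ _ => rfl⟩) (fun i x hx => hn1 i (g i) x hx)
    (fun x => ⟨⊤, trivial, 0, fun _ _ _ _ => trivial⟩)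
  obtain ⟨G, hG⟩ := IsSectionOver.exists_section (W := ⊤) hs'
  refine ⟨G, fun x hx => ?_⟩
  obtain ⟨m, hm⟩ := hs'T x
  obtain ⟨j, hj⟩ := Set.mem_iUnion.1 (hAcov.ge (Set.mem_univ x))
  refine (hG x trivial).trans ((hm (max m (j + 1)) (le_max_left _ _)).trans ?_)
  exact hgA _ x hx ⟨j, by omega, hj⟩

end Germs

/-! ### Soft sheaves are acyclic -/

section Acyclic

variable {X : TopCat.{u}}

/-- A flasque sheaf has cut-offs to any closed neighbourhood inside an open set. -/
theorem hasCutoff_of_isFlasque (F : TopCat.Sheaf AddCommGrpCat.{u} X) [F.IsFlasque]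
    {N U : Opens X} (hNU : closure (N : Set X) ⊆ U) : HasCutoff F N U := by
  classical
  intro t L _ hL
  let Z : Set X := {x | (∃ hx : x ∈ U, F.presheaf.germ U x hx t = 0) ∨ x ∉ closure (N : Set X)}
  have hZ : IsOpen Z := by
    rw [isOpen_iff_mem_nhds]
    rintro x (⟨hx, h⟩ | hx)
    · obtain ⟨W, i, j, hxW, h⟩ := exists_germ_eqOn F (U := U) (V := U) hx hx (s := t) (t := 0)
        (by rw [h, map_zero])
      filter_upwards [W.isOpen.mem_nhds hxW] with y hy
      exact Or.inl ⟨i hy, by rw [h y hy, map_zero]⟩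
    · filter_upwards [isClosed_closure.isOpen_compl.mem_nhds hx] with y hy
      exact Or.inr hy
  let W : Opens X := N ⊔ ⟨Z, hZ⟩
  let s : ∀ x, F.presheaf.stalk x := fun x =>
    if h : x ∈ N then F.presheaf.germ U x (hNU (subset_closure h)) t else 0
  have hs : IsSectionOver F W s := by
    rintro x (hx | hx)
    · refine ⟨N, hx, F.presheaf.map (homOfLE fun y hy => hNU (subset_closure hy)).op t, ?_⟩
      intro y _ hy
      refine (germ_map F _ y hy t).trans ?_
      simp only [s]
      rw [dif_pos hy]
    · refine ⟨⟨Z, hZ⟩, hx, 0, fun y _ hy => ?_⟩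
      rw [map_zero]
      simp only [s]
      split_ifs with h
      · rcases hy with ⟨_, h'⟩ | h'
        · exact h'.symm
        · exact absurd (subset_closure h) h'
      · rfl
  obtain ⟨t', ht'⟩ := hs.exists_section
  have hsurj := (AddCommGrpCat.epi_iff_surjective (F.presheaf.map (homOfLE (le_top : W ≤ ⊤)).op)).1
    (TopCat.Presheaf.IsFlasque.epi _)
  obtain ⟨g, rfl⟩ := hsurj t'
  have hg : ∀ x, x ∈ W → F.presheaf.germ ⊤ x trivial g = s x := fun x hx =>
    (germ_map F le_top x hx g).symm.trans (ht' x hx)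
  refine ⟨g, fun y hU hy => (hg y (Or.inl hy)).trans (dif_pos hy), fun y hy => ?_, fun y hy => ?_⟩
  · have hyZ : y ∈ Z := by
      by_cases hU : y ∈ U
      · exact Or.inl ⟨hU, hL y hU hy⟩
      · exact Or.inr fun h => hU (hNU h)
    refine (hg y (Or.inr hyZ)).trans ?_
    simp only [s]
    split_ifs with h
    · exact hL y _ hy
    · rfl
  · have hyZ : y ∈ Z := Or.inr fun h => hy (hNU h)
    refine (hg y (Or.inr hyZ)).trans (dif_neg fun h => hy (hNU (subset_closure h)))

/-- Sections of a sheaf of abelian groups over `U` are the homomorphisms from the free abelian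
sheaf generated by `U`. -/
def freeHomEquiv (F : Sheaf (Opens.grothendieckTopology X) AddCommGrpCat.{u}) (U : Opens X) :
    ((presheafToSheaf (Opens.grothendieckTopology X) AddCommGrpCat.{u}).obj
      (yoneda.obj U ⋙ AddCommGrpCat.free) ⟶ F) ≃ F.obj.obj (op U) :=
  ((sheafificationAdjunction _ _).homEquiv _ _).trans
    ((((AddCommGrpCat.adj.whiskerRight _).homEquiv _ _)).trans yonedaEquiv)

theorem freeHomEquiv_comp (F : Sheaf (Opens.grothendieckTopology X) AddCommGrpCat.{u})
    {U V : Opens X} (i : V ⟶ U)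
    (f : (presheafToSheaf (Opens.grothendieckTopology X) AddCommGrpCat.{u}).obj
      (yoneda.obj U ⋙ AddCommGrpCat.free) ⟶ F) :
    freeHomEquiv F V ((presheafToSheaf _ _).map
      (Functor.whiskerRight (yoneda.map i) AddCommGrpCat.free) ≫ f) =
      F.obj.map i.op (freeHomEquiv F U f) := by
  simp only [freeHomEquiv, Equiv.trans_apply]
  rw [Adjunction.homEquiv_naturality_left]
  have h := Adjunction.homEquiv_naturality_left
    (AddCommGrpCat.adj.{u}.whiskerRight (Opens X)ᵒᵖ) (yoneda.map i)
    (((sheafificationAdjunction _ _).homEquiv _ _) f)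
  refine (congrArg yonedaEquiv h).trans ?_
  exact (yonedaEquiv_naturality _ _).symm

/-- Restriction from `U` to `V` is precomposition with a monomorphism between the sheaves freely
generated by `V` and `U`, hence surjective for maps into an injective sheaf. -/
theorem isFlasque_of_injective (F : Sheaf (Opens.grothendieckTopology X) AddCommGrpCat.{u})
    [Injective F] : TopCat.Sheaf.IsFlasque (X := X) F where
  epi {U V} i := by
    rw [AddCommGrpCat.epi_iff_surjective]
    intro t
    obtain ⟨f, rfl⟩ := (freeHomEquiv F V.unop).surjective t
    let j := (presheafToSheaf (Opens.grothendieckTopology X) AddCommGrpCat.{u}).map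
      (Functor.whiskerRight (yoneda.map i.unop) AddCommGrpCat.free)
    have : Mono (Functor.whiskerRight (yoneda.map i.unop) AddCommGrpCat.free.{u}) := by
      rw [NatTrans.mono_iff_mono_app]
      intro W
      have : Mono ((yoneda.map i.unop).app W) :=
        (CategoryTheory.mono_iff_injective _).2 fun a b _ =>
          Subsingleton.elim (α := W.unop ⟶ V.unop) a b
      exact inferInstanceAs (Mono (AddCommGrpCat.free.map ((yoneda.map i.unop).app W)))
    have : Mono j := inferInstance
    refine ⟨freeHomEquiv F U.unop (Injective.factorThru f j), ?_⟩
    have := freeHomEquiv_comp F i.unop (Injective.factorThru f j)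
    rw [Injective.comp_factorThru] at this
    exact this.symm

section Exact

variable {S : ShortComplex (TopCat.Sheaf AddCommGrpCat.{u} X)}

theorem stalk_map_injective (hS : S.ShortExact) (x : X) :
    Function.Injective (stalkMap S.f x) := by
  have := hS.mono_f
  have := TopCat.Presheaf.stalk_mono_of_mono S.f x
  exact (AddCommGrpCat.mono_iff_injective _).1 this

/-- An epimorphism of sheaves is locally surjective. -/
theorem exists_local_lift (hS : S.ShortExact) {U : Opens X} (t : S.X₃.presheaf.obj (op U)) {x : X}
    (hx : x ∈ U) : ∃ (V : Opens X) (h : V ≤ U) (t' : S.X₂.presheaf.obj (op V)), x ∈ V ∧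
      S.g.hom.app (op V) t' = S.X₃.presheaf.map (homOfLE h).op t := by
  have := (TopCat.Sheaf.isLocallySurjective_iff_epi S.g).mpr hS.epi_g
  obtain ⟨V, h, ⟨t', ht'⟩, hxV⟩ := (TopCat.Presheaf.isLocallySurjective_iff _).1 this U t x hx
  exact ⟨V, h, t', hxV, ht'⟩

/-- Exactness in the middle, locally. -/
theorem exists_lift_of_germ_eq_zero (hS : S.ShortExact) {U : Opens X}
    (t : S.X₂.presheaf.obj (op U)) {x : X} (hx : x ∈ U)
    (h0 : S.X₃.presheaf.germ U x hx (S.g.hom.app (op U) t) = 0) :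
    ∃ (V : Opens X) (h : V ≤ U) (c : S.X₁.presheaf.obj (op V)), x ∈ V ∧
      S.f.hom.app (op V) c = S.X₂.presheaf.map (homOfLE h).op t := by
  obtain ⟨V, i, j, hxV, h⟩ := exists_map_eq_of_germ_eq S.X₃ hx hx (t := 0)
    (h0.trans (map_zero _).symm)
  rw [map_zero] at h
  have h2 : S.g.hom.app (op V) (S.X₂.presheaf.map (homOfLE i).op t) = 0 := by
    rw [← h]
    exact ConcreteCategory.congr_hom (S.g.hom.naturality (homOfLE i).op) t
  obtain ⟨c, hc⟩ := TopCat.Sheaf.sections_exact_of_left_exact hS.1 hS.mono_f _ h2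
  exact ⟨V, i, c, hxV, hc⟩

variable [T2Space X] [LocallyCompactSpace X] [SigmaCompactSpace X]

/-- If `0 → F → G → H → 0` is exact and `F` is soft, then sections of `H` over closed sets lift
to sections of `G`: local lifts are corrected successively by global sections of `F`. -/
theorem exists_lift_sectionOver (hS : S.ShortExact) (h1 : IsSoft S.X₁) {K : Set X} (hK : IsClosed K)
    {s : ∀ x, S.X₃.presheaf.stalk x} (hs : IsSectionOver S.X₃ K s) :
    ∃ s' : ∀ x, S.X₂.presheaf.stalk x, IsSectionOver S.X₂ K s' ∧ ∀ x ∈ K,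
      stalkMap S.g x (s' x) = s x := by
  classical
  rw [isSoft_iff] at h1
  have hloc : ∀ x, ∃ W : Opens X, x ∈ W ∧ ∃ t : S.X₂.presheaf.obj (op W),
      ∀ (y : X) (_ : y ∈ K) (hU : y ∈ W),
        stalkMap S.g y
          (S.X₂.presheaf.germ W y hU t) = s y := by
    intro x
    by_cases hx : x ∈ K
    · obtain ⟨U, hxU, t, ht⟩ := hs x hx
      obtain ⟨V, h, t', hxV, ht'⟩ := exists_local_lift hS t hxU
      refine ⟨V, hxV, t', fun y hyK hyV => ?_⟩
      rw [← germ_app, ht']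
      exact (germ_map S.X₃ h y hyV t).trans (ht y hyK (h hyV))
    · exact ⟨⟨Kᶜ, hK.isOpen_compl⟩, hx, 0, fun y hy hy' => absurd hy hy'⟩
  choose W hxW t ht using hloc
  obtain ⟨N, U, -, hNU, hUW, hfin, hcov⟩ :=
    exists_locallyFinite_seq_of_small_pairs (fun _ _ => True) trivial
      (fun x W hx => ⟨W, W, hx, le_rfl, le_rfl, trivial⟩) W hxW
  have hloc' : ∀ i, ∃ t : S.X₂.presheaf.obj (op (U i)),
      ∀ (y : X) (_ : y ∈ K) (hU : y ∈ U i),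
        stalkMap S.g y
          (S.X₂.presheaf.germ (U i) y hU t) = s y := by
    intro i
    rcases hUW i with h | ⟨x, h⟩
    · exact ⟨0, fun y _ hy => by rw [h] at hy; exact absurd hy (by simp)⟩
    · exact ⟨S.X₂.presheaf.map (homOfLE h).op (t x), fun y hy hU =>
        (congrArg _ (germ_map S.X₂ h y hU _)).trans (ht x y hy _)⟩
  choose t' ht' using hloc'
  obtain ⟨A, hAcov, hAc, hAU⟩ := exists_iUnion_eq_closed_subset (fun i => (U i).isOpen)
    (fun x => hfin.point_finite x)
    (Set.eq_univ_of_forall fun x => Set.mem_iUnion.2 ((hcov x).imp fun i h => hNU i h))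
  let B : ℕ → Set X := fun i => ⋃ j ∈ Set.Iio i, A j
  have hBc : ∀ i, IsClosed (B i) := fun i =>
    (Set.finite_Iio i).isClosed_biUnion fun j _ => hAc j
  have hB1 : ∀ i, B (i + 1) = B i ∪ A i := by
    intro i
    ext x
    simp only [B, Set.mem_iUnion, Set.mem_Iio, exists_prop, Set.mem_union, Nat.lt_succ_iff_lt_or_eq]
    constructor
    · rintro ⟨j, hj | rfl, hx⟩
      · exact Or.inl ⟨j, hj, hx⟩
      · exact Or.inr hx
    · rintro (⟨j, hj, hx⟩ | hx)
      · exact ⟨j, Or.inl hj, hx⟩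
      · exact ⟨i, Or.inr rfl, hx⟩
  let Q : ℕ → (∀ x, S.X₂.presheaf.stalk x) → Prop := fun i T =>
    IsSectionOver S.X₂ (K ∩ B i) T ∧ ∀ x ∈ K ∩ B i,
      stalkMap S.g x (T x) = s x
  have step : ∀ (i : ℕ) (T : ∀ x, S.X₂.presheaf.stalk x), ∃ T' : ∀ x, S.X₂.presheaf.stalk x,
      (∀ x ∉ U i, T' x = T x) ∧ (Q i T → Q (i + 1) T') := by
    intro i T
    by_cases hQ : Q i T
    swap
    · exact ⟨T, fun _ _ => rfl, fun h => absurd h hQ⟩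
    obtain ⟨hT, hTs⟩ := hQ
    -- On the overlap the two lifts differ by a section of the kernel.
    let D : Set X := K ∩ B i ∩ A i
    have hD : ∀ x ∈ D, ∃ (O : Opens X) (hO : O ≤ U i) (c : S.X₁.presheaf.obj (op O)), x ∈ O ∧
        ∀ (y : X) (_ : y ∈ D) (hy : y ∈ O),
          stalkMap S.f y
            (S.X₁.presheaf.germ O y hy c) = T y - S.X₂.presheaf.germ (U i) y (hO hy) (t' i) := by
      intro x hx
      obtain ⟨O, hxO, a, ha⟩ := hT x hx.1
      have hxU : x ∈ U i := hAU i hx.2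
      let d := S.X₂.presheaf.map (homOfLE (inf_le_left : O ⊓ U i ≤ O)).op a -
        S.X₂.presheaf.map (homOfLE (inf_le_right : O ⊓ U i ≤ U i)).op (t' i)
      have hd : ∀ (y : X) (hy : y ∈ O ⊓ U i), y ∈ K ∩ B i →
          S.X₂.presheaf.germ _ y hy d = T y - S.X₂.presheaf.germ (U i) y hy.2 (t' i) := by
        intro y hy hyK
        simp only [d]
        rw [map_sub, germ_map, germ_map, ha y hyK hy.1]
      obtain ⟨V, hV, c, hxV, hc⟩ := exists_lift_of_germ_eq_zero hS d (x := x) ⟨hxO, hxU⟩ (by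
        refine (germ_app S.g x (U := O ⊓ U i) ⟨hxO, hxU⟩ d).trans ?_
        rw [hd x ⟨hxO, hxU⟩ hx.1, map_sub, hTs x hx.1, ht' i x hx.1.1, sub_self])
      refine ⟨V, hV.trans inf_le_right, c, hxV, fun y hy hyV => ?_⟩
      rw [← germ_app, hc]
      exact (germ_map S.X₂ hV y hyV d).trans (hd y (hV hyV) hy.1)
    have hr : ∀ x, ∃ r : S.X₁.presheaf.stalk x, ∀ hx : x ∈ D,
        stalkMap S.f x r =
          T x - S.X₂.presheaf.germ (U i) x (hAU i hx.2) (t' i) := by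
      intro x
      by_cases hx : x ∈ D
      · obtain ⟨O, hO, c, hxO, h⟩ := hD x hx
        exact ⟨S.X₁.presheaf.germ O x hxO c, fun _ => h x hx hxO⟩
      · exact ⟨0, fun h => absurd h hx⟩
    choose r hr using hr
    obtain ⟨ρ, hρ⟩ := h1 D ((hK.inter (hBc i)).inter (hAc i)) r (by
      intro x hx
      obtain ⟨O, hO, c, hxO, h⟩ := hD x hx
      refine ⟨O, hxO, c, fun y hy hyO => stalk_map_injective hS y ?_⟩
      exact (h y hy hyO).trans (hr y hy).symm)
    let t'' := t' i + S.f.hom.app (op (U i)) (S.X₁.presheaf.map (homOfLE le_top).op ρ)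
    have ht'' : ∀ (x : X) (hx : x ∈ U i), S.X₂.presheaf.germ (U i) x hx t'' =
        S.X₂.presheaf.germ (U i) x hx (t' i) +
          stalkMap S.f x
            (S.X₁.presheaf.germ ⊤ x trivial ρ) := by
      intro x hx
      simp only [t'']
      rw [map_add, germ_app, germ_map]
    have hcomp : ∀ x z, stalkMap S.g x (stalkMap S.f x z) = 0 := by
      intro x z
      obtain ⟨V, hxV, z, rfl⟩ := TopCat.Presheaf.exists_germ_eq S.X₁.presheaf z
      rw [← germ_app, ← germ_app]
      have h0 : S.g.hom.app (op V) (S.f.hom.app (op V) z) = 0 :=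
        ConcreteCategory.congr_hom (congrArg (fun h => h.hom.app (op V)) S.zero) z
      rw [h0, map_zero]
    have htg : ∀ (x : X) (hx : x ∈ U i), x ∈ K →
        stalkMap S.g x
          (S.X₂.presheaf.germ (U i) x hx t'') = s x := by
      intro x hx hxK
      rw [ht'', map_add, ht' i x hxK hx, hcomp x, add_zero]
    have htD : ∀ (x : X) (hx : x ∈ U i), x ∈ D → S.X₂.presheaf.germ (U i) x hx t'' = T x := by
      intro x hx hxD
      rw [ht'', hρ x hxD, hr x hxD, add_sub_cancel]
    let T' : ∀ x, S.X₂.presheaf.stalk x := fun x =>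
      if h : x ∉ B i ∧ x ∈ U i then S.X₂.presheaf.germ (U i) x h.2 t'' else T x
    have hT'1 : ∀ x ∈ B i, T' x = T x := fun x hx => dif_neg fun h => h.1 hx
    have hT'2 : ∀ x ∈ K ∩ A i, ∀ hx : x ∈ U i, T' x = S.X₂.presheaf.germ (U i) x hx t'' := by
      intro x hx hxU
      by_cases hxB : x ∈ B i
      · rw [hT'1 x hxB, htD x hxU ⟨⟨hx.1, hxB⟩, hx.2⟩]
      · exact dif_pos ⟨hxB, hxU⟩
    refine ⟨T', fun x hx => dif_neg fun h => hx h.2, fun _ => ⟨?_, ?_⟩⟩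
    · intro x hx
      by_cases hxB : x ∈ B i
      · obtain ⟨O, hxO, a, ha⟩ := hT x ⟨hx.1, hxB⟩
        by_cases hxA : x ∈ A i
        · have hxU := hAU i hxA
          obtain ⟨V, i1, i2, hxV, h⟩ := exists_germ_eqOn S.X₂ hxO hxU (s := a) (t := t'')
            (by rw [ha x ⟨hx.1, hxB⟩ hxO, htD x hxU ⟨⟨hx.1, hxB⟩, hxA⟩])
          refine ⟨V, hxV, S.X₂.presheaf.map (homOfLE i1).op a, fun y hy hyV => ?_⟩
          rw [germ_map S.X₂ i1 y hyV]
          rw [hB1] at hy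
          rcases hy.2 with hyB | hyA
          · rw [ha y ⟨hy.1, hyB⟩, hT'1 y hyB]
          · rw [h y hyV, hT'2 y ⟨hy.1, hyA⟩]
        · refine ⟨O ⊓ ⟨(A i)ᶜ, (hAc i).isOpen_compl⟩, ⟨hxO, hxA⟩,
            S.X₂.presheaf.map (homOfLE inf_le_left).op a, fun y hy hyV => ?_⟩
          rw [germ_map S.X₂ inf_le_left y hyV]
          rw [hB1] at hy
          have hyB : y ∈ B i := hy.2.resolve_right hyV.2
          rw [ha y ⟨hy.1, hyB⟩, hT'1 y hyB]
      · have hxA : x ∈ A i := by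
          have := hx.2
          rw [hB1] at this
          exact this.resolve_left hxB
        refine ⟨U i ⊓ ⟨(B i)ᶜ, (hBc i).isOpen_compl⟩, ⟨hAU i hxA, hxB⟩,
          S.X₂.presheaf.map (homOfLE inf_le_left).op t'', fun y hy hyV => ?_⟩
        rw [germ_map S.X₂ inf_le_left y hyV]
        simp only [T']
        rw [dif_pos (show y ∉ B i ∧ y ∈ U i from ⟨hyV.2, hyV.1⟩)]
    · intro x hx
      by_cases hxB : x ∈ B i
      · rw [hT'1 x hxB, hTs x ⟨hx.1, hxB⟩]
      · have hxA : x ∈ A i := by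
          have := hx.2
          rw [hB1] at this
          exact this.resolve_left hxB
        rw [hT'2 x ⟨hx.1, hxA⟩ (hAU i hxA), htg x _ hx.1]
  choose nxt hn1 hn2 using step
  let T : ℕ → ∀ x, S.X₂.presheaf.stalk x := fun i => Nat.rec (fun _ => 0) nxt i
  have hTQ : ∀ i, Q i (T i) := by
    intro i
    induction i with
    | zero =>
      have h0 : ∀ x, x ∉ B 0 := fun x hx => by simp [B] at hx
      exact ⟨fun x hx => absurd hx.2 (h0 x), fun x hx => absurd hx.2 (h0 x)⟩
    | succ i ih => exact hn2 i (T i) ih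
  have hBev : ∀ x, ∃ O : Opens X, x ∈ O ∧ ∃ m, ∀ i ≥ m, ∀ y ∈ O, y ∈ B i := by
    intro x
    obtain ⟨O, hO, hf⟩ := hfin x
    obtain ⟨O', hO', ho, hx⟩ := mem_nhds_iff.1 hO
    obtain ⟨m, hm⟩ := hf.bddAbove
    refine ⟨⟨O', ho⟩, hx, m + 1, fun i hi y hy => ?_⟩
    obtain ⟨j, hj⟩ := Set.mem_iUnion.1 (hAcov.ge (Set.mem_univ y))
    have := hm (show j ∈ _ from ⟨y, hAU j hj, hO' hy⟩)
    exact Set.mem_iUnion₂.2 ⟨j, show j < i by omega, hj⟩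
  obtain ⟨s', hs', hs'T⟩ := exists_eventual_section (K := K) hfin T (fun i => (hTQ i).1)
    (fun i x hx => hn1 i (T i) x hx) hBev
  refine ⟨s', hs', fun x hx => ?_⟩
  obtain ⟨m, hm⟩ := hs'T x
  obtain ⟨O, hxO, m', hm'⟩ := hBev x
  rw [hm (max m m') (le_max_left _ _)]
  exact (hTQ _).2 x ⟨hx, hm' _ (le_max_right _ _) x hxO⟩

/-- The case of the closed set `X` of `exists_lift_sectionOver`: a soft kernel makes global sections
exact. -/
theorem app_top_surjective_of_isSoft (hS : S.ShortExact) (h1 : IsSoft S.X₁) :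
    Function.Surjective (S.g.hom.app (op (⊤ : Opens X))) := by
  intro t
  obtain ⟨s', hs', h⟩ := exists_lift_sectionOver hS h1 isClosed_univ
    (s := fun x => S.X₃.presheaf.germ ⊤ x trivial t) (fun x _ => ⟨⊤, trivial, t, fun _ _ _ => rfl⟩)
  obtain ⟨t', ht'⟩ := IsSectionOver.exists_section (W := ⊤) hs'
  refine ⟨t', TopCat.Presheaf.section_ext S.X₃ _ _ _ fun x hx => ?_⟩
  refine (germ_app S.g x hx t').trans ?_
  rw [ht' x hx, h x trivial]

theorem IsSoft.of_shortExact (hS : S.ShortExact) (h1 : IsSoft S.X₁) (h2 : IsSoft S.X₂) :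
    IsSoft S.X₃ := by
  rw [isSoft_iff] at h2 ⊢
  intro K hK s hs
  obtain ⟨s', hs', h⟩ := exists_lift_sectionOver hS h1 hK hs
  obtain ⟨g, hg⟩ := h2 K hK s' hs'
  refine ⟨S.g.hom.app (op ⊤) g, fun x hx => ?_⟩
  refine (germ_app S.g x (U := ⊤) trivial g).trans ?_
  rw [hg x hx, h x hx]

end Exact

variable [T2Space X] [LocallyCompactSpace X] [SigmaCompactSpace X]

/-- Sections of a flasque sheaf can be cut off, because a section over `N` and the zero section over
an open set disjoint from `N` extend together. -/
theorem isSoft_of_isFlasque (F : TopCat.Sheaf AddCommGrpCat.{u} X) [F.IsFlasque] : IsSoft F := by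
  refine isSoft_of_hasCutoff F fun x W hx => ?_
  obtain ⟨C, hC, hCc, hCW⟩ := exists_mem_nhds_isClosed_subset (W.isOpen.mem_nhds hx)
  refine ⟨⟨interior C, isOpen_interior⟩, W, mem_interior_iff_mem_nhds.2 hC,
    interior_subset.trans hCW, le_rfl, hasCutoff_of_isFlasque F ?_⟩
  exact (closure_minimal interior_subset hCc).trans hCW

open Abelian in
/-- Dimension shifting along `0 → F → I → I/F → 0` with `I` injective: global sections of `I` map
onto those of `I/F`, and `I/F` is again soft. -/
theorem subsingleton_H_of_isSoft (F : Sheaf (Opens.grothendieckTopology X) AddCommGrpCat.{u})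
    (hF : IsSoft (X := X) F) (j : ℕ) : Subsingleton (F.H (j + 1)) := by
  induction j generalizing F with
  | zero =>
    let S := ShortComplex.mk (Injective.ι F) (Limits.cokernel.π (Injective.ι F)) (by simp)
    have hS : S.ShortExact := { exact := ShortComplex.exact_cokernel _ }
    refine subsingleton_of_forall_eq 0 fun a => ?_
    obtain ⟨q, rfl⟩ := Ext.covariant_sequence_exact₁ _ hS a
      (Ext.eq_zero_of_injective _) (zero_add 1)
    have hT : Limits.IsTerminal (⊤ : Opens X) := Limits.isTerminalTop
    obtain ⟨p, hp⟩ := app_top_surjective_of_isSoft hS hF (Sheaf.H.equiv₀ S.X₃ hT q)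
    have hq : q = Sheaf.H.map S.g 0 ((Sheaf.H.equiv₀ S.X₂ hT).symm p) := by
      rw [Sheaf.H.equiv₀_symm_naturality]
      apply (Sheaf.H.equiv₀ S.X₃ hT).injective
      rw [AddEquiv.apply_symm_apply]
      exact hp.symm
    rw [hq, Sheaf.H.map_apply, Ext.comp_assoc_of_second_deg_zero, hS.comp_extClass, Ext.comp_zero]
  | succ j ih =>
    let S := ShortComplex.mk (Injective.ι F) (Limits.cokernel.π (Injective.ι F)) (by simp)
    have hS : S.ShortExact := { exact := ShortComplex.exact_cokernel _ }
    have hI : TopCat.Sheaf.IsFlasque (X := X) (Injective.under F) :=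
      isFlasque_of_injective (Injective.under F)
    have hQ : IsSoft (X := X) S.X₃ :=
      IsSoft.of_shortExact hS hF (isSoft_of_isFlasque (X := X) (Injective.under F))
    have := ih S.X₃ hQ
    refine subsingleton_of_forall_eq 0 fun a => ?_
    obtain ⟨q, rfl⟩ := Ext.covariant_sequence_exact₁ _ hS a (Ext.eq_zero_of_injective _) rfl
    rw [Subsingleton.elim (α := S.X₃.H (j + 1)) q 0, Ext.zero_comp]

theorem IsSoft.isGammaAcyclic {F : TopCat.Sheaf AddCommGrpCat.{u} X} (hF : IsSoft F) :
    IsGammaAcyclic F := by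
  intro j hj
  obtain ⟨j, rfl⟩ := Nat.exists_eq_add_of_le' hj
  exact subsingleton_H_of_isSoft F hF j

end Acyclic

/-! ### Derivative bounds and integrals depending on a parameter -/

section Analysis

variable {E E' F F' G P : Type} [NormedAddCommGroup E] [NormedSpace ℝ E] [NormedAddCommGroup E']
  [NormedSpace ℝ E'] [NormedAddCommGroup F] [NormedSpace ℝ F] [NormedAddCommGroup F']
  [NormedSpace ℝ F'] [NormedAddCommGroup G] [NormedSpace ℝ G] [NormedAddCommGroup P]
  [NormedSpace ℝ P]

theorem exists_bound_iteratedFDeriv {O K : Set E} (hO : IsOpen O) (hK : IsCompact K)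
    (hKO : K ⊆ O) {f : E → F} (hf : ContDiffOn ℝ ∞ f O) (N : ℕ) :
    ∃ C : ℝ, 1 ≤ C ∧ ∀ i ≤ N, ∀ y ∈ K, ‖iteratedFDeriv ℝ i f y‖ ≤ C := by
  have h : ∀ i, ∃ C : ℝ, 1 ≤ C ∧ ∀ y ∈ K, ‖iteratedFDeriv ℝ i f y‖ ≤ C := by
    intro i
    have hc : ContinuousOn (iteratedFDeriv ℝ i f) K := by
      have := (hf.continuousOn_iteratedFDerivWithin (m := i) (by exact_mod_cast le_top)
        hO.uniqueDiffOn).mono hKO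
      exact this.congr fun y hy => (iteratedFDerivWithin_of_isOpen i hO (hKO hy)).symm
    obtain ⟨C, hC⟩ := hK.exists_bound_of_continuousOn hc
    exact ⟨max 1 C, le_max_left _ _, fun y hy => (hC y hy).trans (le_max_right _ _)⟩
  choose C hC1 hC using h
  refine ⟨∑ i ∈ Finset.range (N + 1), C i, ?_, fun i hi y hy => (hC i y hy).trans ?_⟩
  · exact (hC1 0).trans (Finset.single_le_sum (f := C) (fun i _ => zero_le_one.trans (hC1 i))
      (Finset.mem_range.2 (Nat.succ_pos N)))
  · exact Finset.single_le_sum (f := C) (fun i _ => zero_le_one.trans (hC1 i))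
      (Finset.mem_range.2 (by omega))

/-- On a compact set, the derivatives up to order `N` of `A (φ ∘ τ)` are bounded by those of `φ`,
for fixed smooth `A` and `τ`. -/
theorem exists_bound_iteratedFDeriv_clm_comp {O K : Set E} (hO : IsOpen O) (hK : IsCompact K)
    (hKO : K ⊆ O) {A : E → F →L[ℝ] F'} (hA : ContDiffOn ℝ ∞ A O) {τ : E → E'}
    (hτ : ContDiffOn ℝ ∞ τ O) (N : ℕ) :
    ∃ C : ℝ, 0 ≤ C ∧ ∀ (φ : E' → F) (t : Set E'), IsOpen t → ContDiffOn ℝ ∞ φ t → Set.MapsTo τ O t →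
      ∀ y ∈ K, ∀ M : ℝ, 0 ≤ M → (∀ i ≤ N, ‖iteratedFDeriv ℝ i φ (τ y)‖ ≤ M) →
      ∀ i ≤ N, ‖iteratedFDeriv ℝ i (fun y => A y (φ (τ y))) y‖ ≤ C * M := by
  obtain ⟨a, ha1, ha⟩ := exists_bound_iteratedFDeriv hO hK hKO hA N
  obtain ⟨D, hD1, hD⟩ := exists_bound_iteratedFDeriv hO hK hKO hτ N
  refine ⟨2 ^ N * (a * (N.factorial * D ^ N)), by positivity, ?_⟩
  intro φ t ht hφ hmap y hy M hM hb i hi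
  have hyO := hKO hy
  have hcomp : ∀ j ≤ N, ‖iteratedFDerivWithin ℝ j (φ ∘ τ) O y‖ ≤ N.factorial * M * D ^ N := by
    intro j hj
    refine (norm_iteratedFDerivWithin_comp_le hφ hτ (by exact_mod_cast le_top) ht.uniqueDiffOn
      hO.uniqueDiffOn hmap hyO (C := M) (D := D) (fun l hl => ?_) fun l h1 hl => ?_).trans ?_
    · rw [iteratedFDerivWithin_of_isOpen l ht (hmap hyO)]
      exact hb l (hl.trans hj)
    · rw [iteratedFDerivWithin_of_isOpen l hO hyO]
      exact (hD l (hl.trans hj) y hy).trans (le_self_pow₀ hD1 (by omega))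
    · gcongr
  have h := norm_iteratedFDerivWithin_clm_apply (n := i) hA (hφ.comp hτ hmap) hO.uniqueDiffOn hyO
    (by exact_mod_cast le_top)
  rw [iteratedFDerivWithin_of_isOpen i hO hyO] at h
  refine h.trans ?_
  calc ∑ j ∈ Finset.range (i + 1), (i.choose j : ℝ) * ‖iteratedFDerivWithin ℝ j A O y‖ *
        ‖iteratedFDerivWithin ℝ (i - j) (φ ∘ τ) O y‖
      ≤ ∑ j ∈ Finset.range (i + 1), (i.choose j : ℝ) * a * (N.factorial * M * D ^ N) := by
        refine Finset.sum_le_sum fun j hj => ?_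
        rw [Finset.mem_range] at hj
        have h1 : ‖iteratedFDerivWithin ℝ j A O y‖ ≤ a := by
          rw [iteratedFDerivWithin_of_isOpen j hO hyO]
          exact ha j (by omega) y hy
        have h2 := hcomp (i - j) (by omega)
        gcongr
    _ = 2 ^ i * (a * (N.factorial * M * D ^ N)) := by
        simp only [mul_assoc]
        rw [← Finset.sum_mul]
        congr 1
        exact_mod_cast Nat.sum_range_choose i
    _ ≤ 2 ^ N * (a * (N.factorial * M * D ^ N)) := by
        gcongr
        exact one_le_two
    _ = _ := by ring

theorem norm_iteratedFDeriv_slice_le {Ψ : P × E → F} (hΨ : ContDiff ℝ ∞ Ψ) (i : ℕ) (t : P) (y : E) :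
    ‖iteratedFDeriv ℝ i (fun y => Ψ (t, y)) y‖ ≤ ‖iteratedFDeriv ℝ i Ψ (t, y)‖ := by
  have h1 : (fun y => Ψ (t, y)) = (fun p => Ψ ((t, 0) + p)) ∘ (ContinuousLinearMap.inr ℝ P E) := by
    ext y; simp
  have h2 : ContDiff ℝ ∞ fun p => Ψ ((t, 0) + p) := hΨ.comp (contDiff_const.add contDiff_id)
  rw [h1, ContinuousLinearMap.iteratedFDeriv_comp_right _ h2 y (by exact_mod_cast le_top)]
  refine (ContinuousMultilinearMap.norm_compContinuousLinearMap_le _ _).trans ?_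
  rw [iteratedFDeriv_comp_add_left]
  simp only [ContinuousLinearMap.inr_apply, Prod.mk_add_mk, add_zero, zero_add]
  refine mul_le_of_le_one_right (norm_nonneg _) ?_
  exact Finset.prod_le_one (fun _ _ => norm_nonneg _)
    fun _ _ => ContinuousLinearMap.norm_inr_le_one ℝ P E

theorem contDiff_iteratedFDeriv_slice {Ψ : P × E → F} (hΨ : ContDiff ℝ ∞ Ψ) (i : ℕ) :
    ContDiff ℝ ∞ fun p : P × E => iteratedFDeriv ℝ i (fun y => Ψ (p.1, y)) p.2 := by
  induction i with
  | zero =>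
    exact (continuousMultilinearCurryFin0 ℝ E F).symm.contDiff.comp hΨ
  | succ i ih =>
    have h : ContDiff ℝ ∞ fun p : P × E =>
        fderiv ℝ (fun y => iteratedFDeriv ℝ i (fun y => Ψ (p.1, y)) y) p.2 := by
      refine ContDiff.fderiv (m := ∞) (f := fun (p : P × E) y =>
        iteratedFDeriv ℝ i (fun y => Ψ (p.1, y)) y) ?_ contDiff_snd (by simp)
      exact ih.comp (g := fun p : P × E => iteratedFDeriv ℝ i (fun y => Ψ (p.1, y)) p.2)
        (f := fun q : (P × E) × E => (q.1.1, q.2)) (by fun_prop)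
    simp_rw [iteratedFDeriv_succ_eq_comp_left]
    exact (continuousMultilinearCurryLeftEquiv ℝ (fun _ => E) F).symm.contDiff.comp h

theorem fderiv_slice_continuous {Ψ : P → E → F} (hΨ : ContDiff ℝ 1 (Function.uncurry Ψ)) :
    Continuous fun p : P × E => fderiv ℝ (Ψ p.1) p.2 := by
  refine (ContDiff.fderiv (m := 1) (n := 0) (f := fun (p : P × E) => Ψ p.1) ?_ contDiff_snd
    (by simp)).continuous
  exact hΨ.comp (g := Function.uncurry Ψ) (f := fun q : (P × E) × E => (q.1.1, q.2)) (by fun_prop)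

variable [ProperSpace E] [MeasurableSpace P] [BorelSpace P]
  {μ : Measure P} [IsLocallyFiniteMeasure μ]

theorem hasFDerivAt_setIntegral_of_contDiff {Ψ : P → E → F}
    (hΨ : ContDiff ℝ 1 (Function.uncurry Ψ)) {S : Set P} (hS : IsCompact S) (y : E) :
    HasFDerivAt (fun y => ∫ t in S, Ψ t y ∂μ) (∫ t in S, fderiv ℝ (Ψ t) y ∂μ) y := by
  have hc := fderiv_slice_continuous hΨ
  obtain ⟨C, hC⟩ :=
    (hS.prod (isCompact_closedBall y 1)).exists_bound_of_continuousOn hc.continuousOn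
  have hm : MeasurableSet S := hS.isClosed.measurableSet
  have hint : ∀ {H : Type} [NormedAddCommGroup H] [NormedSpace ℝ H] {f : P → H}, Continuous f →
      IntegrableOn f S μ := fun hf => hf.continuousOn.integrableOn_compact hS
  have hcont : ∀ y, Continuous fun t => Ψ t y := fun y =>
    hΨ.continuous.comp (Continuous.prodMk continuous_id continuous_const)
  have hcd : Continuous fun t => fderiv ℝ (Ψ t) y :=
    hc.comp (Continuous.prodMk continuous_id continuous_const)
  refine hasFDerivAt_integral_of_dominated_of_fderiv_le
    (F' := fun y t => fderiv ℝ (Ψ t) y) (bound := fun _ => C) (s := Metric.ball y 1)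
    (Metric.ball_mem_nhds y one_pos)
    (Filter.Eventually.of_forall fun y => (hint (hcont y)).aestronglyMeasurable) (hint (hcont y))
    (hint hcd).aestronglyMeasurable ?_ ?_ ?_
  · filter_upwards [ae_restrict_mem hm] with t ht z hz
    exact hC (t, z) ⟨ht, Metric.ball_subset_closedBall hz⟩
  · exact integrableOn_const (hs := hS.measure_lt_top.ne)
  · filter_upwards with t z _
    have : ContDiff ℝ 1 (Ψ t) :=
      hΨ.comp (g := Function.uncurry Ψ) (f := fun y => (t, y)) (by fun_prop)
    exact (this.differentiable (by simp) z).hasFDerivAt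

theorem norm_iteratedFDeriv_setIntegral_le {Ψ : P → E → F}
    (hΨ : ContDiff ℝ ∞ (Function.uncurry Ψ)) {S : Set P} (hS : IsCompact S) (i : ℕ) (y : E) {M : ℝ}
    (hM : ∀ t ∈ S, ‖iteratedFDeriv ℝ i (Ψ t) y‖ ≤ M) :
    ‖iteratedFDeriv ℝ i (fun y => ∫ t in S, Ψ t y ∂μ) y‖ ≤ M * μ.real S := by
  induction i generalizing F with
  | zero =>
    simp only [norm_iteratedFDeriv_zero] at hM ⊢
    exact norm_setIntegral_le_of_norm_le_const hS.measure_lt_top hM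
  | succ i ih =>
    have : fderiv ℝ (fun y => ∫ t in S, Ψ t y ∂μ) = fun y => ∫ t in S, fderiv ℝ (Ψ t) y ∂μ :=
      funext fun y => (hasFDerivAt_setIntegral_of_contDiff (hΨ.of_le (by simp)) hS y).fderiv
    rw [← norm_iteratedFDeriv_fderiv, this]
    refine ih (Ψ := fun t y => fderiv ℝ (Ψ t) y) ?_ fun t ht => ?_
    · refine ContDiff.fderiv (m := ∞) (f := fun (p : P × E) => Ψ p.1) ?_ contDiff_snd (by simp)
      exact hΨ.comp (g := Function.uncurry Ψ) (f := fun q : (P × E) × E => (q.1.1, q.2))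
        (by fun_prop)
    · exact (norm_iteratedFDeriv_fderiv).trans_le (hM t ht)

variable [SecondCountableTopology P]

theorem contDiff_setIntegral_nat {Ψ : P → E → F} {n : ℕ} (hΨ : ContDiff ℝ n (Function.uncurry Ψ))
    {S : Set P} (hS : IsCompact S) : ContDiff ℝ n fun y => ∫ t in S, Ψ t y ∂μ := by
  induction n generalizing F with
  | zero =>
    rw [Nat.cast_zero, contDiff_zero] at hΨ ⊢
    have h : Continuous (Function.uncurry fun y t => Ψ t y) := hΨ.comp continuous_swap
    exact continuous_parametric_integral_of_continuous h hS
  | succ n ih =>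
    have h1 : ContDiff ℝ 1 (Function.uncurry Ψ) := hΨ.of_le (by simp)
    have hd := fun y => hasFDerivAt_setIntegral_of_contDiff (μ := μ) h1 hS y
    rw [Nat.cast_succ, contDiff_succ_iff_fderiv] at ⊢
    refine ⟨fun y => (hd y).differentiableAt, by simp, ?_⟩
    have : fderiv ℝ (fun y => ∫ t in S, Ψ t y ∂μ) = fun y => ∫ t in S, fderiv ℝ (Ψ t) y ∂μ :=
      funext fun y => (hd y).fderiv
    rw [this]
    refine ih (Ψ := fun t y => fderiv ℝ (Ψ t) y) ?_
    refine ContDiff.fderiv (m := n + 1) (f := fun (p : P × E) => Ψ p.1) ?_ contDiff_snd le_rfl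
    exact hΨ.comp (g := Function.uncurry Ψ) (f := fun q : (P × E) × E => (q.1.1, q.2)) (by fun_prop)

theorem contDiff_setIntegral {Ψ : P → E → F} (hΨ : ContDiff ℝ ∞ (Function.uncurry Ψ))
    {S : Set P} (hS : IsCompact S) : ContDiff ℝ ∞ fun y => ∫ t in S, Ψ t y ∂μ :=
  contDiff_infty.2 fun _ => contDiff_setIntegral_nat (contDiff_infty.1 hΨ _) hS

end Analysis

/-! ### Smooth flows on the line -/

section Flow

/-- A diffeomorphism from `(-1, 1)` to `ℝ` whose derivative grows so fast at the ends that its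
inverse extends smoothly by zero. -/
def stretch (s : ℝ) : ℝ := s * Real.exp ((1 - s ^ 2)⁻¹)

/-- The vector field which `stretch` maps to the unit vector field, extended by zero. -/
def stretchField (s : ℝ) : ℝ :=
  expNegInvGlue (1 - s ^ 2) * ((1 - s ^ 2) ^ 2 / ((1 - s ^ 2) ^ 2 + 2 * s ^ 2))

theorem stretch_denom_pos (s : ℝ) : 0 < (1 - s ^ 2) ^ 2 + 2 * s ^ 2 := by
  have : (1 - s ^ 2) ^ 2 + 2 * s ^ 2 = 1 + (s ^ 2) ^ 2 := by ring
  rw [this]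
  positivity

theorem contDiff_stretchField : ContDiff ℝ ∞ stretchField := by
  unfold stretchField
  refine ContDiff.mul ?_ ?_
  · exact expNegInvGlue.contDiff.comp (by fun_prop)
  · exact ContDiff.div (by fun_prop) (by fun_prop) fun s => (stretch_denom_pos s).ne'

theorem one_sub_sq_pos {s : ℝ} (hs : s ∈ Set.Ioo (-1 : ℝ) 1) : 0 < 1 - s ^ 2 := by
  nlinarith [hs.1, hs.2]

theorem stretchField_pos {s : ℝ} (hs : s ∈ Set.Ioo (-1 : ℝ) 1) : 0 < stretchField s := by
  have h1 := one_sub_sq_pos hs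
  have h2 := expNegInvGlue.pos_of_pos h1
  have h3 := stretch_denom_pos s
  unfold stretchField
  positivity

theorem stretchField_eq_zero {s : ℝ} (hs : s ∉ Set.Ioo (-1 : ℝ) 1) : stretchField s = 0 := by
  have h : 1 - s ^ 2 ≤ 0 := by
    by_contra h
    push Not at h
    refine hs ⟨by nlinarith, by nlinarith⟩
  rw [stretchField, expNegInvGlue.zero_of_nonpos h, zero_mul]

theorem hasDerivAt_stretch {s : ℝ} (hs : s ∈ Set.Ioo (-1 : ℝ) 1) :
    HasDerivAt stretch (stretchField s)⁻¹ s := by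
  have h1 := one_sub_sq_pos hs
  have h2 := stretch_denom_pos s
  have hu : HasDerivAt (fun s : ℝ => 1 - s ^ 2) (-(2 * s)) s := by
    simpa using (hasDerivAt_pow 2 s).const_sub 1
  have h := (hasDerivAt_id s).mul (hu.inv h1.ne').exp
  refine h.congr_deriv ?_
  have he : expNegInvGlue (1 - s ^ 2) = (Real.exp ((1 - s ^ 2)⁻¹))⁻¹ := by
    rw [expNegInvGlue, if_neg (not_le.2 h1), Real.exp_neg]
  rw [stretchField, he]
  have h3 := Real.exp_pos ((1 - s ^ 2)⁻¹)
  simp only [id, Pi.inv_apply]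
  field_simp

theorem strictMonoOn_stretch : StrictMonoOn stretch (Set.Ioo (-1) 1) := by
  refine strictMonoOn_of_deriv_pos (convex_Ioo _ _)
    (fun s hs => (hasDerivAt_stretch hs).continuousAt.continuousWithinAt) fun s hs => ?_
  rw [interior_Ioo] at hs
  rw [(hasDerivAt_stretch hs).deriv]
  exact inv_pos.2 (stretchField_pos hs)

theorem surjOn_stretch : Set.SurjOn stretch (Set.Ioo (-1) 1) Set.univ := by
  intro y _
  obtain ⟨s, hs, hsy⟩ : ∃ s ∈ Set.Ioo (0 : ℝ) 1, |y| ≤ stretch s := by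
    set m := max |y| 1
    have hm : 1 ≤ m := le_max_right _ _
    have hq : (2 * m)⁻¹ ≤ 1 / 2 := by
      rw [inv_le_comm₀ (by positivity) (by norm_num)]; linarith
    have hq0 : 0 < (2 * m)⁻¹ := by positivity
    refine ⟨Real.sqrt (1 - (2 * m)⁻¹), ⟨Real.sqrt_pos.2 (by linarith), ?_⟩, ?_⟩
    · rw [Real.sqrt_lt' one_pos]; linarith
    · rw [stretch, Real.sq_sqrt (by linarith), sub_sub_cancel, inv_inv]
      have h1 : 1 / 2 ≤ Real.sqrt (1 - (2 * m)⁻¹) := by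
        apply Real.le_sqrt_of_sq_le; linarith
      have h2 : 2 * m ≤ Real.exp (2 * m) := by linarith [Real.add_one_le_exp (2 * m)]
      calc |y| ≤ m := le_max_left _ _
        _ = 1 / 2 * (2 * m) := by ring
        _ ≤ _ := by gcongr
  have hsub : Set.Icc (-s) s ⊆ Set.Ioo (-1) 1 := fun x hx =>
    ⟨by linarith [hx.1, hs.2], by linarith [hx.2, hs.2]⟩
  have hneg : stretch (-s) = -stretch s := by simp [stretch]
  have := intermediate_value_Icc (by linarith [hs.1] : -s ≤ s) (f := stretch)
    fun x hx => (hasDerivAt_stretch (hsub hx)).continuousAt.continuousWithinAt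
  obtain ⟨x, hx, rfl⟩ := this ⟨by rw [hneg]; linarith [neg_abs_le y], (le_abs_self y).trans hsy⟩
  exact ⟨x, hsub hx, rfl⟩

/-- `stretch` as an order isomorphism. -/
def stretchIso : Set.Ioo (-1 : ℝ) 1 ≃o ℝ :=
  StrictMono.orderIsoOfSurjective (fun s : Set.Ioo (-1 : ℝ) 1 => stretch s)
    (fun a b hab => strictMonoOn_stretch a.2 b.2 hab) fun y => by
      obtain ⟨x, hx, h⟩ := surjOn_stretch (Set.mem_univ y)
      exact ⟨⟨x, hx⟩, h⟩

/-- The inverse of `stretch`. -/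
def squeeze (t : ℝ) : ℝ := stretchIso.symm t

theorem squeeze_mem (t : ℝ) : squeeze t ∈ Set.Ioo (-1 : ℝ) 1 := (stretchIso.symm t).2

theorem stretch_squeeze (t : ℝ) : stretch (squeeze t) = t := stretchIso.apply_symm_apply t

theorem squeeze_stretch {s : ℝ} (hs : s ∈ Set.Ioo (-1 : ℝ) 1) : squeeze (stretch s) = s :=
  congrArg Subtype.val (stretchIso.symm_apply_apply ⟨s, hs⟩)

theorem hasDerivAt_squeeze (t : ℝ) : HasDerivAt squeeze (stretchField (squeeze t)) t := by
  have hc : Continuous squeeze := continuous_subtype_val.comp stretchIso.symm.continuous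
  have := HasDerivAt.of_local_left_inverse (f := stretch) (g := squeeze) hc.continuousAt
    (hasDerivAt_stretch (squeeze_mem t)) (inv_ne_zero (stretchField_pos (squeeze_mem t)).ne')
    (Filter.Eventually.of_forall stretch_squeeze)
  rwa [inv_inv] at this

theorem contDiff_squeeze : ContDiff ℝ ∞ squeeze := by
  refine contDiff_infty.2 fun n => ?_
  have hd : deriv squeeze = stretchField ∘ squeeze :=
    funext fun t => (hasDerivAt_squeeze t).deriv
  have hD : Differentiable ℝ squeeze := fun t => (hasDerivAt_squeeze t).differentiableAt
  induction n with
  | zero => exact contDiff_zero.2 hD.continuous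
  | succ n ih =>
    rw [Nat.cast_succ, contDiff_succ_iff_deriv]
    refine ⟨hD, by simp, ?_⟩
    rw [hd]
    exact (contDiff_infty.1 contDiff_stretchField n).comp ih

theorem contDiffOn_stretch : ContDiffOn ℝ ∞ stretch (Set.Ioo (-1) 1) := by
  intro s hs
  have : ContDiffAt ℝ ∞ stretch s := by
    unfold stretch
    exact contDiffAt_id.mul (((contDiffAt_const.sub (contDiffAt_id.pow 2)).inv
      (one_sub_sq_pos hs).ne').exp)
  exact this.contDiffWithinAt

/-- The averaged derivative `∫₀¹ g'(a + u (b - a)) du`, the continuous extension of the difference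
quotient of `g`. -/
def meanSlope (g : ℝ → ℝ) (p : ℝ × ℝ) : ℝ :=
  ∫ u in (0 : ℝ)..1, deriv g (p.1 + u * (p.2 - p.1))

theorem continuous_meanSlope {g : ℝ → ℝ} (hg : ContDiff ℝ 1 g) : Continuous (meanSlope g) := by
  have h := hg.continuous_deriv le_rfl
  unfold meanSlope
  exact intervalIntegral.continuous_parametric_intervalIntegral_of_continuous' (by fun_prop) 0 1

theorem meanSlope_self (g : ℝ → ℝ) (a : ℝ) : meanSlope g (a, a) = deriv g a := by
  simp [meanSlope]

theorem meanSlope_mul {g : ℝ → ℝ} (hg : ContDiff ℝ 1 g) (a b : ℝ) :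
    meanSlope g (a, b) * (b - a) = g b - g a := by
  have h := hg.continuous_deriv le_rfl
  have hd : ∀ u ∈ Set.uIcc (0 : ℝ) 1, HasDerivAt (fun u => g (a + u * (b - a)))
      (deriv g (a + u * (b - a)) * (b - a)) u := by
    intro u _
    have h1 : HasDerivAt (fun u : ℝ => a + u * (b - a)) (b - a) u := by
      simpa using ((hasDerivAt_id u).mul_const (b - a)).const_add a
    exact ((hg.differentiable one_ne_zero).differentiableAt.hasDerivAt).comp u h1
  have := intervalIntegral.integral_eq_sub_of_hasDerivAt hd
    (Continuous.intervalIntegrable (by fun_prop) _ _)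
  rw [intervalIntegral.integral_mul_const] at this
  simpa [meanSlope] using this

variable {g : ℝ → ℝ} {h : ℝ → ℝ → ℝ}

/-- The difference of two trajectories of a flow satisfies a linear differential equation. -/
theorem flow_sub (hg : ContDiff ℝ 1 g) (h0 : ∀ x, h x 0 = x)
    (hh : ∀ x t, HasDerivAt (h x) (g (h x t)) t) (x y t : ℝ) :
    h y t - h x t = (y - x) * Real.exp (∫ s in (0 : ℝ)..t, meanSlope g (h x s, h y s)) := by
  have hc : ∀ x, Continuous (h x) := fun x =>
    continuous_iff_continuousAt.2 fun t => (hh x t).continuousAt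
  have hq : Continuous fun s => meanSlope g (h x s, h y s) :=
    (continuous_meanSlope hg).comp ((hc x).prodMk (hc y))
  have hQ : ∀ t, HasDerivAt (fun t => ∫ s in (0 : ℝ)..t, meanSlope g (h x s, h y s))
      (meanSlope g (h x t, h y t)) t := fun t =>
    intervalIntegral.integral_hasDerivAt_right (hq.intervalIntegrable _ _)
      (hq.stronglyMeasurableAtFilter _ _) hq.continuousAt
  have hw : ∀ t, HasDerivAt (fun t => (h y t - h x t) *
      Real.exp (-∫ s in (0 : ℝ)..t, meanSlope g (h x s, h y s))) 0 t := by
    intro t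
    refine (((hh y t).sub (hh x t)).mul (hQ t).neg.exp).congr_deriv ?_
    rw [← meanSlope_mul hg]
    simp only [Pi.neg_apply, Pi.sub_apply]
    ring
  have hconst := is_const_of_deriv_eq_zero (fun t => (hw t).differentiableAt)
    (fun t => (hw t).deriv) t 0
  simp only [h0, intervalIntegral.integral_same, neg_zero, Real.exp_zero, mul_one] at hconst
  rw [← hconst, mul_assoc, ← Real.exp_add, neg_add_cancel, Real.exp_zero, mul_one]

/-- Trajectories starting at nearby points stay together for bounded times, by `flow_sub`. -/
theorem continuous_flow (hg : ContDiff ℝ 1 g) (hgb : ∃ C, ∀ s, |deriv g s| ≤ C)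
    (h0 : ∀ x, h x 0 = x) (hh : ∀ x t, HasDerivAt (h x) (g (h x t)) t) :
    Continuous (Function.uncurry h) := by
  obtain ⟨C, hC⟩ := hgb
  have hm : ∀ p, ‖meanSlope g p‖ ≤ C := fun p => by
    have := intervalIntegral.norm_integral_le_of_norm_le_const (a := 0) (b := 1) (C := C)
      (f := fun u => deriv g (p.1 + u * (p.2 - p.1))) (fun u _ => hC _)
    simpa [meanSlope] using this
  have hc : ∀ x, Continuous (h x) := fun x =>
    continuous_iff_continuousAt.2 fun t => (hh x t).continuousAt
  rw [continuous_iff_continuousAt]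
  rintro ⟨x, t⟩
  have h1 : Filter.Tendsto (fun p : ℝ × ℝ => |p.1 - x| * Real.exp (C * |p.2|)) (nhds (x, t))
      (nhds 0) := by
    have : Continuous fun p : ℝ × ℝ => |p.1 - x| * Real.exp (C * |p.2|) := by fun_prop
    simpa using this.tendsto (x, t)
  have h2 : Filter.Tendsto (fun p : ℝ × ℝ => h p.1 p.2 - h x p.2) (nhds (x, t)) (nhds 0) := by
    refine squeeze_zero_norm (fun p => ?_) h1
    rw [flow_sub hg h0 hh, norm_mul, Real.norm_eq_abs, Real.norm_eq_abs, Real.abs_exp]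
    gcongr
    refine (le_abs_self _).trans ?_
    have := intervalIntegral.norm_integral_le_of_norm_le_const (a := 0) (b := p.2) (C := C)
      (f := fun s => meanSlope g (h x s, h p.1 s)) (fun u _ => hm _)
    simpa using this
  have h3 : Filter.Tendsto (fun p : ℝ × ℝ => h x p.2) (nhds (x, t)) (nhds (h x t)) :=
    ((hc x).comp continuous_snd).tendsto (x, t)
  have := h2.add h3
  simpa [ContinuousAt, Function.uncurry_def] using this

/-- A product of a function vanishing at a point with one which is only continuous there. -/
theorem hasFDerivAt_mul_sub_of_continuousAt {k : ℝ × ℝ → ℝ} {p : ℝ × ℝ} (hk : ContinuousAt k p) :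
    HasFDerivAt (fun q => (q.1 - p.1) * k q) (k p • ContinuousLinearMap.fst ℝ ℝ ℝ) p := by
  rw [hasFDerivAt_iff_isLittleO]
  have h1 : (fun q : ℝ × ℝ => q.1 - p.1) =O[nhds p] fun q => q - p :=
    Asymptotics.isBigO_of_le _ fun q => norm_fst_le (q - p)
  have h2 : (fun q => k q - k p) =o[nhds p] fun _ => (1 : ℝ) := by
    rw [Asymptotics.isLittleO_one_iff]
    simpa using hk.tendsto.sub_const (k p)
  refine ((h1.norm_right.mul_isLittleO h2).congr (fun q => ?_) fun q => mul_one _).of_norm_right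
  simp
  ring

/-- The derivative of a flow with respect to the starting point is the exponential of the integral
of `deriv g` along the trajectory. The integral is over `[0, 1]`, which turns the time into a
parameter. -/
theorem hasFDerivAt_flow (hg : ContDiff ℝ 1 g) (h0 : ∀ x, h x 0 = x)
    (hh : ∀ x t, HasDerivAt (h x) (g (h x t)) t) (hc : Continuous (Function.uncurry h))
    (p : ℝ × ℝ) : HasFDerivAt (Function.uncurry h)
      (Real.exp (p.2 * ∫ u in Set.Icc (0 : ℝ) 1, deriv g (h p.1 (u * p.2))) •
        ContinuousLinearMap.fst ℝ ℝ ℝ + g (h p.1 p.2) • ContinuousLinearMap.snd ℝ ℝ ℝ) p := by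
  obtain ⟨x, t⟩ := p
  let k : ℝ × ℝ → ℝ := fun q => Real.exp (∫ s in (0 : ℝ)..q.2, meanSlope g (h x s, h q.1 s))
  have hk : Continuous k := by
    refine Real.continuous_exp.comp ?_
    have : Continuous (Function.uncurry fun (q : ℝ × ℝ) s => meanSlope g (h x s, h q.1 s)) := by
      refine (continuous_meanSlope hg).comp (Continuous.prodMk ?_ ?_)
      · exact hc.comp (f := fun q : (ℝ × ℝ) × ℝ => (x, q.2)) (by fun_prop)
      · exact hc.comp (f := fun q : (ℝ × ℝ) × ℝ => (q.1.1, q.2)) (by fun_prop)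
    exact intervalIntegral.continuous_parametric_intervalIntegral_of_continuous this continuous_snd
  have hkp : k (x, t) = Real.exp (t * ∫ u in Set.Icc (0 : ℝ) 1, deriv g (h x (u * t))) := by
    simp only [k, meanSlope_self]
    rw [integral_Icc_eq_integral_Ioc, ← intervalIntegral.integral_of_le zero_le_one,
      ← smul_eq_mul t, intervalIntegral.smul_integral_comp_mul_right (fun s => deriv g (h x s))]
    simp
  have h1 := hasFDerivAt_mul_sub_of_continuousAt (p := (x, t)) hk.continuousAt
  have h2 : HasFDerivAt (fun q : ℝ × ℝ => h x q.2) (g (h x t) • ContinuousLinearMap.snd ℝ ℝ ℝ)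
      (x, t) := (hh x t).comp_hasFDerivAt (x, t) hasFDerivAt_snd
  rw [hkp] at h1
  refine (h1.add h2).congr_of_eventuallyEq (Filter.Eventually.of_forall fun q => ?_)
  have := flow_sub hg h0 hh x q.1 q.2
  simp only [Function.uncurry, Pi.add_apply, k]
  linarith

/-- The flow of a smooth vector field on the line is smooth in time and initial value jointly:
its partial derivatives are expressed by the flow itself, with no loss of regularity. -/
theorem contDiff_flow (hg : ContDiff ℝ ∞ g) (hgb : ∃ C, ∀ s, |deriv g s| ≤ C)
    (h0 : ∀ x, h x 0 = x) (hh : ∀ x t, HasDerivAt (h x) (g (h x t)) t) :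
    ContDiff ℝ ∞ (Function.uncurry h) := by
  have hg1 : ContDiff ℝ 1 g := hg.of_le (by simp)
  have hc := continuous_flow hg1 hgb h0 hh
  have hF := hasFDerivAt_flow hg1 h0 hh hc
  refine contDiff_infty.2 fun n => ?_
  induction n with
  | zero => exact contDiff_zero.2 hc
  | succ n ih =>
    rw [Nat.cast_succ, contDiff_succ_iff_fderiv]
    refine ⟨fun p => (hF p).differentiableAt, by simp, ?_⟩
    rw [show fderiv ℝ (Function.uncurry h) = _ from funext fun p => (hF p).fderiv]
    have hd : ContDiff ℝ n (deriv g) :=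
      ((contDiff_infty_iff_deriv.1 hg).2).of_le (by exact_mod_cast le_top)
    have hI : ContDiff ℝ n fun p : ℝ × ℝ =>
        ∫ u in Set.Icc (0 : ℝ) 1, deriv g (h p.1 (u * p.2)) := by
      refine contDiff_setIntegral_nat (Ψ := fun u (p : ℝ × ℝ) => deriv g (h p.1 (u * p.2))) ?_
        isCompact_Icc
      refine hd.comp (ih.comp (f := fun q : ℝ × ℝ × ℝ => (q.2.1, q.1 * q.2.2)) (by fun_prop))
    have h1 := (contDiff_snd.mul hI).exp
    have h2 := (contDiff_infty.1 hg n).comp ih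
    exact (h1.smul contDiff_const).add (h2.smul contDiff_const)

/-- The flow of `stretchField` on `ℝ`. -/
def stretchFlow (x t : ℝ) : ℝ :=
  open Classical in if x ∈ Set.Ioo (-1 : ℝ) 1 then squeeze (stretch x + t) else x

theorem stretchFlow_zero (x : ℝ) : stretchFlow x 0 = x := by
  unfold stretchFlow
  split_ifs with h
  · rw [add_zero, squeeze_stretch h]
  · rfl

theorem hasDerivAt_stretchFlow (x t : ℝ) :
    HasDerivAt (stretchFlow x) (stretchField (stretchFlow x t)) t := by
  by_cases h : x ∈ Set.Ioo (-1 : ℝ) 1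
  · have : stretchFlow x = fun t => squeeze (stretch x + t) := funext fun t => if_pos h
    rw [this]
    exact (hasDerivAt_squeeze _).comp_const_add _ _
  · have : stretchFlow x = fun _ => x := funext fun t => if_neg h
    rw [this, stretchField_eq_zero h]
    exact hasDerivAt_const _ _

theorem hasCompactSupport_stretchField : HasCompactSupport stretchField :=
  HasCompactSupport.of_support_subset_isCompact (isCompact_Icc (a := (-1 : ℝ)) (b := 1))
    fun s hs => by
      by_contra h
      exact hs (stretchField_eq_zero fun h' => h ⟨h'.1.le, h'.2.le⟩)

theorem exists_bound_deriv_stretchField : ∃ C, ∀ s, |deriv stretchField s| ≤ C := by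
  obtain ⟨C, hC⟩ :=
    (contDiff_stretchField.continuous_deriv (by simp)).bounded_above_of_compact_support
      hasCompactSupport_stretchField.deriv
  exact ⟨C, hC⟩

theorem contDiff_stretchFlow : ContDiff ℝ ∞ (Function.uncurry stretchFlow) :=
  contDiff_flow contDiff_stretchField exists_bound_deriv_stretchField stretchFlow_zero
    hasDerivAt_stretchFlow

/-- The affine map from `(-1, 1)` to `(c, d)`. -/
def affIoo (c d s : ℝ) : ℝ := (c + d) / 2 + (d - c) / 2 * s

/-- The inverse of `affIoo`. -/
def affIooInv (c d s : ℝ) : ℝ := (s - (c + d) / 2) / ((d - c) / 2)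

theorem affIooInv_mem_iff {c d : ℝ} (h : c < d) (s : ℝ) :
    affIooInv c d s ∈ Set.Ioo (-1 : ℝ) 1 ↔ s ∈ Set.Ioo c d := by
  have h2 : 0 < (d - c) / 2 := by linarith
  simp only [affIooInv, Set.mem_Ioo, lt_div_iff₀ h2, div_lt_iff₀ h2]
  constructor <;> rintro ⟨h3, h4⟩ <;> constructor <;> linarith

theorem affIoo_inv {c d : ℝ} (h : c < d) (s : ℝ) : affIoo c d (affIooInv c d s) = s := by
  have h2 : (d - c) / 2 ≠ 0 := by linarith
  rw [affIoo, affIooInv, mul_div_cancel₀ _ h2]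
  ring

theorem affIooInv_aff {c d : ℝ} (h : c < d) (s : ℝ) : affIooInv c d (affIoo c d s) = s := by
  have h2 : (d - c) / 2 ≠ 0 := by linarith
  rw [affIoo, affIooInv, add_sub_cancel_left, mul_div_cancel_left₀ _ h2]

/-- A flow on `ℝ` moving exactly the points of `(c, d)`. -/
def ioFlow (c d x t : ℝ) : ℝ := affIoo c d (stretchFlow (affIooInv c d x) t)

/-- The diffeomorphism from `ℝ` to `(c, d)` which turns translations into `ioFlow`. -/
def ioTime (c d t : ℝ) : ℝ := affIoo c d (squeeze t)

/-- The inverse of `ioTime`. -/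
def ioTimeInv (c d x : ℝ) : ℝ := stretch (affIooInv c d x)

theorem contDiff_ioFlow (c d : ℝ) : ContDiff ℝ ∞ (Function.uncurry (ioFlow c d)) := by
  have : ContDiff ℝ ∞ fun p : ℝ × ℝ => stretchFlow (affIooInv c d p.1) p.2 :=
    contDiff_stretchFlow.comp (f := fun p : ℝ × ℝ => (affIooInv c d p.1, p.2))
      (by unfold affIooInv; fun_prop)
  exact contDiff_const.add (contDiff_const.mul this)

theorem contDiff_ioTime (c d : ℝ) : ContDiff ℝ ∞ (ioTime c d) :=
  contDiff_const.add (contDiff_const.mul contDiff_squeeze)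

section

variable {c d : ℝ} (hcd : c < d)
include hcd

theorem isIntervalFlow_ioFlow : IsIntervalFlow c d (ioFlow c d) := by
  have h2 : 0 < (d - c) / 2 := by linarith
  refine ⟨fun s => (d - c) / 2 * stretchField (affIooInv c d s), ?_, fun s hs => ?_, fun s hs => ?_,
    fun x => ⟨?_, fun t => ?_⟩⟩
  · exact contDiff_const.mul (contDiff_stretchField.comp (by unfold affIooInv; fun_prop))
  · exact mul_pos h2 (stretchField_pos ((affIooInv_mem_iff hcd s).2 hs))
  · simp only [stretchField_eq_zero (mt (affIooInv_mem_iff hcd s).1 hs), mul_zero]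
  · rw [ioFlow, stretchFlow_zero, affIoo_inv hcd]
  · simp only [ioFlow, affIooInv_aff hcd]
    exact ((hasDerivAt_stretchFlow _ t).const_mul _).const_add _

theorem ioTime_mem (t : ℝ) : ioTime c d t ∈ Set.Ioo c d := by
  rw [← affIooInv_mem_iff hcd, ioTime, affIooInv_aff hcd]
  exact squeeze_mem t

theorem ioTimeInv_ioTime (t : ℝ) : ioTimeInv c d (ioTime c d t) = t := by
  rw [ioTime, ioTimeInv, affIooInv_aff hcd, stretch_squeeze]

theorem ioTime_ioTimeInv {x : ℝ} (hx : x ∈ Set.Ioo c d) : ioTime c d (ioTimeInv c d x) = x := by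
  rw [ioTime, ioTimeInv, squeeze_stretch ((affIooInv_mem_iff hcd x).2 hx), affIoo_inv hcd]

theorem ioFlow_of_notMem {x : ℝ} (hx : x ∉ Set.Ioo c d) (t : ℝ) : ioFlow c d x t = x := by
  rw [ioFlow, stretchFlow, if_neg (mt (affIooInv_mem_iff hcd x).1 hx), affIoo_inv hcd]

theorem ioFlow_ioTime (s t : ℝ) : ioFlow c d (ioTime c d s) t = ioTime c d (s + t) := by
  rw [ioFlow, ioTime, affIooInv_aff hcd, stretchFlow, if_pos (squeeze_mem s), stretch_squeeze,
    ioTime]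

theorem ioFlow_mem_iff {x : ℝ} (t : ℝ) : ioFlow c d x t ∈ Set.Ioo c d ↔ x ∈ Set.Ioo c d := by
  by_cases hx : x ∈ Set.Ioo c d
  · rw [← ioTime_ioTimeInv hcd hx, ioFlow_ioTime hcd]
    exact ⟨fun _ => ioTime_mem hcd _, fun _ => ioTime_mem hcd _⟩
  · rw [ioFlow_of_notMem hcd hx]

theorem ioFlow_neg_ioFlow (x t : ℝ) : ioFlow c d (ioFlow c d x t) (-t) = x := by
  by_cases hx : x ∈ Set.Ioo c d
  · conv_lhs => rw [← ioTime_ioTimeInv hcd hx]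
    rw [ioFlow_ioTime hcd, ioFlow_ioTime hcd, add_neg_cancel_right, ioTime_ioTimeInv hcd hx]
  · rw [ioFlow_of_notMem hcd hx, ioFlow_of_notMem hcd hx]

theorem contDiffOn_ioTimeInv : ContDiffOn ℝ ∞ (ioTimeInv c d) (Set.Ioo c d) :=
  contDiffOn_stretch.comp (by unfold affIooInv; fun_prop) fun x hx => (affIooInv_mem_iff hcd x).2 hx

end

end Flow

/-! ### Functionals bounded by finitely many derivatives -/

section Jets

variable {E F G Q : Type} [NormedAddCommGroup E] [NormedSpace ℝ E] [NormedAddCommGroup F]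
  [NormedSpace ℝ F] [NormedAddCommGroup G] [NormedSpace ℝ G] [NormedAddCommGroup Q]
  [NormedSpace ℝ Q]

variable {S : Set E} [CompactSpace S]

/-- The restriction to a compact set of a smooth function of two variables. -/
def sliceOn (S : Set E) [CompactSpace S] (k : Q × E → G) (hk : Continuous k) (z : Q) : C(S, G) :=
  ⟨fun y => k (z, y), hk.comp (Continuous.prodMk continuous_const continuous_subtype_val)⟩

omit [NormedSpace ℝ E] [NormedSpace ℝ G] [NormedSpace ℝ Q] in
theorem continuous_sliceOn {k : Q × E → G} (hk : Continuous k) : Continuous (sliceOn S k hk) := by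
  have : Continuous fun p : Q × S => k (p.1, p.2) := by fun_prop
  exact (ContinuousMap.curry ⟨_, this⟩).continuous

theorem contDiff_fderiv_fst {n m : ℕ∞} {k : Q × E → G} (hk : ContDiff ℝ n k)
    (hm : (m + 1 : ℕ∞) ≤ n) :
    ContDiff ℝ m fun p : Q × E => fderiv ℝ (fun z => k (z, p.2)) p.1 :=
  ContDiff.fderiv (m := n) (n := m) (f := fun (p : Q × E) z => k (z, p.2))
    (hk.comp (f := fun q : (Q × E) × Q => (q.2, q.1.2)) (by fun_prop)) contDiff_fst
    (by exact_mod_cast hm)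

theorem continuous_fderiv_fst {k : Q × E → G} (hk : ContDiff ℝ 1 k) :
    Continuous fun p : Q × E => fderiv ℝ (fun z => k (z, p.2)) p.1 :=
  (contDiff_fderiv_fst (n := 1) (m := 0) hk (by simp)).continuous

variable [FiniteDimensional ℝ Q]

/-- The derivative of `sliceOn S k` with respect to the parameter. -/
def sliceOnDeriv (S : Set E) [CompactSpace S] (k : Q × E → G) (hk : ContDiff ℝ 1 k) (z : Q) :
    Q →L[ℝ] C(S, G) :=
  LinearMap.toContinuousLinearMap
    { toFun := fun v => sliceOn S (fun p => fderiv ℝ (fun z => k (z, p.2)) p.1 v)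
        ((continuous_fderiv_fst hk).clm_apply continuous_const) z
      map_add' := fun v w => by ext y; simp [sliceOn]
      map_smul' := fun r v => by ext y; simp [sliceOn] }

theorem hasFDerivAt_sliceOn {k : Q × E → G} (hk : ContDiff ℝ 1 k) (z : Q) :
    HasFDerivAt (sliceOn S k hk.continuous) (sliceOnDeriv S k hk z) z := by
  set D : Q × E → Q →L[ℝ] G := fun p : Q × E => fderiv ℝ (fun z => k (z, p.2)) p.1 with hD
  have hDc : Continuous D := continuous_fderiv_fst hk
  have hkd : ∀ z y, HasFDerivAt (fun z => k (z, y)) (D (z, y)) z := fun z y =>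
    ((hk.comp (f := fun z : Q => (z, y)) (by fun_prop)).differentiable one_ne_zero z).hasFDerivAt
  rw [hasFDerivAt_iff_isLittleO]
  rw [Asymptotics.isLittleO_iff]
  intro ε hε
  have hcont := (continuous_sliceOn (S := S) hDc).continuousAt (x := z)
  rw [Metric.continuousAt_iff] at hcont
  obtain ⟨δ, hδ, h⟩ := hcont ε hε
  filter_upwards [Metric.ball_mem_nhds z hδ] with w hw
  refine (ContinuousMap.norm_le _ (by positivity)).2 fun y => ?_
  have hb : ∀ x ∈ Metric.ball z δ, ‖D (x, y) - D (z, y)‖ ≤ ε := by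
    intro x hx
    have h1 := h hx
    rw [dist_eq_norm] at h1
    exact (ContinuousMap.norm_coe_le_norm (sliceOn S D hDc x - sliceOn S D hDc z) y).trans h1.le
  exact (convex_ball z δ).norm_image_sub_le_of_norm_hasFDerivWithin_le'
    (f := fun z => k (z, y)) (fun x _ => (hkd x y).hasFDerivWithinAt) hb
    (Metric.mem_ball_self hδ) hw

theorem contDiff_sliceOn {k : Q × E → G} (hk : ContDiff ℝ ∞ k) :
    ContDiff ℝ ∞ (sliceOn S k hk.continuous) := by
  refine contDiff_infty.2 fun n => ?_
  induction n generalizing G with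
  | zero => exact contDiff_zero.2 (continuous_sliceOn hk.continuous)
  | succ n ih =>
    have hF := hasFDerivAt_sliceOn (S := S) (hk.of_le (by simp) : ContDiff ℝ 1 k)
    rw [Nat.cast_succ, contDiff_succ_iff_fderiv_apply]
    refine ⟨fun z => (hF z).differentiableAt, by simp, fun v => ?_⟩
    rw [show (fun z => fderiv ℝ (sliceOn S k hk.continuous) z v) = _ from
      funext fun z => congrArg (fun T : Q →L[ℝ] C(S, G) => T v) (hF z).fderiv]
    exact ih (k := fun p : Q × E => fderiv ℝ (fun z => k (z, p.2)) p.1 v)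
      ((contDiff_fderiv_fst (n := ⊤) (m := ⊤) hk (by simp)).clm_apply contDiff_const)

/-- The smooth functions supported in `S`. -/
def smoothOnCompact (S : Set E) (F : Type) [NormedAddCommGroup F] [NormedSpace ℝ F] :
    Submodule ℝ (E → F) where
  carrier := {g | ContDiff ℝ ∞ g ∧ ∀ y ∉ S, g y = 0}
  zero_mem' := ⟨contDiff_const, fun _ _ => rfl⟩
  add_mem' := fun h h' => ⟨h.1.add h'.1, fun y hy => by simp [h.2 y hy, h'.2 y hy]⟩
  smul_mem' := fun c _ h => ⟨h.1.const_smul c, fun y hy => by simp [h.2 y hy]⟩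

/-- The derivatives of order at most `N`. -/
def JetSpace (E F : Type) [NormedAddCommGroup E] [NormedSpace ℝ E] [NormedAddCommGroup F]
    [NormedSpace ℝ F] (N : ℕ) : Type := ∀ i : Fin (N + 1), E [×(i : ℕ)]→L[ℝ] F

instance (N : ℕ) : NormedAddCommGroup (JetSpace E F N) :=
  inferInstanceAs (NormedAddCommGroup (∀ i : Fin (N + 1), E [×(i : ℕ)]→L[ℝ] F))

instance [CompleteSpace F] (N : ℕ) : CompleteSpace (JetSpace E F N) :=
  inferInstanceAs (CompleteSpace (∀ i : Fin (N + 1), E [×(i : ℕ)]→L[ℝ] F))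

instance (N : ℕ) : NormedSpace ℝ (JetSpace E F N) :=
  inferInstanceAs (NormedSpace ℝ (∀ i : Fin (N + 1), E [×(i : ℕ)]→L[ℝ] F))

/-- The `N`-jet of a smooth function supported in the compact set `S`. -/
def jet (S : Set E) [CompactSpace S] (N : ℕ) : smoothOnCompact S F →ₗ[ℝ] C(S, JetSpace E F N) where
  toFun g := ⟨fun y i => iteratedFDeriv ℝ i g.1 y, by
    refine continuous_pi fun i => ?_
    exact (g.2.1.continuous_iteratedFDeriv (by exact_mod_cast le_top)).comp continuous_subtype_val⟩
  map_add' g g' := by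
    refine ContinuousMap.ext fun y => funext fun i => ?_
    exact iteratedFDeriv_add_apply ((g.2.1.of_le (by exact_mod_cast le_top)).contDiffAt)
      ((g'.2.1.of_le (by exact_mod_cast le_top)).contDiffAt)
  map_smul' c g := by
    refine ContinuousMap.ext fun y => funext fun i => ?_
    exact iteratedFDeriv_const_smul_apply ((g.2.1.of_le (by exact_mod_cast le_top)).contDiffAt)

theorem jet_injective (N : ℕ) : Function.Injective (jet (F := F) S N) := by
  intro g g' h
  refine Subtype.ext (funext fun y => ?_)
  by_cases hy : y ∈ S
  · have h2 := congrArg (fun q => q ![]) (congrFun (DFunLike.congr_fun h ⟨y, hy⟩) 0)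
    exact h2
  · rw [g.2.2 y hy, g'.2.2 y hy]

/-- A functional on smooth functions supported in a compact set which is bounded by finitely many
derivatives extends to a continuous functional of the jet, by the Hahn-Banach theorem. -/
theorem exists_extension_of_bound [FiniteDimensional ℝ G] (N : ℕ) (τ : smoothOnCompact S F →ₗ[ℝ] G)
    (C : ℝ) (hτ : ∀ g : smoothOnCompact S F, ∀ M : ℝ, 0 ≤ M →
      (∀ i ≤ N, ∀ y ∈ S, ‖iteratedFDeriv ℝ i g.1 y‖ ≤ M) → ‖τ g‖ ≤ C * M) :
    ∃ τ' : C(S, JetSpace E F N) →L[ℝ] G, ∀ g, τ g = τ' (jet S N g) := by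
  let e := LinearEquiv.ofInjective (jet (F := F) S N) (jet_injective N)
  let f : LinearMap.range (jet (F := F) S N) →L[ℝ] G :=
    (τ.comp e.symm.toLinearMap).mkContinuous C (fun x => by
      obtain ⟨g, rfl⟩ := e.surjective x
      have h0 : (τ.comp e.symm.toLinearMap) (e g) = τ g := congrArg τ (e.symm_apply_apply g)
      rw [h0]
      refine hτ g _ (norm_nonneg _) fun i hi y hy => ?_
      have h1 := ContinuousMap.norm_coe_le_norm (jet S N g) ⟨y, hy⟩
      exact (norm_le_pi_norm (jet S N g ⟨y, hy⟩) ⟨i, by omega⟩).trans h1)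
  obtain ⟨τ', h⟩ := f.exist_extension_of_finiteDimensional_range
  refine ⟨τ', fun g => ?_⟩
  have h1 := DFunLike.congr_fun h (e g)
  simpa [f, e] using h1

omit [FiniteDimensional ℝ Q] in
theorem jet_slice {k : Q × E → F} (hk : ContDiff ℝ ∞ k) (N : ℕ) :
    ContDiff ℝ ∞ fun p : Q × E => (fun i => iteratedFDeriv ℝ i (fun y => k (p.1, y)) p.2 :
      JetSpace E F N) :=
  contDiff_pi.2 fun i => contDiff_iteratedFDeriv_slice hk i

/-- A bounded functional applied to a smooth family of functions with supports in a fixed compact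
set depends smoothly on the parameter. -/
theorem contDiff_functional_slice [FiniteDimensional ℝ G] (N : ℕ)
    (τ : smoothOnCompact S F →ₗ[ℝ] G)
    (C : ℝ) (hτ : ∀ g : smoothOnCompact S F, ∀ M : ℝ, 0 ≤ M →
      (∀ i ≤ N, ∀ y ∈ S, ‖iteratedFDeriv ℝ i g.1 y‖ ≤ M) → ‖τ g‖ ≤ C * M)
    {k : Q × E → F} (hk : ContDiff ℝ ∞ k) (g : Q → smoothOnCompact S F)
    (hg : ∀ z y, (g z).1 y = k (z, y)) : ContDiff ℝ ∞ fun z => τ (g z) := by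
  obtain ⟨τ', h⟩ := exists_extension_of_bound N τ C hτ
  simp_rw [h]
  have : (fun z => jet S N (g z)) = sliceOn S _ (jet_slice hk N).continuous := by
    funext z
    refine ContinuousMap.ext fun y => funext fun i => ?_
    have : (g z).1 = fun y => k (z, y) := funext (hg z)
    simp only [jet, sliceOn, LinearMap.coe_mk, AddHom.coe_mk, this]
    rfl
  rw [show (fun z => τ' (jet S N (g z))) = τ' ∘ fun z => jet S N (g z) from rfl, this]
  exact (ContinuousLinearMap.contDiff (𝕜 := ℝ) (n := ∞) τ').comp (contDiff_sliceOn (jet_slice hk N))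

variable [MeasurableSpace Q] [BorelSpace Q] [ProperSpace E] {μ : Measure Q}
  [IsLocallyFiniteMeasure μ]

omit [NormedAddCommGroup Q] [NormedSpace ℝ Q] [FiniteDimensional ℝ Q] [BorelSpace Q]
  [IsLocallyFiniteMeasure μ] in
theorem LinearIsometryEquiv.setIntegral_comp_comm {A B : Type} [NormedAddCommGroup A]
    [NormedSpace ℝ A] [NormedAddCommGroup B] [NormedSpace ℝ B] (c : A ≃ₗᵢ[ℝ] B) (Z : Set Q)
    (f : Q → A) : ∫ z in Z, c (f z) ∂μ = c (∫ z in Z, f z ∂μ) :=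
  c.toContinuousLinearEquiv.integral_comp_comm f

omit [FiniteDimensional ℝ Q] in
theorem iteratedFDeriv_setIntegral [CompleteSpace F] {k : Q × E → F} (hk : ContDiff ℝ ∞ k)
    {Z : Set Q} (hZ : IsCompact Z) (i : ℕ) (y : E) :
    iteratedFDeriv ℝ i (fun y => ∫ z in Z, k (z, y) ∂μ) y =
      ∫ z in Z, iteratedFDeriv ℝ i (fun y => k (z, y)) y ∂μ := by
  induction i generalizing y with
  | zero =>
    exact ((continuousMultilinearCurryFin0 ℝ E F).symm.toContinuousLinearEquiv.integral_comp_comm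
      fun z => k (z, y)).symm
  | succ i ih =>
    have h := contDiff_iteratedFDeriv_slice hk i
    rw [iteratedFDeriv_succ_eq_comp_left, Function.comp_apply, funext ih,
      (hasFDerivAt_setIntegral_of_contDiff
        (Ψ := fun z y => iteratedFDeriv ℝ i (fun y => k (z, y)) y) (h.of_le (by simp)) hZ y).fderiv]
    exact (LinearIsometryEquiv.setIntegral_comp_comm (A := E →L[ℝ] E [×i]→L[ℝ] F)
      (B := E [×(i + 1)]→L[ℝ] F)
      (continuousMultilinearCurryLeftEquiv ℝ (fun _ : Fin (i + 1) => E) F).symm Z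
      (μ := μ) _).symm

/-- A bounded functional commutes with integration of a smooth family of functions with supports
in a fixed compact set. -/
theorem functional_setIntegral [FiniteDimensional ℝ G] [CompleteSpace F] (N : ℕ)
    (τ : smoothOnCompact S F →ₗ[ℝ] G)
    (C : ℝ) (hτ : ∀ g : smoothOnCompact S F, ∀ M : ℝ, 0 ≤ M →
      (∀ i ≤ N, ∀ y ∈ S, ‖iteratedFDeriv ℝ i g.1 y‖ ≤ M) → ‖τ g‖ ≤ C * M)
    {k : Q × E → F} (hk : ContDiff ℝ ∞ k) (g : Q → smoothOnCompact S F)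
    (hg : ∀ z y, (g z).1 y = k (z, y)) {Z : Set Q} (hZ : IsCompact Z) (G' : smoothOnCompact S F)
    (hG' : ∀ y, G'.1 y = ∫ z in Z, k (z, y) ∂μ) : τ G' = ∫ z in Z, τ (g z) ∂μ := by
  obtain ⟨τ', h⟩ := exists_extension_of_bound N τ C hτ
  simp_rw [h]
  have hs : (fun z => jet S N (g z)) = sliceOn S _ (jet_slice hk N).continuous := by
    funext z
    refine ContinuousMap.ext fun y => funext fun i => ?_
    have : (g z).1 = fun y => k (z, y) := funext (hg z)
    simp only [jet, sliceOn, LinearMap.coe_mk, AddHom.coe_mk, this]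
    rfl
  have hint : IntegrableOn (fun z => jet S N (g z)) Z μ := by
    rw [hs]
    exact (contDiff_sliceOn (jet_slice hk N)).continuous.continuousOn.integrableOn_compact hZ
  rw [ContinuousLinearMap.integral_comp_comm τ' hint]
  congr 1
  refine ContinuousMap.ext fun y => funext fun i => ?_
  let ev : C(S, JetSpace E F N) →L[ℝ] E [×(i : ℕ)]→L[ℝ] F :=
    (ContinuousLinearMap.proj i).comp (ContinuousMap.evalCLM ℝ y)
  change iteratedFDeriv ℝ i G'.1 y = ev (∫ z in Z, jet S N (g z) ∂μ)
  rw [← ContinuousLinearMap.integral_comp_comm ev hint, show G'.1 = _ from funext hG',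
    iteratedFDeriv_setIntegral hk hZ]
  refine integral_congr_ae (Filter.Eventually.of_forall fun z => ?_)
  change iteratedFDeriv ℝ i (fun y => k (z, y)) y = iteratedFDeriv ℝ i (g z).1 y
  rw [show (g z).1 = _ from funext (hg z)]

end Jets

/-! ### Alternating forms on `ℝⁿ` -/

section Alt

variable {n m : ℕ} {𝕜 : Type} [RCLike 𝕜]

/-- The values of an alternating form on tuples of basis vectors. -/
def altCoords (n m : ℕ) (𝕜 : Type) [RCLike 𝕜] :
    ((Rn n) [⋀^Fin m]→L[ℝ] 𝕜) →L[ℝ] ((Fin m → Fin n) → 𝕜) :=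
  ContinuousLinearMap.pi fun I =>
    ContinuousAlternatingMap.apply ℝ (Rn n) 𝕜 fun j => EuclideanSpace.basisFun (Fin n) ℝ (I j)

theorem altCoords_injective : Function.Injective (altCoords n m 𝕜) := by
  intro a b h
  apply ContinuousAlternatingMap.toAlternatingMap_injective
  exact (EuclideanSpace.basisFun (Fin n) ℝ).toBasis.ext_alternating fun I _ => by
    have h1 := congrFun h I
    simpa [altCoords] using h1

theorem exists_leftInverse_altCoords :
    ∃ L : ((Fin m → Fin n) → 𝕜) →L[ℝ] ((Rn n) [⋀^Fin m]→L[ℝ] 𝕜),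
      ∀ a, L (altCoords n m 𝕜 a) = a := by
  obtain ⟨L, hL⟩ := (altCoords n m 𝕜).toLinearMap.exists_leftInverse_of_injective
    (LinearMap.ker_eq_bot.2 altCoords_injective)
  exact ⟨LinearMap.toContinuousLinearMap L, fun a => LinearMap.congr_fun hL a⟩

instance finiteDimensional_alt : FiniteDimensional ℝ ((Rn n) [⋀^Fin m]→L[ℝ] 𝕜) :=
  FiniteDimensional.of_injective (altCoords n m 𝕜).toLinearMap altCoords_injective

theorem contDiff_alt_iff {E : Type*} [NormedAddCommGroup E] [NormedSpace ℝ E] {r : WithTop ℕ∞}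
    {g : E → (Rn n) [⋀^Fin m]→L[ℝ] 𝕜} :
    ContDiff ℝ r g ↔ ∀ I : Fin m → Fin n,
      ContDiff ℝ r fun y => g y fun j => EuclideanSpace.basisFun (Fin n) ℝ (I j) := by
  constructor
  · intro h I
    exact (ContinuousAlternatingMap.apply ℝ (Rn n) 𝕜
      fun j => EuclideanSpace.basisFun (Fin n) ℝ (I j)).contDiff.comp h
  · intro h
    obtain ⟨L, hL⟩ := exists_leftInverse_altCoords (n := n) (m := m) (𝕜 := 𝕜)
    have : g = fun y => L fun I => g y fun j => EuclideanSpace.basisFun (Fin n) ℝ (I j) :=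
      funext fun y => (hL (g y)).symm
    rw [this]
    exact L.contDiff.comp (contDiff_pi.2 h)

/-- The pullback of forms, as a smooth function of the linear map. -/
theorem contDiff_pullback : ContDiff ℝ ∞ fun A : Rn n →L[ℝ] Rn n =>
    (ContinuousAlternatingMap.compContinuousLinearMapCLM A :
      ((Rn n) [⋀^Fin m]→L[ℝ] 𝕜) →L[ℝ] (Rn n) [⋀^Fin m]→L[ℝ] 𝕜) := by
  refine contDiff_clm_apply_iff.2 fun a => contDiff_alt_iff.2 fun I => ?_
  exact (ContinuousMultilinearMap.contDiff (n := ∞) a.toContinuousMultilinearMap).comp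
    (contDiff_pi.2 fun j => contDiff_id.clm_apply contDiff_const)

theorem contDiffAt_pullback {E : Type*} [NormedAddCommGroup E] [NormedSpace ℝ E]
    {f : E → (Rn n) [⋀^Fin m]→L[ℝ] 𝕜} {A : E → Rn n →L[ℝ] Rn n} {x : E}
    (hf : ContDiffAt ℝ ∞ f x) (hA : ContDiffAt ℝ ∞ A x) :
    ContDiffAt ℝ ∞ (fun x => (f x).compContinuousLinearMap (A x)) x := by
  have h := (contDiff_pullback (𝕜 := 𝕜) (m := m)).contDiffAt.comp x hA
  exact h.clm_apply hf

end Alt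

/-! ### Forms in charts -/

section Forms

variable {n m : ℕ} {𝕜 : Type} [RCLike 𝕜] {X : Type u} [TopologicalSpace X] [ChartedSpace (Rn n) X]

open Classical in
/-- The form which is `e^* g` on the domain of the chart `e` and zero elsewhere. -/
def DForm.ofChart (e : OpenPartialHomeomorph X (Rn n)) (g : Rn n → (Rn n) [⋀^Fin m]→L[ℝ] 𝕜) :
    DForm n 𝕜 X m := fun x =>
  if x ∈ e.source then
    (g (e x)).compContinuousLinearMap (mfderiv 𝓘(ℝ, Rn n) 𝓘(ℝ, Rn n) e x) else 0

theorem DForm.ofChart_of_notMem {e : OpenPartialHomeomorph X (Rn n)}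
    (g : Rn n → (Rn n) [⋀^Fin m]→L[ℝ] 𝕜) {x : X} (hx : x ∉ e.source) :
    DForm.ofChart e g x = 0 := if_neg hx

theorem DForm.inChart_of_eq_zero {η : DForm n 𝕜 X m} (e : OpenPartialHomeomorph X (Rn n)) {y : Rn n}
    (h : η (e.symm y) = 0) : η.inChart e y = 0 := by
  simp only [DForm.inChart, h]
  rfl

theorem DForm.inChart_eventuallyEq_zero [T2Space X] {η : DForm n 𝕜 X m} {K : Set X}
    (hK : IsCompact K) (h : ∀ x ∉ K, η x = 0) {e : OpenPartialHomeomorph X (Rn n)} {y : Rn n}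
    (hy : y ∈ e.target) (hyK : e.symm y ∉ K) : η.inChart e =ᶠ[nhds y] 0 := by
  have h2 : ∀ᶠ z in nhds y, e.symm z ∈ Kᶜ :=
    (e.symm.continuousAt hy).eventually (hK.isClosed.isOpen_compl.mem_nhds hyK)
  filter_upwards [h2] with z hz
  exact DForm.inChart_of_eq_zero e (h _ hz)

theorem mfderiv_chart_comp {e : OpenPartialHomeomorph X (Rn n)} (he : e ∈ SmoothCharts n X)
    {y : Rn n} (hy : y ∈ e.target) :
    (show Rn n →L[ℝ] Rn n from mfderiv 𝓘(ℝ, Rn n) 𝓘(ℝ, Rn n) e (e.symm y)).comp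
      (show Rn n →L[ℝ] Rn n from mfderiv 𝓘(ℝ, Rn n) 𝓘(ℝ, Rn n) e.symm y) =
      ContinuousLinearMap.id ℝ (Rn n) := by
  have h1 : MDifferentiableAt 𝓘(ℝ, Rn n) 𝓘(ℝ, Rn n) e.symm y :=
    (contMDiffAt_symm_of_mem_maximalAtlas he hy).mdifferentiableAt (by simp)
  have h2 : MDifferentiableAt 𝓘(ℝ, Rn n) 𝓘(ℝ, Rn n) e (e.symm y) :=
    (contMDiffAt_of_mem_maximalAtlas he (e.map_target hy)).mdifferentiableAt (by simp)
  have h := mfderiv_comp y h2 h1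
  have h4 : (e ∘ e.symm) =ᶠ[nhds y] id := by
    filter_upwards [e.open_target.mem_nhds hy] with z hz using e.right_inv hz
  rw [h4.mfderiv_eq, mfderiv_id] at h
  exact h.symm

theorem mfderiv_symm_comp {e : OpenPartialHomeomorph X (Rn n)} (he : e ∈ SmoothCharts n X)
    {x : X} (hx : x ∈ e.source) :
    (show Rn n →L[ℝ] Rn n from mfderiv 𝓘(ℝ, Rn n) 𝓘(ℝ, Rn n) e.symm (e x)).comp
      (show Rn n →L[ℝ] Rn n from mfderiv 𝓘(ℝ, Rn n) 𝓘(ℝ, Rn n) e x) =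
      ContinuousLinearMap.id ℝ (Rn n) := by
  have h1 : MDifferentiableAt 𝓘(ℝ, Rn n) 𝓘(ℝ, Rn n) e.symm (e x) :=
    (contMDiffAt_symm_of_mem_maximalAtlas he (e.map_source hx)).mdifferentiableAt (by simp)
  have h2 : MDifferentiableAt 𝓘(ℝ, Rn n) 𝓘(ℝ, Rn n) e x :=
    (contMDiffAt_of_mem_maximalAtlas he hx).mdifferentiableAt (by simp)
  have h := mfderiv_comp x h1 h2
  have h4 : (e.symm ∘ e) =ᶠ[nhds x] id := by
    filter_upwards [e.open_source.mem_nhds hx] with z hz using e.left_inv hz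
  rw [h4.mfderiv_eq, mfderiv_id] at h
  exact h.symm

theorem DForm.inChart_ofChart {e : OpenPartialHomeomorph X (Rn n)} (he : e ∈ SmoothCharts n X)
    (g : Rn n → (Rn n) [⋀^Fin m]→L[ℝ] 𝕜) {y : Rn n} (hy : y ∈ e.target) :
    (DForm.ofChart e g).inChart e y = g y := by
  have h0 : DForm.ofChart e g (e.symm y) = (g (e (e.symm y))).compContinuousLinearMap
      (mfderiv 𝓘(ℝ, Rn n) 𝓘(ℝ, Rn n) e (e.symm y)) := if_pos (e.map_target hy)
  have h1 : (DForm.ofChart e g).inChart e y = (g (e (e.symm y))).compContinuousLinearMap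
      ((show Rn n →L[ℝ] Rn n from mfderiv 𝓘(ℝ, Rn n) 𝓘(ℝ, Rn n) e (e.symm y)).comp
      (show Rn n →L[ℝ] Rn n from mfderiv 𝓘(ℝ, Rn n) 𝓘(ℝ, Rn n) e.symm y)) := by
    unfold DForm.inChart
    rw [h0]
    rfl
  rw [h1, mfderiv_chart_comp he hy, e.right_inv hy]
  rfl

theorem DForm.eq_pullback_inChart {e : OpenPartialHomeomorph X (Rn n)} (he : e ∈ SmoothCharts n X)
    (η : DForm n 𝕜 X m) {x : X} (hx : x ∈ e.source) :
    η x = (η.inChart e (e x)).compContinuousLinearMap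
      (mfderiv 𝓘(ℝ, Rn n) 𝓘(ℝ, Rn n) e x) := by
  have key : ∀ (x' : X) (_ : x' = x) (A B : Rn n →L[ℝ] Rn n),
      A.comp B = ContinuousLinearMap.id ℝ (Rn n) →
      (show (Rn n) [⋀^Fin m]→L[ℝ] 𝕜 from η x) =
      ((show (Rn n) [⋀^Fin m]→L[ℝ] 𝕜 from η x').compContinuousLinearMap
        A).compContinuousLinearMap B := by
    rintro x' rfl A B h
    have : ((show (Rn n) [⋀^Fin m]→L[ℝ] 𝕜 from η x').compContinuousLinearMap
        A).compContinuousLinearMap B = (show (Rn n) [⋀^Fin m]→L[ℝ] 𝕜 from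
          η x').compContinuousLinearMap (A.comp B) := rfl
    rw [this, h]
    rfl
  exact key _ (e.left_inv hx) _ _ (mfderiv_symm_comp he hx)

theorem DForm.eq_zero_of_inChart {e : OpenPartialHomeomorph X (Rn n)} (he : e ∈ SmoothCharts n X)
    {η : DForm n 𝕜 X m} {x : X} (hx : x ∈ e.source) (h : η.inChart e (e x) = 0) : η x = 0 := by
  rw [DForm.eq_pullback_inChart he η hx, h]
  rfl

theorem DForm.ext_inChart {e : OpenPartialHomeomorph X (Rn n)} (he : e ∈ SmoothCharts n X)
    {η ζ : DForm n 𝕜 X m} (h : ∀ y ∈ e.target, η.inChart e y = ζ.inChart e y)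
    (hη : ∀ x ∉ e.source, η x = 0) (hζ : ∀ x ∉ e.source, ζ x = 0) : η = ζ := by
  funext x
  by_cases hx : x ∈ e.source
  · rw [DForm.eq_pullback_inChart he η hx, DForm.eq_pullback_inChart he ζ hx,
      h _ (e.map_source hx)]
  · rw [hη x hx, hζ x hx]

variable [IsManifold 𝓘(ℝ, Rn n) ∞ X]

/-- The change of chart, as a linear operation on values: see `DForm.inChart_change`. -/
theorem DForm.inChart_eq_transition (η : DForm n 𝕜 X m) {e e' : OpenPartialHomeomorph X (Rn n)}
    (he : e ∈ SmoothCharts n X) (he' : e' ∈ SmoothCharts n X) {y : Rn n}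
    (hy : y ∈ e.target ∩ e.symm ⁻¹' e'.source) :
    η.inChart e y = (ContinuousAlternatingMap.compContinuousLinearMapCLM
      (fderiv ℝ (fun z => e' (e.symm z)) y) :
        ((Rn n) [⋀^Fin m]→L[ℝ] 𝕜) →L[ℝ] (Rn n) [⋀^Fin m]→L[ℝ] 𝕜)
      (η.inChart e' (e' (e.symm y))) := η.inChart_change he he' hy.1 hy.2

omit [ChartedSpace (Rn n) X] [IsManifold 𝓘(ℝ, Rn n) ∞ X] in
theorem isOpen_overlap (e e' : OpenPartialHomeomorph X (Rn n)) :
    IsOpen (e.target ∩ e.symm ⁻¹' e'.source) :=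
  e.symm.isOpen_inter_preimage e'.open_source

theorem contDiffOn_transition {e e' : OpenPartialHomeomorph X (Rn n)}
    (he : e ∈ SmoothCharts n X) (he' : e' ∈ SmoothCharts n X) :
    ContDiffOn ℝ ∞ (fun z => e' (e.symm z)) (e.target ∩ e.symm ⁻¹' e'.source) :=
  fun _ hy => (DForm.contDiffAt_transition he he' hy.1 hy.2).contDiffWithinAt

theorem contDiffOn_transition_pullback {e e' : OpenPartialHomeomorph X (Rn n)}
    (he : e ∈ SmoothCharts n X) (he' : e' ∈ SmoothCharts n X) :
    ContDiffOn ℝ ∞ (fun y => (ContinuousAlternatingMap.compContinuousLinearMapCLM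
      (fderiv ℝ (fun z => e' (e.symm z)) y) :
        ((Rn n) [⋀^Fin m]→L[ℝ] 𝕜) →L[ℝ] (Rn n) [⋀^Fin m]→L[ℝ] 𝕜))
      (e.target ∩ e.symm ⁻¹' e'.source) :=
  contDiff_pullback.comp_contDiffOn
    ((contDiffOn_transition he he').fderiv_of_isOpen (isOpen_overlap e e') (by simp))

theorem DForm.contDiffAt_inChart_of_chart {η : DForm n 𝕜 X m}
    {e e' : OpenPartialHomeomorph X (Rn n)}
    (he : e ∈ SmoothCharts n X) (he' : e' ∈ SmoothCharts n X) {y : Rn n}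
    (hy : y ∈ e.target ∩ e.symm ⁻¹' e'.source)
    (h : ContDiffAt ℝ ∞ (η.inChart e') (e' (e.symm y))) : ContDiffAt ℝ ∞ (η.inChart e) y := by
  have hO := (isOpen_overlap e e').mem_nhds hy
  have h1 := (contDiffOn_transition_pullback (𝕜 := 𝕜) (m := m) he he').contDiffAt hO
  have h2 := h.comp y (DForm.contDiffAt_transition he he' hy.1 hy.2)
  refine (h1.clm_apply h2).congr_of_eventuallyEq ?_
  filter_upwards [hO] with z hz using η.inChart_eq_transition he he' hz

omit [IsManifold 𝓘(ℝ, Rn n) ∞ X] in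
theorem DForm.isSmoothOn_top_iff {η : DForm n 𝕜 X m} : η.IsSmoothOn ⊤ ↔
    ∀ e ∈ SmoothCharts n X, ∀ y ∈ e.target, ContDiffAt ℝ ∞ (η.inChart e) y := by
  simp only [DForm.IsSmoothOn, Opens.coe_top, Set.preimage_univ, Set.inter_univ]
  exact ⟨fun h e he y hy => (h e he).contDiffAt (e.open_target.mem_nhds hy),
    fun h e he y hy => (h e he y hy).contDiffWithinAt⟩

theorem DForm.ofChart_isSmoothOn [T2Space X] {e : OpenPartialHomeomorph X (Rn n)}
    (he : e ∈ SmoothCharts n X)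
    {g : Rn n → (Rn n) [⋀^Fin m]→L[ℝ] 𝕜} {S : Set (Rn n)} (hS : IsCompact S) (hSe : S ⊆ e.target)
    (hg : ContDiffOn ℝ ∞ g e.target) (hgS : ∀ y ∉ S, g y = 0) :
    (DForm.ofChart e g).IsSmoothOn ⊤ ∧ ∀ x ∉ e.symm '' S, DForm.ofChart e g x = 0 := by
  have hz : ∀ x ∉ e.symm '' S, DForm.ofChart e g x = 0 := by
    intro x hx
    by_cases hxe : x ∈ e.source
    · have : e x ∉ S := fun h => hx ⟨_, h, e.left_inv hxe⟩
      refine DForm.eq_zero_of_inChart he hxe ?_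
      rw [DForm.inChart_ofChart he g (e.map_source hxe), hgS _ this]
    · exact DForm.ofChart_of_notMem g hxe
  have hK : IsCompact (e.symm '' S) := hS.image_of_continuousOn (e.continuousOn_symm.mono hSe)
  refine ⟨DForm.isSmoothOn_top_iff.2 fun e' he' y hy => ?_, hz⟩
  by_cases hye : e'.symm y ∈ e.source
  · refine DForm.contDiffAt_inChart_of_chart he' he ⟨hy, hye⟩ ?_
    have h1 := e.open_target.mem_nhds (e.map_source hye)
    refine (hg.contDiffAt h1).congr_of_eventuallyEq ?_
    filter_upwards [h1] with z hz using DForm.inChart_ofChart he g hz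
  · have hyK : e'.symm y ∉ e.symm '' S := by
      rintro ⟨z, hz, h⟩
      exact hye (h ▸ e.map_target (hSe hz))
    exact contDiffAt_const.congr_of_eventuallyEq (DForm.inChart_eventuallyEq_zero hK hz hy hyK)

end Forms

section TestForms

variable {n m : ℕ} {𝕜 : Type} [RCLike 𝕜] {X : Type u} [TopologicalSpace X] [ChartedSpace (Rn n) X]
  [IsManifold 𝓘(ℝ, Rn n) ∞ X] [T2Space X]

/-- The test form with a given coordinate expression with compact support. -/
def TestForm.ofChart {U : Opens X} {e : OpenPartialHomeomorph X (Rn n)} (he : e ∈ SmoothCharts n X)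
    {S : Set (Rn n)} (hS : IsCompact S) (hSU : S ⊆ e.target ∩ e.symm ⁻¹' U)
    (g : Rn n → (Rn n) [⋀^Fin m]→L[ℝ] 𝕜) (hg : ContDiff ℝ ∞ g) (hgS : ∀ y ∉ S, g y = 0) :
    TestForm n 𝕜 m U :=
  Subtype.mk (DForm.ofChart e g)
    ⟨(DForm.ofChart_isSmoothOn he hS (fun _ h => (hSU h).1) hg.contDiffOn hgS).1, e.symm '' S,
      hS.image_of_continuousOn (e.continuousOn_symm.mono fun _ h => (hSU h).1),
      Set.image_subset_iff.2 fun _ h => (hSU h).2,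
      (DForm.ofChart_isSmoothOn he hS (fun _ h => (hSU h).1) hg.contDiffOn hgS).2⟩

omit [IsManifold 𝓘(ℝ, Rn n) ∞ X] [T2Space X] in
theorem TestForm.contDiffOn {U : Opens X} (φ : TestForm n 𝕜 m U)
    {e : OpenPartialHomeomorph X (Rn n)} (he : e ∈ SmoothCharts n X) :
    ContDiffOn ℝ ∞ (φ.1.inChart e) e.target := by
  have := φ.2.1 e he
  simpa using this

/-- The coordinate expression of a form, extended by zero outside the range of the chart. -/
def DForm.local (e : OpenPartialHomeomorph X (Rn n)) (η : DForm n 𝕜 X m) :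
    Rn n → (Rn n) [⋀^Fin m]→L[ℝ] 𝕜 := e.target.indicator (η.inChart e)

omit [IsManifold 𝓘(ℝ, Rn n) ∞ X] [T2Space X] in
theorem DForm.local_eq {e : OpenPartialHomeomorph X (Rn n)} (η : DForm n 𝕜 X m) {y : Rn n}
    (hy : y ∈ e.target) : η.local e y = η.inChart e y := Set.indicator_of_mem hy _

omit [IsManifold 𝓘(ℝ, Rn n) ∞ X] [T2Space X] in
theorem DForm.local_eq_zero {e : OpenPartialHomeomorph X (Rn n)} {η : DForm n 𝕜 X m} {K : Set X}
    (h : ∀ x ∉ K, η x = 0) {y : Rn n}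
    (hy : y ∉ e '' K) : η.local e y = 0 := by
  by_cases hye : y ∈ e.target
  · rw [DForm.local_eq η hye]
    refine DForm.inChart_of_eq_zero e (h _ fun hK => hy ⟨_, hK, e.right_inv hye⟩)
  · exact Set.indicator_of_notMem hye _

omit [ChartedSpace (Rn n) X] [IsManifold 𝓘(ℝ, Rn n) ∞ X] [T2Space X] in
theorem isCompact_chart_image {e : OpenPartialHomeomorph X (Rn n)} {K : Set X} (hK : IsCompact K)
    (hKe : K ⊆ e.source) : IsCompact (e '' K) := hK.image_of_continuousOn (e.continuousOn.mono hKe)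

omit [ChartedSpace (Rn n) X] [IsManifold 𝓘(ℝ, Rn n) ∞ X] [T2Space X] in
theorem chart_image_subset {e : OpenPartialHomeomorph X (Rn n)} {K : Set X}
    (hKe : K ⊆ e.source) : e '' K ⊆ e.target := by
  rintro _ ⟨x, hx, rfl⟩
  exact e.map_source (hKe hx)

omit [IsManifold 𝓘(ℝ, Rn n) ∞ X] [T2Space X] in
theorem TestForm.contDiff_local {U : Opens X} (φ : TestForm n 𝕜 m U)
    {e : OpenPartialHomeomorph X (Rn n)} (he : e ∈ SmoothCharts n X) {K : Set X} (hK : IsCompact K)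
    (hKe : K ⊆ e.source) (h : ∀ x ∉ K, φ.1 x = 0) : ContDiff ℝ ∞ (φ.1.local e) := by
  refine contDiff_iff_contDiffAt.2 fun y => ?_
  by_cases hy : y ∈ e.target
  · refine ((φ.contDiffOn he).contDiffAt (e.open_target.mem_nhds hy)).congr_of_eventuallyEq ?_
    filter_upwards [e.open_target.mem_nhds hy] with z hz using DForm.local_eq φ.1 hz
  · have h1 : y ∉ e '' K := fun h => hy (chart_image_subset hKe h)
    refine (contDiffAt_const (c := 0)).congr_of_eventuallyEq ?_
    filter_upwards [(isCompact_chart_image hK hKe).isClosed.isOpen_compl.mem_nhds h1] with z hz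
    exact DForm.local_eq_zero h hz

omit [IsManifold 𝓘(ℝ, Rn n) ∞ X] [T2Space X] in
theorem TestForm.local_eventuallyEq {U : Opens X} (φ : TestForm n 𝕜 m U)
    (e : OpenPartialHomeomorph X (Rn n)) {y : Rn n} (hy : y ∈ e.target) :
    φ.1.local e =ᶠ[nhds y] φ.1.inChart e := by
  filter_upwards [e.open_target.mem_nhds hy] with z hz using DForm.local_eq φ.1 hz

omit [IsManifold 𝓘(ℝ, Rn n) ∞ X] in
/-- Derivatives of a form with compact support in a chart vanish off the support. -/
theorem TestForm.bound_of_bound_on {U : Opens X} {φ : TestForm n 𝕜 m U}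
    {e : OpenPartialHomeomorph X (Rn n)} {K : Set X} (hK : IsCompact K)
    (h : ∀ x ∉ K, φ.1 x = 0) {N : ℕ} {M : ℝ} (hM : 0 ≤ M)
    (hb : ∀ i ≤ N, ∀ y ∈ e.target, e.symm y ∈ K → ‖iteratedFDeriv ℝ i (φ.1.inChart e) y‖ ≤ M) :
    ∀ i ≤ N, ∀ y ∈ e.target, ‖iteratedFDeriv ℝ i (φ.1.inChart e) y‖ ≤ M := by
  intro i hi y hy
  by_cases hyK : e.symm y ∈ K
  · exact hb i hi y hy hyK
  · have := (DForm.inChart_eventuallyEq_zero hK h hy hyK).iteratedFDeriv ℝ i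
    rw [this.eq_of_nhds]
    simpa using hM

/-- The derivatives in one chart are bounded by those in another one. -/
theorem TestForm.exists_bound_transition {U : Opens X} {e e' : OpenPartialHomeomorph X (Rn n)}
    (he : e ∈ SmoothCharts n X) (he' : e' ∈ SmoothCharts n X) {K : Set X} (hK : IsCompact K)
    (hKe : K ⊆ e.source) (hKe' : K ⊆ e'.source) (N : ℕ) : ∃ C : ℝ, 0 ≤ C ∧
    ∀ φ : TestForm n 𝕜 m U, (∀ x ∉ K, φ.1 x = 0) → ∀ M : ℝ, 0 ≤ M →
      (∀ i ≤ N, ∀ y ∈ e'.target, ‖iteratedFDeriv ℝ i (φ.1.inChart e') y‖ ≤ M) →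
      ∀ i ≤ N, ∀ y ∈ e.target, ‖iteratedFDeriv ℝ i (φ.1.inChart e) y‖ ≤ C * M := by
  have hO := isOpen_overlap e e'
  have hKO : e '' K ⊆ e.target ∩ e.symm ⁻¹' e'.source := by
    rintro _ ⟨x, hx, rfl⟩
    refine ⟨e.map_source (hKe hx), ?_⟩
    rw [Set.mem_preimage, e.left_inv (hKe hx)]
    exact hKe' hx
  obtain ⟨C, hC0, hC⟩ := exists_bound_iteratedFDeriv_clm_comp hO (isCompact_chart_image hK hKe) hKO
    (contDiffOn_transition_pullback (𝕜 := 𝕜) (m := m) he he') (contDiffOn_transition he he') N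
  refine ⟨C, hC0, fun φ hφ M hM hb => TestForm.bound_of_bound_on hK hφ (mul_nonneg hC0 hM) ?_⟩
  intro i hi y hy hyK
  have hyK' : y ∈ e '' K := ⟨_, hyK, e.right_inv hy⟩
  have h1 := hC (φ.1.inChart e') e'.target e'.open_target (φ.contDiffOn he')
    (fun z hz => e'.map_source hz.2) y hyK' M hM
    (fun i hi => hb i hi _ (e'.map_source (hKO hyK').2)) i hi
  refine le_trans (le_of_eq ?_) h1
  congr 1
  refine Filter.EventuallyEq.eq_of_nhds (Filter.EventuallyEq.iteratedFDeriv ℝ ?_ i)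
  filter_upwards [hO.mem_nhds (hKO hyK')] with z hz using φ.1.inChart_eq_transition he he' hz

/-- On a subset of the domain of a chart it is enough to check the continuity of a functional
in this chart. -/
theorem isContinuousFunctional_of_chart {U : Opens X} {e : OpenPartialHomeomorph X (Rn n)}
    (he : e ∈ SmoothCharts n X) (hU : (U : Set X) ⊆ e.source) {T : TestForm n 𝕜 m U →ₗ[𝕜] 𝕜}
    (h : ∀ K : Set X, IsCompact K → K ⊆ U → ∃ (C : ℝ) (N : ℕ), ∀ φ : TestForm n 𝕜 m U,
      (∀ x ∉ K, φ.1 x = 0) → ∀ M : ℝ, 0 ≤ M →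
      (∀ i ≤ N, ∀ y ∈ e.target, ‖iteratedFDeriv ℝ i (φ.1.inChart e) y‖ ≤ M) → ‖T φ‖ ≤ C * M) :
    IsContinuousFunctional T := by
  intro e' he' K hK hKe' hKU
  obtain ⟨C, N, hC⟩ := h K hK hKU
  obtain ⟨C', hC'0, hC'⟩ := TestForm.exists_bound_transition (𝕜 := 𝕜) (m := m) (U := U) he he' hK
    (hKU.trans hU) hKe' N
  refine ⟨C * C', N, fun φ hφ M hM hb => ?_⟩
  rw [mul_assoc]
  exact hC φ hφ _ (mul_nonneg hC'0 hM) (hC' φ hφ M hM hb)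

end TestForms

/-! ### Operations on currents -/

section CurrentOps

variable {n m m' : ℕ} {𝕜 : Type} [RCLike 𝕜] {X : Type u} [TopologicalSpace X]
  [ChartedSpace (Rn n) X]

theorem TestForm.ext {U : Opens X} {φ ψ : TestForm n 𝕜 m U} (h : ∀ x, φ.1 x = ψ.1 x) : φ = ψ :=
  Subtype.ext (funext h)

theorem Current.ext {U : Opens X} {S T : Current n 𝕜 m U} (h : ∀ φ, S.1 φ = T.1 φ) : S = T :=
  Subtype.ext (LinearMap.ext h)

variable [T2Space X]

/-- Precomposition with a local operator which is continuous for the derivatives preserves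
continuous functionals. -/
theorem IsContinuousFunctional.comp_local {U V : Opens X} {T : TestForm n 𝕜 m' U →ₗ[𝕜] 𝕜}
    (hT : IsContinuousFunctional T) (A : TestForm n 𝕜 m V →ₗ[𝕜] TestForm n 𝕜 m' U)
    (hA : ∀ e ∈ SmoothCharts n X, ∀ K : Set X, IsCompact K → K ⊆ e.source → K ⊆ V →
      ∃ K' : Set X, IsCompact K' ∧ K' ⊆ e.source ∧ K' ⊆ U ∧
      (∀ φ : TestForm n 𝕜 m V, (∀ x ∉ K, φ.1 x = 0) → ∀ x ∉ K', (A φ).1 x = 0) ∧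
      ∀ N : ℕ, ∃ (C : ℝ) (N' : ℕ), 0 ≤ C ∧ ∀ φ : TestForm n 𝕜 m V, ∀ y ∈ e.target, e.symm y ∈ K' →
        ∀ M : ℝ, 0 ≤ M → (∀ i ≤ N', ‖iteratedFDeriv ℝ i (φ.1.inChart e) y‖ ≤ M) →
        ∀ i ≤ N, ‖iteratedFDeriv ℝ i ((A φ).1.inChart e) y‖ ≤ C * M) :
    IsContinuousFunctional (T.comp A) := by
  intro e he K hK hKe hKV
  obtain ⟨K', hK', hKe', hKU', hs, hb⟩ := hA e he K hK hKe hKV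
  obtain ⟨C, N, hC⟩ := hT e he K' hK' hKe' hKU'
  obtain ⟨C', N', hC'0, hC'⟩ := hb N
  refine ⟨C * C', N', fun φ hφ M hM hbM => ?_⟩
  rw [mul_assoc]
  exact hC (A φ) (hs φ hφ) _ (mul_nonneg hC'0 hM) (TestForm.bound_of_bound_on hK' (hs φ hφ)
    (mul_nonneg hC'0 hM) fun i hi y hy hyK => hC' φ y hy hyK M hM (fun i hi => hbM i hi y hy) i hi)

variable [IsManifold 𝓘(ℝ, Rn n) ∞ X]

/-- The exterior derivative of a current. -/
def Current.d {U : Opens X} : Current n 𝕜 (m + 1) U →ₗ[𝕜] Current n 𝕜 m U where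
  toFun T := Subtype.mk (T.1.comp TestForm.d) <| T.2.comp_local _ fun e he K hK hKe hKU =>
    ⟨K, hK, hKe, hKU, fun φ hφ x hx => DForm.extD_eq_zero hK hφ hx, fun N => by
      obtain ⟨C, hC0, hC⟩ := exists_bound_iteratedFDeriv_clm_comp
        (F := Rn n →L[ℝ] ((Rn n) [⋀^Fin m]→L[ℝ] 𝕜)) (F' := (Rn n) [⋀^Fin (m + 1)]→L[ℝ] 𝕜)
        e.open_target (isCompact_chart_image hK hKe) (chart_image_subset hKe)
        (A := fun _ => ContinuousAlternatingMap.alternatizeUncurryFinCLM ℝ (Rn n) 𝕜 (n := m))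
        contDiffOn_const contDiffOn_id N
      refine ⟨C, N + 1, hC0, fun φ y hy hyK M hM hb i hi => ?_⟩
      have h1 : (TestForm.d φ).1.inChart e =ᶠ[nhds y] fun z =>
          ContinuousAlternatingMap.alternatizeUncurryFinCLM ℝ (Rn n) 𝕜
            (fderiv ℝ (φ.1.inChart e) z) := by
        filter_upwards [e.open_target.mem_nhds hy] with z hz using DForm.inChart_extD φ.2.1 he hz
      rw [(h1.iteratedFDeriv ℝ i).eq_of_nhds]
      refine hC (fderiv ℝ (φ.1.inChart e)) e.target e.open_target
        ((φ.contDiffOn he).fderiv_of_isOpen e.open_target (by simp)) (fun z hz => hz) y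
        ⟨_, hyK, e.right_inv hy⟩ M hM (fun i hi => ?_) i hi
      rw [id, norm_iteratedFDeriv_fderiv]
      exact hb _ (by omega)⟩
  map_add' _ _ := rfl
  map_smul' _ _ := rfl

theorem Current.isExtDeriv_iff {U : Opens X} {T : Current n 𝕜 (m + 1) U} {D : Current n 𝕜 m U} :
    T.IsExtDeriv D ↔ D = T.d := ⟨fun h => Current.ext h, fun h _ => h ▸ rfl⟩

theorem CurrentSubsheaf.mem_dPreimage {B : CurrentSubsheaf n 𝕜 X m} {U : Opens X}
    {T : Current n 𝕜 (m + 1) U} : T ∈ B.dPreimage U ↔ T.d ∈ B.sections U :=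
  ⟨fun ⟨_, hD, h⟩ => Current.isExtDeriv_iff.1 h ▸ hD,
    fun h => ⟨_, h, Current.isExtDeriv_iff.2 rfl⟩⟩

theorem CurrentSubsheaf.mem_dPreimage_of_locally {B : CurrentSubsheaf n 𝕜 X m} {U : Opens X}
    {T : Current n 𝕜 (m + 1) U} (h : ∀ x ∈ U, ∃ (V : Opens X) (h : V ≤ U), x ∈ V ∧
      Current.res h T ∈ B.dPreimage V) : T ∈ B.dPreimage U := by
  refine CurrentSubsheaf.mem_dPreimage.2 (B.of_locally fun x hx => ?_)
  obtain ⟨V, hV, hxV, hT⟩ := h x hx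
  exact ⟨V, hV, hxV, CurrentSubsheaf.mem_dPreimage.1 hT⟩

variable (n X) in
/-- The smooth real functions on `X`. -/
abbrev SmoothFun : Type u := C^∞⟮𝓘(ℝ, Rn n), X; 𝓘(ℝ), ℝ⟯

omit [IsManifold 𝓘(ℝ, Rn n) ∞ X] [T2Space X] in
theorem SmoothFun.contDiffOn (χ : SmoothFun n X) {e : OpenPartialHomeomorph X (Rn n)}
    (he : e ∈ SmoothCharts n X) : ContDiffOn ℝ ∞ (fun y => χ (e.symm y)) e.target := by
  intro y hy
  refine ContDiffAt.contDiffWithinAt ?_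
  rw [← contMDiffAt_iff_contDiffAt]
  exact χ.contMDiff.contMDiffAt.comp y (contMDiffAt_symm_of_mem_maximalAtlas he hy)

omit [IsManifold 𝓘(ℝ, Rn n) ∞ X] [T2Space X] in
theorem DForm.inChart_mul (χ : X → ℝ) (η : DForm n 𝕜 X m) (e : OpenPartialHomeomorph X (Rn n))
    (y : Rn n) : DForm.inChart e (fun x => χ x • η x : DForm n 𝕜 X m) y =
      χ (e.symm y) • η.inChart e y := rfl

/-- Multiplication of test forms on `V` by a smooth function whose support in `V` is contained
in `U`. -/
def TestForm.mulExt (χ : SmoothFun n X) {U V : Opens X} (h : tsupport χ ∩ V ⊆ U) :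
    TestForm n 𝕜 m V →ₗ[𝕜] TestForm n 𝕜 m U where
  toFun φ := Subtype.mk (fun x => χ x • φ.1 x) ⟨fun e he => by
      have h1 := φ.contDiffOn he
      simp only [Opens.coe_top, Set.preimage_univ, Set.inter_univ]
      exact (χ.contDiffOn he).smul h1, by
      obtain ⟨K, hK, hKV, hφ⟩ := φ.2.2
      refine ⟨K ∩ tsupport χ, hK.inter_right (isClosed_tsupport _),
        fun x hx => h ⟨hx.2, hKV hx.1⟩, fun x hx => ?_⟩
      by_cases hxK : x ∈ K
      · have : χ x = 0 := image_eq_zero_of_notMem_tsupport fun h => hx ⟨hxK, h⟩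
        change χ x • (φ.1 x : (TangentSpace 𝓘(ℝ, Rn n) x) [⋀^Fin m]→L[ℝ] 𝕜) = 0
        rw [this]
        exact zero_smul ℝ (A := (TangentSpace 𝓘(ℝ, Rn n) x) [⋀^Fin m]→L[ℝ] 𝕜) _
      · exact (congrArg (χ x • ·) (hφ x hxK)).trans
          (smul_zero (A := (TangentSpace 𝓘(ℝ, Rn n) x) [⋀^Fin m]→L[ℝ] 𝕜) (χ x))⟩
  map_add' φ ψ := TestForm.ext fun x =>
    smul_add (A := (TangentSpace 𝓘(ℝ, Rn n) x) [⋀^Fin m]→L[ℝ] 𝕜) (χ x) (φ.1 x) (ψ.1 x)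
  map_smul' c φ := TestForm.ext fun x =>
    smul_comm (α := (TangentSpace 𝓘(ℝ, Rn n) x) [⋀^Fin m]→L[ℝ] 𝕜) (χ x) c (φ.1 x)

omit [IsManifold 𝓘(ℝ, Rn n) ∞ X] [T2Space X] in
theorem TestForm.mulExt_apply (χ : SmoothFun n X) {U V : Opens X} (h : tsupport χ ∩ V ⊆ U)
    (φ : TestForm n 𝕜 m V) (x : X) : (TestForm.mulExt χ h φ).1 x = χ x • φ.1 x := rfl

omit [IsManifold 𝓘(ℝ, Rn n) ∞ X] [T2Space X] in
theorem TestForm.mulExt_eq_zero (χ : SmoothFun n X) {U V : Opens X} (h : tsupport χ ∩ V ⊆ U)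
    (φ : TestForm n 𝕜 m V) {x : X} (hx : χ x = 0 ∨ φ.1 x = 0) :
    (TestForm.mulExt χ h φ).1 x = 0 := by
  rw [TestForm.mulExt_apply]
  rcases hx with hx | hx <;> rw [hx]
  · exact zero_smul ℝ (A := (TangentSpace 𝓘(ℝ, Rn n) x) [⋀^Fin m]→L[ℝ] 𝕜) _
  · exact smul_zero (A := (TangentSpace 𝓘(ℝ, Rn n) x) [⋀^Fin m]→L[ℝ] 𝕜) (χ x)

omit [T2Space X] [IsManifold 𝓘(ℝ, Rn n) ∞ X] in
theorem TestForm.mulExt_eq_self (χ : SmoothFun n X) {U V : Opens X} (h : tsupport χ ∩ V ⊆ U)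
    (φ : TestForm n 𝕜 m V) {x : X} (hx : χ x = 1 ∨ φ.1 x = 0) :
    (TestForm.mulExt χ h φ).1 x = φ.1 x := by
  rcases hx with hx | hx
  · rw [TestForm.mulExt_apply, hx]
    exact one_smul ℝ (φ.1 x : (TangentSpace 𝓘(ℝ, Rn n) x) [⋀^Fin m]→L[ℝ] 𝕜)
  · rw [TestForm.mulExt_eq_zero χ h φ (Or.inr hx), hx]

/-- Multiplication of a current on `U` by a smooth function whose support in `V` is contained in
`U`, as a current on `V`. -/
def Current.mulExt (χ : SmoothFun n X) {U V : Opens X} (h : tsupport χ ∩ V ⊆ U)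
    (T : Current n 𝕜 m U) : Current n 𝕜 m V :=
  Subtype.mk (T.1.comp (TestForm.mulExt χ h)) <| T.2.comp_local _ fun e he K hK hKe hKV => by
    have hsub : K ∩ tsupport χ ⊆ K := Set.inter_subset_left
    refine ⟨K ∩ tsupport χ, hK.inter_right (isClosed_tsupport _), hsub.trans hKe,
      fun x hx => h ⟨hx.2, hKV hx.1⟩, fun φ hφ x hx => ?_, fun N => ?_⟩
    · refine TestForm.mulExt_eq_zero χ h φ ?_
      by_cases hxK : x ∈ K
      · exact Or.inl (image_eq_zero_of_notMem_tsupport fun h => hx ⟨hxK, h⟩)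
      · exact Or.inr (hφ x hxK)
    · obtain ⟨C, hC0, hC⟩ := exists_bound_iteratedFDeriv_clm_comp e.open_target
        (isCompact_chart_image hK hKe) (chart_image_subset hKe)
        (A := fun y => χ (e.symm y) • ContinuousLinearMap.id ℝ ((Rn n) [⋀^Fin m]→L[ℝ] 𝕜))
        ((χ.contDiffOn he).smul contDiffOn_const) contDiffOn_id N
      exact ⟨C, N, hC0, fun φ y hy hyK M hM hb i hi => hC (φ.1.inChart e) e.target e.open_target
        (φ.contDiffOn he) (fun z hz => hz) y ⟨_, hyK.1, e.right_inv hy⟩ M hM hb i hi⟩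

/-! ### Gluing of currents -/

variable [SigmaCompactSpace X]

theorem exists_finite_partition {ι : Type u} (U : ι → Opens X) {K : Set X} (hK : IsCompact K)
    (hKU : K ⊆ ⋃ i, (U i : Set X)) :
    ∃ (s : Finset ι) (χ : ι → SmoothFun n X), (∀ i, tsupport (χ i) ⊆ U i) ∧
      ∀ x ∈ K, ∑ i ∈ s, χ i x = 1 := by
  classical
  obtain ⟨f, hf⟩ := SmoothPartitionOfUnity.exists_isSubordinate 𝓘(ℝ, Rn n) hK.isClosed
    (fun i => (U i : Set X)) (fun i => (U i).isOpen) hKU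
  have hfin := f.locallyFinite.finite_nonempty_inter_compact hK
  refine ⟨hfin.toFinset, f, hf, fun x hx => ?_⟩
  refine f.sum_finsupport' x hx fun i hi => ?_
  rw [f.mem_finsupport] at hi
  exact hfin.mem_toFinset.2 ⟨x, hi, hx⟩

omit [IsManifold 𝓘(ℝ, Rn n) ∞ X] [T2Space X] [SigmaCompactSpace X] in
theorem TestForm.sum_coe {ι : Type*} {U : Opens X} (s : Finset ι) (f : ι → TestForm n 𝕜 m U)
    (x : X) : (∑ i ∈ s, f i).1 x = ∑ i ∈ s, (f i).1 x := by
  classical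
  induction s using Finset.induction_on with
  | empty => rfl
  | insert i s hi ih =>
    rw [Finset.sum_insert hi, Finset.sum_insert hi, ← ih]
    rfl

omit [IsManifold 𝓘(ℝ, Rn n) ∞ X] [T2Space X] [SigmaCompactSpace X] in
theorem TestForm.eq_sum_mulExt {ι : Type u} {V : Opens X}
    (s : Finset ι) (χ : ι → SmoothFun n X) (W : ι → Opens X) (hW : ∀ i, W i ≤ V)
    (h : ∀ i, tsupport (χ i) ∩ V ⊆ W i) (φ : TestForm n 𝕜 m V)
    (hs : ∀ x, φ.1 x ≠ 0 → ∑ i ∈ s, χ i x = 1) :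
    φ = ∑ i ∈ s, TestForm.extend (hW i) (TestForm.mulExt (χ i) (h i) φ) := by
  refine TestForm.ext fun x => ?_
  rw [TestForm.sum_coe]
  change φ.1 x = ∑ i ∈ s, (χ i x • φ.1 x : (TangentSpace 𝓘(ℝ, Rn n) x) [⋀^Fin m]→L[ℝ] 𝕜)
  rw [← Finset.sum_smul]
  by_cases hx : φ.1 x = 0
  · rw [hx]
    exact (smul_zero (A := (TangentSpace 𝓘(ℝ, Rn n) x) [⋀^Fin m]→L[ℝ] 𝕜) _).symm
  · rw [hs x hx]
    exact (one_smul ℝ (φ.1 x : (TangentSpace 𝓘(ℝ, Rn n) x) [⋀^Fin m]→L[ℝ] 𝕜)).symm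

theorem Current.ext_of_cover {ι : Type u} {V : Opens X} (U : ι → Opens X) (hU : ∀ i, U i ≤ V)
    (hV : (V : Set X) ⊆ ⋃ i, (U i : Set X)) {S T : Current n 𝕜 m V}
    (h : ∀ i, Current.res (hU i) S = Current.res (hU i) T) : S = T := by
  refine Current.ext fun φ => ?_
  obtain ⟨K, hK, hKV, hφ⟩ := φ.2.2
  obtain ⟨s, χ, hχ, hs⟩ := exists_finite_partition (n := n) U hK (hKV.trans hV)
  rw [φ.eq_sum_mulExt s χ U hU (fun i x hx => hχ i hx.1)
    (fun x hx => hs x (by_contra fun h => hx (hφ x h))), map_sum, map_sum]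
  exact Finset.sum_congr rfl fun i _ => congrArg (fun R : Current n 𝕜 m (U i) => R.1 _) (h i)

/-- Currents glue: the value of the glued current on a test form is the sum of the values on the
pieces cut out by a partition of unity, and this does not depend on the partition. -/
theorem Current.exists_glue {ι : Type u} (U : ι → Opens X) (T : ∀ i, Current n 𝕜 m (U i))
    (hT : ∀ i j, Current.res (inf_le_left : U i ⊓ U j ≤ U i) (T i) =
      Current.res (inf_le_right : U i ⊓ U j ≤ U j) (T j)) :
    ∃ S : Current n 𝕜 m (iSup U), ∀ i, Current.res (le_iSup U i) S = T i := by
  classical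
  have hsup : ((iSup U : Opens X) : Set X) ⊆ ⋃ i, (U i : Set X) := (Opens.coe_iSup U).le
  have hχi : ∀ {χ : ι → SmoothFun n X}, (∀ i, tsupport (χ i) ⊆ U i) → ∀ i (V : Opens X),
    tsupport (χ i) ∩ V ⊆ U i := fun hχ i V x hx => hχ i hx.1
  -- the value on a form supported in one of the sets, in terms of a partition of unity
  have key : ∀ (s : Finset ι) (χ : ι → SmoothFun n X) (hχ : ∀ i, tsupport (χ i) ⊆ U i) (i : ι)
      (f : TestForm n 𝕜 m (U i)), (∀ x, f.1 x ≠ 0 → ∑ i ∈ s, χ i x = 1) →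
      (T i).1 f = ∑ b ∈ s, (T b).1 (TestForm.mulExt (χ b) (hχi hχ b _)
        (TestForm.extend (le_iSup U i) f)) := by
    intro s χ hχ i f hf
    have h1 := f.eq_sum_mulExt s χ (fun b => U i ⊓ U b) (fun b => inf_le_left)
      (fun b x hx => ⟨hx.2, hχ b hx.1⟩) hf
    conv_lhs => rw [h1]
    rw [map_sum]
    exact Finset.sum_congr rfl fun b _ =>
      congrArg (fun R : Current n 𝕜 m (U i ⊓ U b) => R.1 _) (hT i b)
  let Φ : (Π₀ i, TestForm n 𝕜 m (U i)) →ₗ[𝕜] TestForm n 𝕜 m (iSup U) :=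
    DFinsupp.lsum ℕ fun i => TestForm.extend (le_iSup U i)
  let Ψ : (Π₀ i, TestForm n 𝕜 m (U i)) →ₗ[𝕜] 𝕜 := DFinsupp.lsum ℕ fun i => (T i).1
  have hΦ1 : ∀ i f, Φ (DFinsupp.single i f) = TestForm.extend (le_iSup U i) f := fun i f =>
    DFinsupp.lsum_single ..
  have hΨ1 : ∀ i f, Ψ (DFinsupp.single i f) = (T i).1 f := fun i f => DFinsupp.lsum_single ..
  have hker : LinearMap.ker Φ ≤ LinearMap.ker Ψ := by
    intro f hf
    rw [LinearMap.mem_ker] at hf ⊢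
    choose K hK hKU hfK using fun i => (f i).2.2
    obtain ⟨s, χ, hχ, hs⟩ := exists_finite_partition (n := n) U
      (f.support.finite_toSet.isCompact_biUnion fun i _ => hK i)
      (Set.iUnion₂_subset fun i _ => (hKU i).trans (Set.subset_iUnion (fun i => (U i : Set X)) i))
    have h1 : ∀ g : Π₀ i, TestForm n 𝕜 m (U i), (∀ i x, (g i).1 x ≠ 0 → ∑ i ∈ s, χ i x = 1) →
        Ψ g = ∑ b ∈ s, (T b).1 (TestForm.mulExt (χ b) (hχi hχ b _) (Φ g)) := by
      intro g hg
      have h2 : Ψ g = ∑ i ∈ g.support, (T i).1 (g i) := by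
        conv_lhs => rw [← DFinsupp.sum_single (f := g), DFinsupp.sum, map_sum]
        exact Finset.sum_congr rfl fun i _ => hΨ1 i _
      have h3 : Φ g = ∑ i ∈ g.support, TestForm.extend (le_iSup U i) (g i) := by
        conv_lhs => rw [← DFinsupp.sum_single (f := g), DFinsupp.sum, map_sum]
        exact Finset.sum_congr rfl fun i _ => hΦ1 i _
      rw [h2, h3, Finset.sum_congr rfl fun i _ => key s χ hχ i (g i) (hg i), Finset.sum_comm]
      exact Finset.sum_congr rfl fun b _ => by rw [map_sum, map_sum]
    rw [h1 f, hf]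
    · simp
    · intro i x hx
      have hi : i ∈ f.support := by
        rw [DFinsupp.mem_support_iff]
        intro h
        rw [h] at hx
        exact hx rfl
      exact hs x (Set.mem_biUnion hi (by_contra fun h => hx (hfK i x h)))
  have hsurj : Function.Surjective Φ := by
    intro φ
    obtain ⟨K, hK, hKV, hφ⟩ := φ.2.2
    obtain ⟨s, χ, hχ, hs⟩ := exists_finite_partition (n := n) U hK (hKV.trans hsup)
    refine ⟨∑ i ∈ s, DFinsupp.single i (TestForm.mulExt (χ i) (hχi hχ i _) φ), ?_⟩
    rw [map_sum, φ.eq_sum_mulExt s χ U (le_iSup U) (fun i => hχi hχ i _)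
      (fun x hx => hs x (by_contra fun h => hx (hφ x h)))]
    refine Finset.sum_congr rfl fun i _ => ?_
    rw [hΦ1, ← φ.eq_sum_mulExt s χ U (le_iSup U) (fun i => hχi hχ i _)
      (fun x hx => hs x (by_contra fun h => hx (hφ x h)))]
  let R : TestForm n 𝕜 m (iSup U) →ₗ[𝕜] 𝕜 :=
    ((LinearMap.ker Φ).liftQ Ψ hker).comp (Φ.quotKerEquivOfSurjective hsurj).symm.toLinearMap
  have hR : ∀ i f, R (TestForm.extend (le_iSup U i) f) = (T i).1 f := by
    intro i f
    rw [← hΦ1, ← hΨ1]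
    have : (Φ.quotKerEquivOfSurjective hsurj).symm (Φ (DFinsupp.single i f)) =
        (LinearMap.ker Φ).mkQ (DFinsupp.single i f) :=
      (LinearEquiv.symm_apply_eq _).2 rfl
    change ((LinearMap.ker Φ).liftQ Ψ hker)
      ((Φ.quotKerEquivOfSurjective hsurj).symm (Φ (DFinsupp.single i f))) = _
    rw [this]
    exact Submodule.liftQ_apply _ _ _
  refine ⟨⟨R, fun e he K hK hKe hKU => ?_⟩, fun i => Current.ext fun f => hR i f⟩
  obtain ⟨s, χ, hχ, hs⟩ := exists_finite_partition (n := n) U hK (hKU.trans hsup)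
  have hQ : IsContinuousFunctional (∑ b ∈ s, (Current.mulExt (χ b) (hχi hχ b (iSup U)) (T b)).1) :=
    Submodule.sum_mem (currents n 𝕜 m (iSup U)) fun b _ =>
      (Current.mulExt (χ b) (hχi hχ b (iSup U)) (T b)).2
  obtain ⟨C, N, hC⟩ := hQ e he K hK hKe hKU
  refine ⟨C, N, fun φ hφ M hM hb => ?_⟩
  convert! hC φ hφ M hM hb using 2
  rw [φ.eq_sum_mulExt s χ U (le_iSup U) (fun i => hχi hχ i _)
      (fun x hx => hs x (by_contra fun h => hx (hφ x h))), map_sum,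
    ← φ.eq_sum_mulExt s χ U (le_iSup U) (fun i => hχi hχ i _)
      (fun x hx => hs x (by_contra fun h => hx (hφ x h))), LinearMap.sum_apply]
  exact Finset.sum_congr rfl fun b _ => hR b _

/-- The preimage of a sheaf of currents under `d` is a sheaf. -/
theorem CurrentSubsheaf.isSheaf_dPreimagePresheaf (B : CurrentSubsheaf n 𝕜 X m) :
    B.dPreimagePresheaf.IsSheaf := by
  rw [TopCat.Presheaf.isSheaf_iff_isSheaf_comp (forget AddCommGrpCat)]
  refine TopCat.Presheaf.isSheaf_of_isSheafUniqueGluing_types _ fun ι U sf hsf => ?_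
  have hcompat : ∀ i j, Current.res (inf_le_left : U i ⊓ U j ≤ U i) (sf i).1 =
      Current.res (inf_le_right : U i ⊓ U j ≤ U j) (sf j).1 := fun i j =>
    congrArg Subtype.val (hsf i j)
  obtain ⟨S, hS⟩ := Current.exists_glue U (fun i => (sf i).1) hcompat
  have hmem : S ∈ B.dPreimage (iSup U) := by
    refine CurrentSubsheaf.mem_dPreimage_of_locally fun x hx => ?_
    obtain ⟨i, hi⟩ := Opens.mem_iSup.1 hx
    refine ⟨U i, le_iSup U i, hi, ?_⟩
    rw [hS]
    exact (sf i).2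
  refine ⟨⟨S, hmem⟩, fun i => Subtype.ext (hS i), fun S' hS' => Subtype.ext ?_⟩
  refine Current.ext_of_cover U (le_iSup U) (Opens.coe_iSup U).le fun i => ?_
  rw [hS]
  exact congrArg Subtype.val (hS' i)

end CurrentOps

/-! ### Averages of pullbacks of forms -/

section PullbackIntegral

variable {n m : ℕ} {𝕜 : Type} [RCLike 𝕜]

/-- The average `∫ F_t^* g ρ(t) dt` of the pullbacks of a form along a family of maps. -/
def pullbackIntegral (F : Rn n → Rn n → Rn n) (ρ : Rn n → ℝ)
    (g : Rn n → (Rn n) [⋀^Fin m]→L[ℝ] 𝕜) (y : Rn n) : (Rn n) [⋀^Fin m]→L[ℝ] 𝕜 :=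
  ∫ t in tsupport ρ, ρ t • (g (F t y)).compContinuousLinearMap (fderiv ℝ (F t) y)

variable {F : Rn n → Rn n → Rn n} (hF : ContDiff ℝ ∞ (Function.uncurry F)) {ρ : Rn n → ℝ}
  (hρ : ContDiff ℝ ∞ ρ) (hρc : HasCompactSupport ρ)

theorem contDiff_fderiv_family {F : Rn n → Rn n → Rn n} (hF : ContDiff ℝ ∞ (Function.uncurry F)) :
    ContDiff ℝ ∞ fun p : Rn n × Rn n => fderiv ℝ (F p.1) p.2 :=
  ContDiff.fderiv (m := ∞) (n := ∞) (f := fun (p : Rn n × Rn n) y => F p.1 y)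
    (hF.comp (f := fun q : (Rn n × Rn n) × Rn n => (q.1.1, q.2)) (by fun_prop)) contDiff_snd
    (by simp)

theorem contDiff_real_smul {E V : Type*} [NormedAddCommGroup E] [NormedSpace ℝ E]
    [NormedAddCommGroup V] [NormedSpace ℝ V] {f : E → ℝ} {g : E → V} (hf : ContDiff ℝ ∞ f)
    (hg : ContDiff ℝ ∞ g) : ContDiff ℝ ∞ fun x => f x • g x := hf.smul hg

theorem contDiffAt_real_smul {E V : Type*} [NormedAddCommGroup E] [NormedSpace ℝ E]
    [NormedAddCommGroup V] [NormedSpace ℝ V] {f : E → ℝ} {g : E → V} {x : E}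
    (hf : ContDiffAt ℝ ∞ f x) (hg : ContDiffAt ℝ ∞ g x) :
    ContDiffAt ℝ ∞ (fun x => f x • g x) x := hf.smul hg

theorem contDiff_pullback_weight {F : Rn n → Rn n → Rn n}
    (hF : ContDiff ℝ ∞ (Function.uncurry F)) (hρ : ContDiff ℝ ∞ ρ) :
    ContDiff ℝ ∞ fun p : Rn n × Rn n => ρ p.1 •
      (ContinuousAlternatingMap.compContinuousLinearMapCLM (fderiv ℝ (F p.1) p.2) :
        ((Rn n) [⋀^Fin m]→L[ℝ] 𝕜) →L[ℝ] (Rn n) [⋀^Fin m]→L[ℝ] 𝕜) :=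
  contDiff_real_smul (V := ((Rn n) [⋀^Fin m]→L[ℝ] 𝕜) →L[ℝ] (Rn n) [⋀^Fin m]→L[ℝ] 𝕜)
    (hρ.comp contDiff_fst) (contDiff_pullback.comp (contDiff_fderiv_family hF))

theorem contDiff_pullback_family {F : Rn n → Rn n → Rn n}
    (hF : ContDiff ℝ ∞ (Function.uncurry F)) (hρ : ContDiff ℝ ∞ ρ)
    {g : Rn n → (Rn n) [⋀^Fin m]→L[ℝ] 𝕜} (hg : ContDiff ℝ ∞ g) :
    ContDiff ℝ ∞ (Function.uncurry fun t y =>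
      ρ t • (g (F t y)).compContinuousLinearMap (fderiv ℝ (F t) y)) :=
  (contDiff_pullback_weight hF hρ).clm_apply (hg.comp hF)

include hF hρ

theorem contDiff_pullbackIntegral (hρc : HasCompactSupport ρ)
    {g : Rn n → (Rn n) [⋀^Fin m]→L[ℝ] 𝕜} (hg : ContDiff ℝ ∞ g) :
    ContDiff ℝ ∞ (pullbackIntegral F ρ g) :=
  contDiff_setIntegral (contDiff_pullback_family hF hρ hg) hρc

theorem integrableOn_pullback (hρc : HasCompactSupport ρ) {g : Rn n → (Rn n) [⋀^Fin m]→L[ℝ] 𝕜}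
    (hg : ContDiff ℝ ∞ g) (y : Rn n) : IntegrableOn (fun t =>
      ρ t • (g (F t y)).compContinuousLinearMap (fderiv ℝ (F t) y)) (tsupport ρ) :=
  (((contDiff_pullback_family hF hρ hg).continuous.comp
    (f := fun t => (t, y)) (by fun_prop)).continuousOn).integrableOn_compact hρc

theorem pullbackIntegral_add (hρc : HasCompactSupport ρ) {g g' : Rn n → (Rn n) [⋀^Fin m]→L[ℝ] 𝕜}
    (hg : ContDiff ℝ ∞ g) (hg' : ContDiff ℝ ∞ g') (y : Rn n) :
    pullbackIntegral F ρ (g + g') y = pullbackIntegral F ρ g y + pullbackIntegral F ρ g' y := by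
  unfold pullbackIntegral
  rw [← integral_add (integrableOn_pullback hF hρ hρc hg y) (integrableOn_pullback hF hρ hρc hg' y)]
  exact integral_congr_ae (Filter.Eventually.of_forall fun t => by
    exact smul_add (ρ t) ((g (F t y)).compContinuousLinearMap (fderiv ℝ (F t) y))
      ((g' (F t y)).compContinuousLinearMap (fderiv ℝ (F t) y)))

omit hF hρ in
theorem pullbackIntegral_smul (r : 𝕜) (g : Rn n → (Rn n) [⋀^Fin m]→L[ℝ] 𝕜) (y : Rn n) :
    pullbackIntegral F ρ (r • g) y = r • pullbackIntegral F ρ g y := by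
  unfold pullbackIntegral
  rw [← integral_smul]
  exact integral_congr_ae (Filter.Eventually.of_forall fun t => by
    simp only [Pi.smul_apply]
    rw [smul_comm]
    rfl)

omit hF hρ in
theorem extDeriv_setIntegral {Ψ : Rn n → Rn n → (Rn n) [⋀^Fin m]→L[ℝ] 𝕜}
    (hΨ : ContDiff ℝ ∞ (Function.uncurry Ψ)) {S : Set (Rn n)} (hS : IsCompact S) (y : Rn n) :
    extDeriv (fun y => ∫ t in S, Ψ t y) y = ∫ t in S, extDeriv (Ψ t) y := by
  have h1 : ContDiff ℝ 1 (Function.uncurry Ψ) := hΨ.of_le (by simp)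
  have h := hasFDerivAt_setIntegral_of_contDiff (μ := volume) h1 hS y
  have hc : Continuous fun t => fderiv ℝ (Ψ t) y :=
    (fderiv_slice_continuous h1).comp (f := fun t => (t, y)) (by fun_prop)
  rw [extDeriv, h.fderiv]
  exact (ContinuousLinearMap.integral_comp_comm (𝕜 := ℝ) (E := Rn n →L[ℝ] ((Rn n) [⋀^Fin m]→L[ℝ] 𝕜))
    (Fₗ := (Rn n) [⋀^Fin (m + 1)]→L[ℝ] 𝕜)
    (ContinuousAlternatingMap.alternatizeUncurryFinCLM ℝ (Rn n) 𝕜 (n := m))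
    (hc.continuousOn.integrableOn_compact (μ := volume) hS)).symm

/-- Averages of pullbacks commute with the exterior derivative. -/
theorem extDeriv_pullbackIntegral (hρc : HasCompactSupport ρ)
    {g : Rn n → (Rn n) [⋀^Fin m]→L[ℝ] 𝕜} (hg : ContDiff ℝ ∞ g) (y : Rn n) :
    extDeriv (pullbackIntegral F ρ g) y = pullbackIntegral F ρ (extDeriv g) y := by
  have hFt : ∀ t, ContDiff ℝ ∞ (F t) := fun t => hF.comp (f := fun y => (t, y)) (by fun_prop)
  refine (extDeriv_setIntegral (contDiff_pullback_family hF hρ hg) hρc y).trans ?_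
  refine integral_congr_ae (Filter.Eventually.of_forall fun t => ?_)
  refine (extDeriv_smul (ρ t) (fun y =>
    (g (F t y)).compContinuousLinearMap (fderiv ℝ (F t) y))).trans ?_
  refine congrArg (ρ t • ·) ?_
  exact extDeriv_pullback (hg.differentiable (by simp) _) (hFt t).contDiffAt
    (by simp only [minSmoothness_of_isRCLikeNormedField]; exact WithTop.coe_le_coe.2 le_top)

theorem exists_bound_pullbackIntegral (hρc : HasCompactSupport ρ) {K : Set (Rn n)}
    (hK : IsCompact K) (N : ℕ) : ∃ C : ℝ, 0 ≤ C ∧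
      ∀ g : Rn n → (Rn n) [⋀^Fin m]→L[ℝ] 𝕜, ContDiff ℝ ∞ g → ∀ M : ℝ, 0 ≤ M →
      (∀ i ≤ N, ∀ z, ‖iteratedFDeriv ℝ i g z‖ ≤ M) →
      ∀ i ≤ N, ∀ y ∈ K, ‖iteratedFDeriv ℝ i (pullbackIntegral F ρ g) y‖ ≤ C * M := by
  obtain ⟨C, hC0, hC⟩ := exists_bound_iteratedFDeriv_clm_comp isOpen_univ
    (hρc.isCompact.prod hK) (Set.subset_univ _)
    (contDiff_pullback_weight (𝕜 := 𝕜) (m := m) hF hρ).contDiffOn hF.contDiffOn N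
  refine ⟨C * volume.real (tsupport ρ), by positivity, fun g hg M hM hb i hi y hy => ?_⟩
  have hG := contDiff_pullback_family hF hρ hg
  refine (norm_iteratedFDeriv_setIntegral_le hG hρc i y (M := C * M) fun t ht => ?_).trans_eq
    (by ring)
  refine (norm_iteratedFDeriv_slice_le hG i t y).trans ?_
  exact hC g Set.univ isOpen_univ hg.contDiffOn (Set.mapsTo_univ _ _) (t, y) ⟨ht, hy⟩ M hM
    (fun i hi => hb i hi _) i hi

omit hF hρ in
theorem pullbackIntegral_eq_zero {g : Rn n → (Rn n) [⋀^Fin m]→L[ℝ] 𝕜} {y : Rn n}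
    (h : ∀ t ∈ tsupport ρ, g (F t y) = 0) : pullbackIntegral F ρ g y = 0 := by
  refine setIntegral_eq_zero_of_forall_eq_zero fun t ht => ?_
  rw [h t ht]
  exact smul_zero (A := (Rn n) [⋀^Fin m]→L[ℝ] 𝕜) (ρ t)

omit hF hρ in
theorem pullbackIntegral_eq_self {g : Rn n → (Rn n) [⋀^Fin m]→L[ℝ] 𝕜} {O : Set (Rn n)}
    (hO : IsOpen O) (hFO : ∀ t, ∀ y ∈ O, F t y = y) (hρ1 : ∫ t, ρ t = 1) {y : Rn n} (hy : y ∈ O) :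
    pullbackIntegral F ρ g y = g y := by
  have h1 : ∀ t, fderiv ℝ (F t) y = ContinuousLinearMap.id ℝ (Rn n) := fun t => by
    have : F t =ᶠ[nhds y] id := by
      filter_upwards [hO.mem_nhds hy] with z hz using hFO t z hz
    rw [this.fderiv_eq, fderiv_id]
  have h2 : ∀ t, ρ t • (g (F t y)).compContinuousLinearMap (fderiv ℝ (F t) y) = ρ t • g y := by
    intro t
    rw [h1, hFO t y hy]
    rfl
  unfold pullbackIntegral
  simp_rw [h2]
  rw [integral_smul_const, setIntegral_eq_integral_of_forall_compl_eq_zero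
    fun t ht => image_eq_zero_of_notMem_tsupport ht, hρ1, one_smul]

end PullbackIntegral

/-! ### Smears of currents -/

section Smear

variable {n m : ℕ} {𝕜 : Type} [RCLike 𝕜]

/-- The flow moving the points whose coordinates lie in the intervals `(cᵢ, dᵢ)`, with the
parameter negated. -/
def backFlow (c d : Fin n → ℝ) : Rn n → Rn n → Rn n :=
  boxFlow fun i x s => ioFlow (c i) (d i) x (-s)

theorem backFlow_apply (c d : Fin n → ℝ) (t y : Rn n) (i : Fin n) :
    backFlow c d t y i = ioFlow (c i) (d i) (y i) (-t i) := rfl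

theorem contDiff_backFlow (c d : Fin n → ℝ) : ContDiff ℝ ∞ (Function.uncurry (backFlow c d)) := by
  rw [contDiff_euclidean]
  intro i
  exact (contDiff_ioFlow (c i) (d i)).comp
    (f := fun p : Rn n × Rn n => (p.2 i, -p.1 i)) (by fun_prop)

section
variable {c d : Fin n → ℝ} (hcd : ∀ i, c i < d i)
include hcd

theorem backFlow_neg (t y : Rn n) : backFlow c d (-t) (backFlow c d t y) = y := by
  ext i
  have := ioFlow_neg_ioFlow (hcd i) (y i) (-t i)
  simpa [backFlow_apply] using this

theorem backFlow_mem_iff {a b : Fin n → ℝ} (hab : ∀ i, a i ≤ c i ∧ d i ≤ b i) (t y : Rn n) :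
    backFlow c d t y ∈ openBox a b ↔ y ∈ openBox a b := by
  refine forall_congr' fun i => ?_
  rw [backFlow_apply]
  by_cases h : y i ∈ Set.Ioo (c i) (d i)
  · have h' := (ioFlow_mem_iff (hcd i) (-t i)).2 h
    exact ⟨fun _ => ⟨(hab i).1.trans_lt h.1, h.2.trans_le (hab i).2⟩,
      fun _ => ⟨(hab i).1.trans_lt h'.1, h'.2.trans_le (hab i).2⟩⟩
  · rw [ioFlow_of_notMem (hcd i) h]

theorem backFlow_eq_self {y : Rn n} (hy : ∀ i, y i ∉ Set.Ioo (c i) (d i)) (t : Rn n) :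
    backFlow c d t y = y := by
  ext i
  exact ioFlow_of_notMem (hcd i) (hy i) _

end

variable {X : Type u} [TopologicalSpace X] [ChartedSpace (Rn n) X]

section

variable {e : OpenPartialHomeomorph X (Rn n)} {U : Opens X}

theorem TestForm.local_add (φ ψ : TestForm n 𝕜 m U) :
    (φ + ψ).1.local e = φ.1.local e + ψ.1.local e :=
  Set.indicator_add' e.target (φ.1.inChart e) (ψ.1.inChart e)

theorem TestForm.local_smul (r : 𝕜) (φ : TestForm n 𝕜 m U) :
    (r • φ).1.local e = r • φ.1.local e :=
  Set.indicator_const_smul e.target r (φ.1.inChart e)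

theorem DForm.ofChart_add (g g' : Rn n → (Rn n) [⋀^Fin m]→L[ℝ] 𝕜) :
    (DForm.ofChart e (g + g') : DForm n 𝕜 X m) = DForm.ofChart e g + DForm.ofChart e g' := by
  funext x
  by_cases h : x ∈ e.source
  · simp only [DForm.ofChart, Pi.add_apply, if_pos h]
    rfl
  · simp only [DForm.ofChart, Pi.add_apply, if_neg h]
    exact (add_zero (0 : (Rn n) [⋀^Fin m]→L[ℝ] 𝕜)).symm

theorem DForm.ofChart_smul (r : 𝕜) (g : Rn n → (Rn n) [⋀^Fin m]→L[ℝ] 𝕜) :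
    (DForm.ofChart e (r • g) : DForm n 𝕜 X m) = r • DForm.ofChart e g := by
  funext x
  by_cases h : x ∈ e.source
  · simp only [DForm.ofChart, Pi.smul_apply, if_pos h]
    rfl
  · simp only [DForm.ofChart, Pi.smul_apply, if_neg h]
    exact (smul_zero (A := (Rn n) [⋀^Fin m]→L[ℝ] 𝕜) r).symm

variable [IsManifold 𝓘(ℝ, Rn n) ∞ X] [T2Space X]

theorem TestForm.local_d (he : e ∈ SmoothCharts n X) (hU : (U : Set X) ⊆ e.source)
    (φ : TestForm n 𝕜 m U) : (TestForm.d φ).1.local e = extDeriv (φ.1.local e) := by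
  funext y
  by_cases hy : y ∈ e.target
  · rw [DForm.local_eq _ hy, (φ.local_eventuallyEq e hy).extDeriv_eq]
    exact DForm.inChart_extD φ.2.1 he hy
  · obtain ⟨K, hK, hKU, hφ⟩ := φ.2.2
    have hKe := hKU.trans hU
    have h1 : y ∉ e '' K := fun h => hy (chart_image_subset hKe h)
    have h2 : φ.1.local e =ᶠ[nhds y] fun _ => 0 := by
      filter_upwards [(isCompact_chart_image hK hKe).isClosed.isOpen_compl.mem_nhds h1] with z hz
      exact DForm.local_eq_zero hφ hz
    rw [h2.extDeriv_eq, extDeriv, DForm.local, Set.indicator_of_notMem hy,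
      fderiv_fun_const]
    exact (map_zero (ContinuousAlternatingMap.alternatizeUncurryFinCLM ℝ (Rn n) 𝕜)).symm

end

/-- The data of a smear on the box `U`, which is the box `∏ (aᵢ, bᵢ)` in the chart `e`: the box
`∏ (cᵢ, dᵢ)` of the flow and the weight `ρ`. The vector fields are those of the flows `ioFlow`. -/
structure SmearData (e : OpenPartialHomeomorph X (Rn n)) (U : Opens X) where
  (a b c d : Fin n → ℝ)
  (ρ : Rn n → ℝ)
  isNBox : IsNBox e a b U
  le : ∀ i, a i ≤ c i ∧ c i < d i ∧ d i ≤ b i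
  contDiff : ContDiff ℝ ∞ ρ
  hasCompactSupport : HasCompactSupport ρ

namespace SmearData

variable {e : OpenPartialHomeomorph X (Rn n)} {U : Opens X} (s : SmearData e U)
include s

/-- The flow of the smear. -/
def flow : Rn n → Rn n → Rn n := backFlow s.c s.d

theorem contDiff_flow : ContDiff ℝ ∞ (Function.uncurry s.flow) := contDiff_backFlow s.c s.d

theorem lt (i : Fin n) : s.c i < s.d i := (s.le i).2.1

theorem flow_mem_iff (t y : Rn n) : s.flow t y ∈ openBox s.a s.b ↔ y ∈ openBox s.a s.b :=
  backFlow_mem_iff s.lt (fun i => ⟨(s.le i).1, (s.le i).2.2⟩) t y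

theorem box_subset : openBox s.a s.b ⊆ e.target :=
  fun _ hy => s.isNBox.closedBox_subset fun i => ⟨(hy i).1.le, (hy i).2.le⟩

theorem subset_source : (U : Set X) ⊆ e.source := by
  rw [s.isNBox.eq_image]
  rintro _ ⟨y, hy, rfl⟩
  exact e.map_target (s.box_subset hy)

theorem mem_iff {y : Rn n} (hy : y ∈ e.target) : e.symm y ∈ U ↔ y ∈ openBox s.a s.b := by
  rw [← SetLike.mem_coe, s.isNBox.eq_image]
  refine ⟨?_, fun h => ⟨y, h, rfl⟩⟩
  rintro ⟨z, hz, h⟩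
  rwa [← e.right_inv hy, ← h, e.right_inv (s.box_subset hz)]

theorem image_subset {K : Set X} (hK : K ⊆ U) : e '' K ⊆ openBox s.a s.b := by
  rintro _ ⟨x, hx, rfl⟩
  have hx' := s.subset_source (hK hx)
  rw [← s.mem_iff (e.map_source hx'), e.left_inv hx']
  exact hK hx

/-- The points which the flow moves into `S` for some parameter in the support of the weight. It
contains the support of the smear of a form supported in `S`. -/
def spread (S : Set (Rn n)) : Set (Rn n) :=
  (fun p : Rn n × Rn n => s.flow (-p.1) p.2) '' (tsupport s.ρ ×ˢ S)

theorem isCompact_spread {S : Set (Rn n)} (hS : IsCompact S) : IsCompact (s.spread S) := by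
  refine (s.hasCompactSupport.isCompact.prod hS).image ?_
  exact s.contDiff_flow.continuous.comp (f := fun p : Rn n × Rn n => (-p.1, p.2)) (by fun_prop)

theorem mem_spread {S : Set (Rn n)} {t y : Rn n} (ht : t ∈ tsupport s.ρ) (h : s.flow t y ∈ S) :
    y ∈ s.spread S := ⟨(t, s.flow t y), ⟨ht, h⟩, backFlow_neg s.lt t y⟩

theorem spread_subset {S : Set (Rn n)} (hS : S ⊆ openBox s.a s.b) :
    s.spread S ⊆ openBox s.a s.b := by
  rintro _ ⟨p, ⟨_, hp⟩, rfl⟩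
  exact (s.flow_mem_iff _ _).2 (hS hp)

/-- The smear of a form with compact support in the box. -/
def smearForm (g : Rn n → (Rn n) [⋀^Fin m]→L[ℝ] 𝕜) : Rn n → (Rn n) [⋀^Fin m]→L[ℝ] 𝕜 :=
  pullbackIntegral s.flow s.ρ g

theorem smearForm_eq_zero {g : Rn n → (Rn n) [⋀^Fin m]→L[ℝ] 𝕜} {S : Set (Rn n)}
    (hg : ∀ y ∉ S, g y = 0) {y : Rn n} (hy : y ∉ s.spread S) : s.smearForm g y = 0 :=
  pullbackIntegral_eq_zero fun _ ht => hg _ fun h => hy (s.mem_spread ht h)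

theorem contDiff_smearForm {g : Rn n → (Rn n) [⋀^Fin m]→L[ℝ] 𝕜} (hg : ContDiff ℝ ∞ g) :
    ContDiff ℝ ∞ (s.smearForm g) :=
  contDiff_pullbackIntegral s.contDiff_flow s.contDiff s.hasCompactSupport hg

variable [IsManifold 𝓘(ℝ, Rn n) ∞ X] [T2Space X]

omit [IsManifold 𝓘(ℝ, Rn n) ∞ X] [T2Space X] in
theorem contDiff_local (φ : TestForm n 𝕜 m U) : ContDiff ℝ ∞ (φ.1.local e) := by
  obtain ⟨K, hK, hKU, hφ⟩ := φ.2.2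
  exact φ.contDiff_local s.isNBox.chart hK (hKU.trans s.subset_source) hφ

/-- The smear of a test form is again a test form. -/
theorem smearTest_aux (φ : TestForm n 𝕜 m U) {K : Set X} (hK : IsCompact K) (hKU : K ⊆ U)
    (hφ : ∀ x ∉ K, φ.1 x = 0) :
    (DForm.ofChart e (s.smearForm (φ.1.local e))).IsSmoothOn ⊤ ∧
      ∀ x ∉ e.symm '' s.spread (e '' K), DForm.ofChart e (s.smearForm (φ.1.local e)) x = 0 :=
  DForm.ofChart_isSmoothOn s.isNBox.chart
    (s.isCompact_spread (isCompact_chart_image hK (hKU.trans s.subset_source)))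
    ((s.spread_subset (s.image_subset hKU)).trans s.box_subset)
    (s.contDiff_smearForm (s.contDiff_local φ)).contDiffOn
    fun _ hy => s.smearForm_eq_zero (fun _ hz => DForm.local_eq_zero hφ hz) hy

omit [IsManifold 𝓘(ℝ, Rn n) ∞ X] [T2Space X] in
theorem isCompact_spread_image {K : Set X} (hK : IsCompact K) (hKU : K ⊆ U) :
    IsCompact (e.symm '' s.spread (e '' K)) :=
  (s.isCompact_spread (isCompact_chart_image hK
    (hKU.trans s.subset_source))).image_of_continuousOn
      (e.continuousOn_symm.mono ((s.spread_subset (s.image_subset hKU)).trans s.box_subset))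

omit [IsManifold 𝓘(ℝ, Rn n) ∞ X] [T2Space X] in
theorem spread_image_subset {K : Set X} (hKU : K ⊆ U) :
    e.symm '' s.spread (e '' K) ⊆ U := by
  rw [s.isNBox.eq_image]
  exact Set.image_mono (s.spread_subset (s.image_subset hKU))

/-- The smear of test forms on the box. -/
def smearTest : TestForm n 𝕜 m U →ₗ[𝕜] TestForm n 𝕜 m U where
  toFun φ := Subtype.mk (DForm.ofChart e (s.smearForm (φ.1.local e))) <| by
    obtain ⟨K, hK, hKU, hφ⟩ := φ.2.2
    have h := s.smearTest_aux φ hK hKU hφ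
    exact ⟨h.1, _, s.isCompact_spread_image hK hKU, s.spread_image_subset hKU, h.2⟩
  map_add' φ ψ := Subtype.ext <| by
    have : s.smearForm (φ.1.local e + ψ.1.local e) =
        s.smearForm (φ.1.local e) + s.smearForm (ψ.1.local e) := funext fun y =>
      pullbackIntegral_add s.contDiff_flow s.contDiff s.hasCompactSupport (s.contDiff_local φ)
        (s.contDiff_local ψ) y
    change DForm.ofChart e (s.smearForm ((φ + ψ).1.local e)) =
      DForm.ofChart e (s.smearForm (φ.1.local e)) + DForm.ofChart e (s.smearForm (ψ.1.local e))
    rw [TestForm.local_add, this, DForm.ofChart_add]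
  map_smul' r φ := Subtype.ext <| by
    have : s.smearForm (r • φ.1.local e) = r • s.smearForm (φ.1.local e) := funext fun y =>
      pullbackIntegral_smul r (φ.1.local e) y
    change DForm.ofChart e (s.smearForm ((r • φ).1.local e)) =
      r • DForm.ofChart e (s.smearForm (φ.1.local e))
    rw [TestForm.local_smul, this, DForm.ofChart_smul]

theorem inChart_smearTest (φ : TestForm n 𝕜 m U) {y : Rn n} (hy : y ∈ e.target) :
    (s.smearTest φ).1.inChart e y = s.smearForm (φ.1.local e) y :=
  DForm.inChart_ofChart s.isNBox.chart _ hy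

theorem smearTest_eq_zero (φ : TestForm n 𝕜 m U) {K : Set X} (hK : IsCompact K) (hKU : K ⊆ U)
    (hφ : ∀ x ∉ K, φ.1 x = 0) : ∀ x ∉ e.symm '' s.spread (e '' K), (s.smearTest φ).1 x = 0 :=
  (s.smearTest_aux φ hK hKU hφ).2

theorem d_smearTest (φ : TestForm n 𝕜 m U) :
    TestForm.d (s.smearTest φ) = s.smearTest (TestForm.d φ) := by
  refine Subtype.ext ?_
  have hz : ∀ {l : ℕ} (ψ : TestForm n 𝕜 l U), ∀ x ∉ e.source, ψ.1 x = 0 := fun ψ x hx => by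
    obtain ⟨K, hK, hKU, hψ⟩ := ψ.2.2
    exact hψ x fun h => hx (s.subset_source (hKU h))
  refine DForm.ext_inChart s.isNBox.chart (fun y hy => ?_) (hz _) (hz _)
  have h1 : (s.smearTest φ).1.inChart e =ᶠ[nhds y] s.smearForm (φ.1.local e) := by
    filter_upwards [e.open_target.mem_nhds hy] with z hz using s.inChart_smearTest φ hz
  refine (DForm.inChart_extD (s.smearTest φ).2.1 s.isNBox.chart hy).trans ?_
  rw [h1.extDeriv_eq, s.inChart_smearTest _ hy,
    TestForm.local_d s.isNBox.chart s.subset_source]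
  exact extDeriv_pullbackIntegral s.contDiff_flow s.contDiff s.hasCompactSupport
    (s.contDiff_local φ) y

/-- The smear of a current on the box. -/
def smear (T : Current n 𝕜 m U) : Current n 𝕜 m U :=
  Subtype.mk (T.1.comp s.smearTest) <| by
    refine isContinuousFunctional_of_chart s.isNBox.chart s.subset_source fun K hK hKU => ?_
    have hK'c := s.isCompact_spread_image hK hKU
    have hKe := hKU.trans s.subset_source
    obtain ⟨C, N, hC⟩ := T.2 e s.isNBox.chart _ hK'c
      ((s.spread_image_subset hKU).trans s.subset_source) (s.spread_image_subset hKU)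
    obtain ⟨C', hC'0, hC'⟩ := exists_bound_pullbackIntegral (𝕜 := 𝕜) (m := m) s.contDiff_flow
      s.contDiff s.hasCompactSupport (s.isCompact_spread (isCompact_chart_image hK hKe)) N
    refine ⟨C * C', N, fun φ hφ M hM hb => ?_⟩
    rw [mul_assoc]
    have hCM := mul_nonneg hC'0 hM
    refine hC _ (s.smearTest_eq_zero φ hK hKU hφ) _ hCM
      (TestForm.bound_of_bound_on hK'c (s.smearTest_eq_zero φ hK hKU hφ) hCM ?_)
    intro i hi y hy hyK
    have hy' : y ∈ s.spread (e '' K) := by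
      obtain ⟨z, hz, h⟩ := hyK
      have hzt := s.box_subset (s.spread_subset (s.image_subset hKU) hz)
      rwa [← e.right_inv hy, ← h, e.right_inv hzt]
    have h1 : (s.smearTest φ).1.inChart e =ᶠ[nhds y] s.smearForm (φ.1.local e) := by
      filter_upwards [e.open_target.mem_nhds hy] with z hz using s.inChart_smearTest φ hz
    rw [(h1.iteratedFDeriv ℝ i).eq_of_nhds]
    refine hC' _ (s.contDiff_local φ) M hM (fun i hi z => ?_) i hi y hy'
    by_cases hz : z ∈ e.target
    · rw [((φ.local_eventuallyEq e hz).iteratedFDeriv ℝ i).eq_of_nhds]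
      exact hb i hi z hz
    · have h1 : z ∉ e '' K := fun h => hz (chart_image_subset hKe h)
      have h2 : φ.1.local e =ᶠ[nhds z] fun _ => 0 := by
        filter_upwards [(isCompact_chart_image hK hKe).isClosed.isOpen_compl.mem_nhds h1] with w hw
        exact DForm.local_eq_zero hφ hw
      rw [(h2.iteratedFDeriv ℝ i).eq_of_nhds]
      simpa using hM

theorem isSmear_smear (T : Current n 𝕜 m U) :
    T.IsSmear e (fun i => ioFlow (s.c i) (s.d i)) s.ρ (s.smear T) := by
  refine fun φ => ⟨s.smearTest φ, fun y hy hyU => ?_, rfl⟩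
  rw [s.inChart_smearTest φ hy]
  have hyb := (s.mem_iff hy).1 hyU
  have h : ∀ t, s.ρ t • (φ.1.local e (s.flow t y)).compContinuousLinearMap
      (fderiv ℝ (s.flow t) y) = s.ρ t • (φ.1.inChart e (s.flow t y)).compContinuousLinearMap
      (fderiv ℝ (s.flow t) y) := fun t => by
    rw [DForm.local_eq _ (s.box_subset ((s.flow_mem_iff t y).2 hyb))]
  unfold SmearData.smearForm pullbackIntegral
  simp_rw [h]
  exact setIntegral_eq_integral_of_forall_compl_eq_zero fun t ht => by
    rw [image_eq_zero_of_notMem_tsupport ht]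
    exact zero_smul ℝ (A := (Rn n) [⋀^Fin m]→L[ℝ] 𝕜) _

/-- Since smearing commutes with `d`, the preimage of a sheaf closed under smears is closed under
these smears. -/
theorem smear_mem_dPreimage {B : CurrentSubsheaf n 𝕜 X m} (hB : B.ClosedUnderSmears)
    {T : Current n 𝕜 (m + 1) U} (hT : T ∈ B.dPreimage U) : s.smear T ∈ B.dPreimage U := by
  rw [CurrentSubsheaf.mem_dPreimage] at hT ⊢
  have h : (s.smear T).d = s.smear T.d := Current.ext fun φ =>
    congrArg T.1 (s.d_smearTest φ).symm
  rw [h]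
  exact hB U e s.a s.b s.isNBox s.c s.d _ s.ρ s.le (fun i => isIntervalFlow_ioFlow (s.lt i))
    s.contDiff s.hasCompactSupport T.d hT _ (s.isSmear_smear T.d)

end SmearData

end Smear

/-! ### Smears are smooth inside the box of the flow -/

section BoxTime

variable {n : ℕ}

theorem isOpen_openBox (c d : Fin n → ℝ) : IsOpen (openBox c d) := by
  simp only [openBox, Set.ofPred_forall]
  exact isOpen_iInter_of_finite fun i => isOpen_Ioo.preimage (by fun_prop)

theorem contDiff_clm_det : ContDiff ℝ ∞ fun A : Rn n →L[ℝ] Rn n => A.det := by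
  have h : ∀ A : Rn n →L[ℝ] Rn n, A.det = ∑ σ : Equiv.Perm (Fin n), Equiv.Perm.sign σ •
      ∏ i, (A (EuclideanSpace.basisFun (Fin n) ℝ i)) (σ i) := fun A => by
    rw [ContinuousLinearMap.det,
      ← LinearMap.det_toMatrix (EuclideanSpace.basisFun (Fin n) ℝ).toBasis, Matrix.det_apply]
    simp [LinearMap.toMatrix_apply]
  simp_rw [h]
  refine ContDiff.sum fun σ _ => ContDiff.const_smul _ (contDiff_prod fun i _ => ?_)
  exact (EuclideanSpace.proj (𝕜 := ℝ) (σ i)).contDiff.comp (contDiff_id.clm_apply contDiff_const)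

/-- The diffeomorphism from the box to `ℝⁿ` turning the flow into translations. -/
def boxTimeInv (c d : Fin n → ℝ) (y : Rn n) : Rn n :=
  WithLp.toLp 2 fun i => ioTimeInv (c i) (d i) (y i)

/-- The inverse of `boxTimeInv`. -/
def boxTime (c d : Fin n → ℝ) (z : Rn n) : Rn n :=
  WithLp.toLp 2 fun i => ioTime (c i) (d i) (z i)

theorem contDiff_boxTime (c d : Fin n → ℝ) : ContDiff ℝ ∞ (boxTime c d) := by
  rw [contDiff_euclidean]
  exact fun i => (contDiff_ioTime (c i) (d i)).comp (f := fun p : Rn n => p i) (by fun_prop)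

variable {c d : Fin n → ℝ} (hcd : ∀ i, c i < d i)
include hcd

theorem contDiffOn_boxTimeInv : ContDiffOn ℝ ∞ (boxTimeInv c d) (openBox c d) := by
  rw [contDiffOn_euclidean]
  exact fun i => (contDiffOn_ioTimeInv (hcd i)).comp
    (f := fun p : Rn n => p i) (by fun_prop) fun y hy => hy i

theorem boxTime_mem (z : Rn n) : boxTime c d z ∈ openBox c d := fun i => ioTime_mem (hcd i) _

theorem boxTimeInv_boxTime (z : Rn n) : boxTimeInv c d (boxTime c d z) = z := by
  ext i
  exact ioTimeInv_ioTime (hcd i) _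

theorem boxTime_boxTimeInv {y : Rn n} (hy : y ∈ openBox c d) :
    boxTime c d (boxTimeInv c d y) = y := by
  ext i
  exact ioTime_ioTimeInv (hcd i) (hy i)

theorem injOn_boxTimeInv : Set.InjOn (boxTimeInv c d) (openBox c d) := fun y hy z hz h => by
  rw [← boxTime_boxTimeInv hcd hy, h, boxTime_boxTimeInv hcd hz]

theorem image_boxTimeInv : boxTimeInv c d '' openBox c d = Set.univ :=
  Set.eq_univ_of_forall fun z => ⟨_, boxTime_mem hcd z, boxTimeInv_boxTime hcd z⟩

theorem det_fderiv_boxTimeInv_ne_zero {y : Rn n} (hy : y ∈ openBox c d) :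
    (fderiv ℝ (boxTimeInv c d) y).det ≠ 0 := by
  have h1 : DifferentiableAt ℝ (boxTimeInv c d) y :=
    ((contDiffOn_boxTimeInv hcd).contDiffAt ((isOpen_openBox c d).mem_nhds hy)).differentiableAt
      (by simp)
  have h2 : DifferentiableAt ℝ (boxTime c d) (boxTimeInv c d y) :=
    (contDiff_boxTime c d).differentiable (by simp) _
  have h3 : (boxTime c d ∘ boxTimeInv c d) =ᶠ[nhds y] id := by
    filter_upwards [(isOpen_openBox c d).mem_nhds hy] with z hz using boxTime_boxTimeInv hcd hz
  have h4 := fderiv_comp y h2 h1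
  rw [h3.fderiv_eq, fderiv_id] at h4
  intro h0
  have h5 := congrArg ContinuousLinearMap.det h4
  rw [ContinuousLinearMap.det, ContinuousLinearMap.det, ContinuousLinearMap.toLinearMap_comp,
    LinearMap.det_comp] at h5
  rw [ContinuousLinearMap.det] at h0
  rw [h0, mul_zero] at h5
  simp at h5

/-- On its box the flow is simply transitive: in the time coordinates it is a translation. -/
theorem backFlow_sub {y w : Rn n} (hy : y ∈ openBox c d) (hw : w ∈ openBox c d) :
    backFlow c d (boxTimeInv c d y - boxTimeInv c d w) y = w := by
  ext i
  have h := ioFlow_ioTime (hcd i) (ioTimeInv (c i) (d i) (y i))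
    (-(ioTimeInv (c i) (d i) (y i) - ioTimeInv (c i) (d i) (w i)))
  rw [ioTime_ioTimeInv (hcd i) (hy i)] at h
  rw [backFlow_apply]
  refine h.trans ?_
  rw [show ioTimeInv (c i) (d i) (y i) + -(ioTimeInv (c i) (d i) (y i) -
    ioTimeInv (c i) (d i) (w i)) = ioTimeInv (c i) (d i) (w i) by ring]
  exact ioTime_ioTimeInv (hcd i) (hw i)

/-- Integration over the parameter of the flow as integration over the points which are reached. -/
theorem integral_eq_integral_box {V : Type*} [NormedAddCommGroup V] [NormedSpace ℝ V]
    (f : Rn n → V) (z : Rn n) : ∫ t, f t = ∫ w in openBox c d,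
      |(fderiv ℝ (boxTimeInv c d) w).det| • f (z - boxTimeInv c d w) := by
  have h := integral_image_eq_integral_abs_det_fderiv_smul volume
    (isOpen_openBox c d).measurableSet (f := boxTimeInv c d) (f' := fderiv ℝ (boxTimeInv c d))
    (fun y hy => (((contDiffOn_boxTimeInv hcd).contDiffAt
      ((isOpen_openBox c d).mem_nhds hy)).differentiableAt (by simp)).hasFDerivAt.hasFDerivWithinAt)
    (injOn_boxTimeInv hcd) (fun w => f (z - w))
  rw [← h, image_boxTimeInv hcd, setIntegral_univ]
  exact (integral_sub_left_eq_self f volume z).symm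

end BoxTime

section Functional

variable {n m : ℕ} {𝕜 : Type} [RCLike 𝕜] {X : Type u} [TopologicalSpace X]
  [ChartedSpace (Rn n) X] [IsManifold 𝓘(ℝ, Rn n) ∞ X] [T2Space X]
  {U : Opens X} {e : OpenPartialHomeomorph X (Rn n)} (he : e ∈ SmoothCharts n X)
  {S : Set (Rn n)} (hS : IsCompact S) (hSU : S ⊆ e.target ∩ e.symm ⁻¹' U)

/-- A current as a functional on the coordinate expressions of forms supported in a compact
set. -/
def Current.chartFunctional (T : Current n 𝕜 m U) :
    smoothOnCompact S ((Rn n) [⋀^Fin m]→L[ℝ] 𝕜) →ₗ[ℝ] 𝕜 where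
  toFun g := T.1 (TestForm.ofChart he hS hSU g.1 g.2.1 g.2.2)
  map_add' g g' := by
    rw [← map_add]
    exact congrArg T.1 (Subtype.ext (DForm.ofChart_add _ _))
  map_smul' r g := by
    rw [RingHom.id_apply, RCLike.real_smul_eq_coe_mul, ← smul_eq_mul, ← map_smul]
    refine congrArg T.1 (Subtype.ext ?_)
    rw [show (TestForm.ofChart he hS hSU (r • g).1 (r • g).2.1 (r • g).2.2).1 =
      DForm.ofChart e ((r : 𝕜) • g.1) from congrArg (DForm.ofChart e)
        (funext fun y => RCLike.real_smul_eq_coe_smul (K := 𝕜) r (g.1 y))]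
    exact DForm.ofChart_smul _ _

/-- A current, read in a chart on forms supported in a fixed compact set, has finite order. -/
theorem Current.exists_bound_chartFunctional (T : Current n 𝕜 m U) : ∃ (C : ℝ) (N : ℕ),
    ∀ g : smoothOnCompact S ((Rn n) [⋀^Fin m]→L[ℝ] 𝕜), ∀ M : ℝ, 0 ≤ M →
      (∀ i ≤ N, ∀ y ∈ S, ‖iteratedFDeriv ℝ i g.1 y‖ ≤ M) →
      ‖T.chartFunctional he hS hSU g‖ ≤ C * M := by
  have hSe : S ⊆ e.target := fun _ h => (hSU h).1
  have hK : IsCompact (e.symm '' S) := hS.image_of_continuousOn (e.continuousOn_symm.mono hSe)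
  obtain ⟨C, N, hC⟩ := T.2 e he _ hK (by
    rintro _ ⟨y, hy, rfl⟩
    exact e.map_target (hSe hy)) (Set.image_subset_iff.2 fun _ h => (hSU h).2)
  refine ⟨C, N, fun g M hM hb => ?_⟩
  have hz := (DForm.ofChart_isSmoothOn he hS hSe g.2.1.contDiffOn g.2.2).2
  refine hC _ hz M hM (TestForm.bound_of_bound_on hK hz hM fun i hi y hy hyS => ?_)
  have hyS' : y ∈ S := by
    obtain ⟨z, hz, h⟩ := hyS
    rwa [← e.right_inv hy, ← h, e.right_inv (hSe hz)]
  have h1 : (TestForm.ofChart he hS hSU g.1 g.2.1 g.2.2).1.inChart e =ᶠ[nhds y] g.1 := by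
    filter_upwards [e.open_target.mem_nhds hy] with z hz using DForm.inChart_ofChart he _ hz
  rw [(h1.iteratedFDeriv ℝ i).eq_of_nhds]
  exact hb i hi y hyS'

end Functional

namespace SmearData

variable {n m : ℕ} {𝕜 : Type} [RCLike 𝕜] {X : Type u} [TopologicalSpace X]
  [ChartedSpace (Rn n) X]
  {e : OpenPartialHomeomorph X (Rn n)} {U : Opens X} (s : SmearData e U)

open Classical in
/-- The kernel of the smearing operator, cut off by `κ`. -/
def kernel (κ : Rn n → ℝ) (w y : Rn n) (a : (Rn n) [⋀^Fin m]→L[ℝ] 𝕜) :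
    (Rn n) [⋀^Fin m]→L[ℝ] 𝕜 :=
  if w ∈ openBox s.c s.d ∧ y ∈ openBox s.c s.d then
    (κ w * |(fderiv ℝ (boxTimeInv s.c s.d) w).det| *
      s.ρ (boxTimeInv s.c s.d y - boxTimeInv s.c s.d w)) •
    a.compContinuousLinearMap (fderiv ℝ (s.flow (boxTimeInv s.c s.d y - boxTimeInv s.c s.d w)) y)
  else 0

theorem kernel_add (κ : Rn n → ℝ) (w y : Rn n) (a b : (Rn n) [⋀^Fin m]→L[ℝ] 𝕜) :
    s.kernel κ w y (a + b) = s.kernel κ w y a + s.kernel κ w y b := by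
  unfold kernel
  split_ifs
  · exact smul_add _ (a.compContinuousLinearMap _) (b.compContinuousLinearMap _)
  · exact (add_zero _).symm

theorem kernel_smul (κ : Rn n → ℝ) (w y : Rn n) (r : 𝕜) (a : (Rn n) [⋀^Fin m]→L[ℝ] 𝕜) :
    s.kernel κ w y (r • a) = r • s.kernel κ w y a := by
  unfold kernel
  split_ifs
  · exact smul_comm _ r (a.compContinuousLinearMap _)
  · exact (smul_zero (A := (Rn n) [⋀^Fin m]→L[ℝ] 𝕜) r).symm

theorem box_le : openBox s.c s.d ⊆ openBox s.a s.b :=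
  fun _ hy i => ⟨(s.le i).1.trans_lt (hy i).1, (hy i).2.trans_le (s.le i).2.2⟩

theorem flow_mem_inner_iff (t y : Rn n) : s.flow t y ∈ openBox s.c s.d ↔ y ∈ openBox s.c s.d :=
  backFlow_mem_iff s.lt (fun _ => ⟨le_rfl, le_rfl⟩) t y

theorem kernel_eq_zero {κ : Rn n → ℝ} {w y : Rn n} (a : (Rn n) [⋀^Fin m]→L[ℝ] 𝕜)
    (hp : ¬ (w ∈ tsupport κ ∧ y ∈ s.spread (tsupport κ))) : s.kernel κ w y a = 0 := by
  unfold kernel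
  split_ifs with h
  · refine (congrArg (fun r : ℝ => r • a.compContinuousLinearMap _) ?_).trans
      (zero_smul ℝ (A := (Rn n) [⋀^Fin m]→L[ℝ] 𝕜) _)
    by_cases h1 : w ∈ tsupport κ
    · have h2 : boxTimeInv s.c s.d y - boxTimeInv s.c s.d w ∉ tsupport s.ρ := fun h2 =>
        hp ⟨h1, s.mem_spread h2 (by
          rw [SmearData.flow, backFlow_sub s.lt h.2 h.1]
          exact h1)⟩
      rw [image_eq_zero_of_notMem_tsupport h2, mul_zero]
    · rw [image_eq_zero_of_notMem_tsupport h1, zero_mul, zero_mul]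
  · rfl

theorem spread_tsupport_subset {κ : Rn n → ℝ} (hκs : tsupport κ ⊆ openBox s.c s.d) :
    s.spread (tsupport κ) ⊆ openBox s.c s.d := by
  rintro _ ⟨p, ⟨_, hp⟩, rfl⟩
  exact (s.flow_mem_inner_iff _ _).2 (hκs hp)

variable {κ : Rn n → ℝ} (hκ : ContDiff ℝ ∞ κ) (hκc : HasCompactSupport κ)
  (hκs : tsupport κ ⊆ openBox s.c s.d)

include hκ hκc hκs

/-- The kernel extends smoothly by zero, because its support is compact in the square of the box of
the flow. -/
theorem contDiff_kernel {g : Rn n → (Rn n) [⋀^Fin m]→L[ℝ] 𝕜} (hg : ContDiff ℝ ∞ g) :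
    ContDiff ℝ ∞ fun p : Rn n × Rn n => s.kernel κ p.1 p.2 (g p.1) := by
  refine contDiff_iff_contDiffAt.2 fun p => ?_
  set D := openBox s.c s.d with hD
  have hDo : IsOpen D := isOpen_openBox _ _
  by_cases hp : p ∈ D ×ˢ D
  · have hn := (hDo.prod hDo).mem_nhds hp
    have hθ : ∀ y ∈ D, ContDiffAt ℝ ∞ (boxTimeInv s.c s.d) y := fun y hy =>
      (contDiffOn_boxTimeInv s.lt).contDiffAt (hDo.mem_nhds hy)
    have h1 : ContDiffAt ℝ ∞ (fun p : Rn n × Rn n =>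
        boxTimeInv s.c s.d p.2 - boxTimeInv s.c s.d p.1) p :=
      ((hθ _ hp.2).comp p contDiffAt_snd).sub ((hθ _ hp.1).comp p contDiffAt_fst)
    have h2 : ContDiffAt ℝ ∞ (fun p : Rn n × Rn n =>
        |(fderiv ℝ (boxTimeInv s.c s.d) p.1).det|) p := by
      have h3 : ContDiffAt ℝ ∞ (fun p : Rn n × Rn n => fderiv ℝ (boxTimeInv s.c s.d) p.1) p :=
        ((hθ _ hp.1).fderiv_right (m := ∞) (by simp)).comp p contDiffAt_fst
      have h4 : ContDiffAt ℝ ∞ (fun p : Rn n × Rn n =>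
          (fderiv ℝ (boxTimeInv s.c s.d) p.1).det) p := by
        exact contDiff_clm_det.contDiffAt.comp p h3
      exact (contDiffAt_abs (det_fderiv_boxTimeInv_ne_zero s.lt hp.1)).comp p h4
    have h5 : ContDiffAt ℝ ∞ (fun p : Rn n × Rn n =>
        κ p.1 * |(fderiv ℝ (boxTimeInv s.c s.d) p.1).det| *
          s.ρ (boxTimeInv s.c s.d p.2 - boxTimeInv s.c s.d p.1)) p :=
      ((hκ.contDiffAt.comp p contDiffAt_fst).mul h2).mul (s.contDiff.contDiffAt.comp p h1)
    have h6 : ContDiffAt ℝ ∞ (fun p : Rn n × Rn n =>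
        fderiv ℝ (s.flow (boxTimeInv s.c s.d p.2 - boxTimeInv s.c s.d p.1)) p.2) p :=
      ContDiffAt.comp (g := fun q : Rn n × Rn n => fderiv ℝ (s.flow q.1) q.2)
        (f := fun p : Rn n × Rn n => (boxTimeInv s.c s.d p.2 - boxTimeInv s.c s.d p.1, p.2)) p
        (contDiff_fderiv_family s.contDiff_flow).contDiffAt (h1.prodMk contDiffAt_snd)
    have h0 : ContDiffAt ℝ ∞ (fun p : Rn n × Rn n => g p.1) p := hg.contDiffAt.comp p contDiffAt_fst
    have h7 := contDiffAt_pullback h0 h6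
    refine (contDiffAt_real_smul (V := (Rn n) [⋀^Fin m]→L[ℝ] 𝕜) h5 h7).congr_of_eventuallyEq ?_
    filter_upwards [hn] with q hq
    exact if_pos (And.intro hq.1 hq.2)
  · have h1 : p ∉ tsupport κ ×ˢ s.spread (tsupport κ) := fun h =>
      hp ⟨hκs h.1, s.spread_tsupport_subset hκs h.2⟩
    have h2 : IsCompact (tsupport κ ×ˢ s.spread (tsupport κ)) :=
      hκc.isCompact.prod (s.isCompact_spread hκc)
    refine (contDiffAt_const (c := 0)).congr_of_eventuallyEq ?_
    filter_upwards [h2.isClosed.isOpen_compl.mem_nhds h1] with q hq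
    exact s.kernel_eq_zero _ hq

omit hκ hκc in
/-- Inside its box the flow reaches each point for exactly one parameter, so that the average over
the parameter becomes an integral over points. -/
theorem smearForm_eq_integral_kernel (g : Rn n → (Rn n) [⋀^Fin m]→L[ℝ] 𝕜) (y : Rn n) :
    s.smearForm (fun w => κ w • g w) y = ∫ w in tsupport κ, s.kernel κ w y (g w) := by
  have hz : ∀ w ∉ tsupport κ, s.kernel κ w y (g w) = 0 := fun w hw =>
    s.kernel_eq_zero _ fun h => hw h.1
  by_cases hy : y ∈ openBox s.c s.d
  · have h1 : s.smearForm (fun w => κ w • g w) y = ∫ t, s.ρ t •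
        ((κ (s.flow t y) • g (s.flow t y)).compContinuousLinearMap (fderiv ℝ (s.flow t) y)) :=
      setIntegral_eq_integral_of_forall_compl_eq_zero fun t ht => by
        rw [image_eq_zero_of_notMem_tsupport ht]
        exact zero_smul ℝ (A := (Rn n) [⋀^Fin m]→L[ℝ] 𝕜) _
    rw [h1, integral_eq_integral_box s.lt _ (boxTimeInv s.c s.d y),
      setIntegral_eq_integral_of_forall_compl_eq_zero hz,
      ← setIntegral_eq_integral_of_forall_compl_eq_zero (s := openBox s.c s.d)
        fun w hw => hz w fun h => hw (hκs h)]
    refine setIntegral_congr_fun (isOpen_openBox _ _).measurableSet fun w hw => ?_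
    have h2 : s.flow (boxTimeInv s.c s.d y - boxTimeInv s.c s.d w) y = w :=
      backFlow_sub s.lt hy hw
    simp only [h2, kernel, if_pos (And.intro hw hy)]
    set A := fderiv ℝ (s.flow (boxTimeInv s.c s.d y - boxTimeInv s.c s.d w)) y
    have h3 : (κ w • g w).compContinuousLinearMap A = κ w • (g w).compContinuousLinearMap A := rfl
    rw [h3, smul_smul, smul_smul]
    refine (congrArg (fun r : ℝ => r • (g w).compContinuousLinearMap A) ?_)
    ring
  · rw [setIntegral_eq_zero_of_forall_eq_zero fun w _ => ?_]
    · refine s.smearForm_eq_zero (S := tsupport κ) (fun w hw => ?_) fun h =>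
        hy (s.spread_tsupport_subset hκs h)
      rw [image_eq_zero_of_notMem_tsupport hw]
      exact zero_smul ℝ (A := (Rn n) [⋀^Fin m]→L[ℝ] 𝕜) _
    · exact s.kernel_eq_zero _ fun h => hy (s.spread_tsupport_subset hκs h.2)

variable [IsManifold 𝓘(ℝ, Rn n) ∞ X] [T2Space X]

/-- Inside the box of the flow the smear of a current is given by a smooth density. -/
theorem exists_density (T : Current n 𝕜 m U) :
    ∃ L : Rn n → ((Rn n) [⋀^Fin m]→L[ℝ] 𝕜) →L[ℝ] 𝕜, ContDiff ℝ ∞ L ∧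
      (∀ w (r : 𝕜) a, L w (r • a) = r * L w a) ∧
      ∀ φ ψ : TestForm n 𝕜 m U, (∀ y, ψ.1.local e y = κ y • φ.1.local e y) →
        (s.smear T).1 ψ = ∫ w, L w (φ.1.local e w) := by
  set S := s.spread (tsupport κ) with hSdef
  have hS : IsCompact S := s.isCompact_spread hκc
  have : CompactSpace S := isCompact_iff_compactSpace.1 hS
  have hSb : S ⊆ openBox s.a s.b := (s.spread_tsupport_subset hκs).trans s.box_le
  have hSU : S ⊆ e.target ∩ e.symm ⁻¹' U := fun y hy =>
    ⟨s.box_subset (hSb hy), (s.mem_iff (s.box_subset (hSb hy))).2 (hSb hy)⟩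
  have hks : ∀ w y (a : (Rn n) [⋀^Fin m]→L[ℝ] 𝕜), y ∉ S → s.kernel κ w y a = 0 :=
    fun w y a hy => s.kernel_eq_zero a fun h => hy h.2
  let τ := T.chartFunctional s.isNBox.chart hS hSU
  obtain ⟨C, N, hC⟩ := T.exists_bound_chartFunctional s.isNBox.chart hS hSU
  let G : Rn n → ((Rn n) [⋀^Fin m]→L[ℝ] 𝕜) → smoothOnCompact S ((Rn n) [⋀^Fin m]→L[ℝ] 𝕜) :=
    fun w a => ⟨fun y => s.kernel κ w y a,
      (s.contDiff_kernel hκ hκc hκs (contDiff_const (c := a))).comp (f := fun y => (w, y))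
        (by fun_prop), fun y hy => hks w y a hy⟩
  let L : Rn n → ((Rn n) [⋀^Fin m]→L[ℝ] 𝕜) →L[ℝ] 𝕜 := fun w => LinearMap.toContinuousLinearMap
    { toFun := fun a => τ (G w a)
      map_add' := fun a b => by
        rw [← map_add]
        exact congrArg τ (Subtype.ext (funext fun y => s.kernel_add κ w y a b))
      map_smul' := fun r a => by
        rw [RingHom.id_apply, ← map_smul]
        exact congrArg τ (Subtype.ext (funext fun y => by
          change s.kernel κ w y (r • a) = r • s.kernel κ w y a
          rw [RCLike.real_smul_eq_coe_smul (K := 𝕜) r a, s.kernel_smul]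
          exact (RCLike.real_smul_eq_coe_smul (K := 𝕜) r (s.kernel κ w y a)).symm)) }
  have hL : ∀ w a, L w a = τ (G w a) := fun _ _ => rfl
  refine ⟨L, contDiff_clm_apply_iff.2 fun a => ?_, fun w r a => ?_, fun φ ψ h => ?_⟩
  · simp only [hL]
    exact contDiff_functional_slice N τ C hC (k := fun p => s.kernel κ p.1 p.2 a)
      (s.contDiff_kernel hκ hκc hκs contDiff_const) (fun w => G w a) fun _ _ => rfl
  · rw [hL, hL, ← smul_eq_mul]
    have h1 : (G w (r • a)).1 = r • (G w a).1 := funext fun y => s.kernel_smul κ w y r a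
    refine Eq.trans ?_ (map_smul T.1 r _)
    refine congrArg T.1 (Subtype.ext ?_)
    exact (congrArg (DForm.ofChart e) h1).trans (DForm.ofChart_smul r _)
  · have hg := s.contDiff_local φ
    have hψ : ψ.1.local e = fun y => κ y • φ.1.local e y := funext h
    have hsm : s.smearForm (ψ.1.local e) = fun y =>
        ∫ w in tsupport κ, s.kernel κ w y (φ.1.local e w) := by
      rw [hψ]
      exact funext fun y => s.smearForm_eq_integral_kernel hκs (φ.1.local e) y
    have hsupp : ∀ y ∉ S, s.smearForm (ψ.1.local e) y = 0 := fun y hy =>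
      s.smearForm_eq_zero (S := tsupport κ) (fun w hw => by
        rw [h, image_eq_zero_of_notMem_tsupport hw]
        exact zero_smul ℝ (A := (Rn n) [⋀^Fin m]→L[ℝ] 𝕜) _) hy
    have h2 := functional_setIntegral (μ := volume) N τ C hC
      (k := fun p : Rn n × Rn n => s.kernel κ p.1 p.2 (φ.1.local e p.1))
      (s.contDiff_kernel hκ hκc hκs hg) (fun w => G w (φ.1.local e w)) (fun _ _ => rfl)
      hκc.isCompact ⟨s.smearForm (ψ.1.local e), s.contDiff_smearForm (s.contDiff_local ψ), hsupp⟩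
      fun y => congrFun hsm y
    refine h2.trans (setIntegral_eq_integral_of_forall_compl_eq_zero fun w hw => ?_)
    have h0 : G w (φ.1.local e w) = 0 :=
      Subtype.ext (funext fun y => s.kernel_eq_zero _ fun h => hw h.1)
    rw [h0, map_zero]

end SmearData

/-! ### The wedge pairing -/

section Wedge

variable {n k m : ℕ} {𝕜 : Type} [RCLike 𝕜]

theorem wedge_apply (a : (Rn n) [⋀^Fin k]→L[ℝ] 𝕜) (b : (Rn n) [⋀^Fin m]→L[ℝ] 𝕜)
    (v : Fin k ⊕ Fin m → Rn n) : wedge a b v = ∑ σ : Equiv.Perm.ModSumCongr (Fin k) (Fin m),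
      LinearMap.mul' ℝ 𝕜 (AlternatingMap.domCoprod.summand a.toAlternatingMap b.toAlternatingMap σ
        v) := by
  simp [wedge]

theorem wedge_summand (a : (Rn n) [⋀^Fin k]→L[ℝ] 𝕜) (b : (Rn n) [⋀^Fin m]→L[ℝ] 𝕜)
    (v : Fin k ⊕ Fin m → Rn n) (σ : Equiv.Perm (Fin k ⊕ Fin m)) :
    LinearMap.mul' ℝ 𝕜 (AlternatingMap.domCoprod.summand a.toAlternatingMap b.toAlternatingMap
      (Quotient.mk'' σ) v) =
      Equiv.Perm.sign σ • ((a fun i => v (σ (Sum.inl i))) * b fun i => v (σ (Sum.inr i))) := by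
  rw [AlternatingMap.domCoprod.summand_mk'']
  simp [MultilinearMap.domDomCongr_apply, MultilinearMap.domCoprod_apply]

/-- The wedge product as a sum over representatives of the shuffles. -/
theorem exists_wedge_repr (a : (Rn n) [⋀^Fin k]→L[ℝ] 𝕜) (b : (Rn n) [⋀^Fin m]→L[ℝ] 𝕜)
    (v : Fin k ⊕ Fin m → Rn n) : wedge a b v =
      ∑ σ : Equiv.Perm.ModSumCongr (Fin k) (Fin m), Equiv.Perm.sign σ.out •
        ((a fun i => v (σ.out (Sum.inl i))) * b fun i => v (σ.out (Sum.inr i))) := by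
  rw [wedge_apply]
  refine Finset.sum_congr rfl fun σ _ => ?_
  rw [← wedge_summand]
  congr 2
  rw [show (Quotient.mk'' σ.out : Equiv.Perm.ModSumCongr (Fin k) (Fin m)) = σ from σ.out_eq]

theorem wedgeCoeff_add_left (h : k + m = n) (a a' : (Rn n) [⋀^Fin k]→L[ℝ] 𝕜)
    (b : (Rn n) [⋀^Fin m]→L[ℝ] 𝕜) :
    wedgeCoeff h (a + a') b = wedgeCoeff h a b + wedgeCoeff h a' b := by
  simp only [wedgeCoeff, exists_wedge_repr, ← Finset.sum_add_distrib, ← smul_add, ← add_mul]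
  rfl

theorem wedgeCoeff_smul_left (h : k + m = n) (r : 𝕜) (a : (Rn n) [⋀^Fin k]→L[ℝ] 𝕜)
    (b : (Rn n) [⋀^Fin m]→L[ℝ] 𝕜) : wedgeCoeff h (r • a) b = r * wedgeCoeff h a b := by
  simp only [wedgeCoeff, exists_wedge_repr, Finset.mul_sum, mul_smul_comm, ← mul_assoc]
  rfl

theorem wedgeCoeff_zero_left (h : k + m = n) (b : (Rn n) [⋀^Fin m]→L[ℝ] 𝕜) :
    wedgeCoeff h (0 : (Rn n) [⋀^Fin k]→L[ℝ] 𝕜) b = 0 := by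
  have h1 := wedgeCoeff_add_left h (0 : (Rn n) [⋀^Fin k]→L[ℝ] 𝕜) 0 b
  rwa [show (0 : (Rn n) [⋀^Fin k]→L[ℝ] 𝕜) + 0 = 0 from add_zero 0, left_eq_add] at h1

theorem wedgeCoeff_add_right (h : k + m = n) (a : (Rn n) [⋀^Fin k]→L[ℝ] 𝕜)
    (b b' : (Rn n) [⋀^Fin m]→L[ℝ] 𝕜) :
    wedgeCoeff h a (b + b') = wedgeCoeff h a b + wedgeCoeff h a b' := by
  simp only [wedgeCoeff, exists_wedge_repr, ← Finset.sum_add_distrib, ← smul_add, ← mul_add]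
  rfl

theorem wedgeCoeff_smul_right (h : k + m = n) (r : 𝕜) (a : (Rn n) [⋀^Fin k]→L[ℝ] 𝕜)
    (b : (Rn n) [⋀^Fin m]→L[ℝ] 𝕜) : wedgeCoeff h a (r • b) = r * wedgeCoeff h a b := by
  simp only [wedgeCoeff, exists_wedge_repr, Finset.mul_sum, mul_smul_comm, mul_left_comm r]
  rfl

/-- The standard basis of `ℝⁿ`, indexed by the arguments of a wedge product. -/
def sumBasis (h : k + m = n) : Module.Basis (Fin k ⊕ Fin m) ℝ (Rn n) :=
  (EuclideanSpace.basisFun (Fin n) ℝ).toBasis.reindex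
    (finSumFinEquiv.trans (finCongr h)).symm

theorem sumBasis_apply (h : k + m = n) (i : Fin k ⊕ Fin m) : sumBasis h i =
    EuclideanSpace.basisFun (Fin n) ℝ (finCongr h (finSumFinEquiv i)) := by
  simp [sumBasis]

/-- An alternating map in as many arguments as the dimension is a multiple of the determinant. -/
theorem alternating_eq_det_smul {ι : Type*} [Fintype ι] [DecidableEq ι] {V : Type*}
    [AddCommGroup V] [Module ℝ V] (e : Module.Basis ι ℝ V) {W : Type*} [AddCommGroup W] [Module ℝ W]
    (f : V [⋀^ι]→ₗ[ℝ] W) (v : ι → V) : f v = e.det v • f e := by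
  have : f = (LinearMap.toSpanSingleton ℝ W (f e)).compAlternatingMap e.det := by
    refine e.ext_alternating fun σ hσ => ?_
    let τ : Equiv.Perm ι := Equiv.ofBijective σ (Finite.injective_iff_bijective.1 hσ)
    have h1 : (fun i => e (σ i)) = (⇑e) ∘ τ := rfl
    rw [h1, LinearMap.compAlternatingMap_apply, AlternatingMap.map_perm, AlternatingMap.map_perm,
      e.det_self]
    rw [LinearMap.toSpanSingleton_apply, Units.smul_def, Units.smul_def, smul_assoc, one_smul]
  conv_lhs => rw [this]
  rfl

theorem wedgeCoeff_pullback (h : k + m = n) (a : (Rn n) [⋀^Fin k]→L[ℝ] 𝕜)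
    (b : (Rn n) [⋀^Fin m]→L[ℝ] 𝕜) (A : Rn n →L[ℝ] Rn n) :
    wedgeCoeff h (a.compContinuousLinearMap A) (b.compContinuousLinearMap A) =
      A.det • wedgeCoeff h a b := by
  have h0 : ∀ i, EuclideanSpace.basisFun (Fin n) ℝ (finCongr h (finSumFinEquiv i)) =
      sumBasis h i := fun i => (sumBasis_apply h i).symm
  have h1 : ∀ v, wedge (a.compContinuousLinearMap A) (b.compContinuousLinearMap A) v =
      wedge a b fun i => A (v i) := fun v => by
    rw [exists_wedge_repr, exists_wedge_repr]
    rfl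
  rw [wedgeCoeff, h1, wedgeCoeff, alternating_eq_det_smul (sumBasis h) (wedge a b)]
  have h2 := (sumBasis h).det_comp A.toLinearMap (sumBasis h)
  rw [(sumBasis h).det_self, mul_one] at h2
  simp only [h0]
  rw [ContinuousLinearMap.det, ← h2]
  rfl

/-- The alternating form `dx_J` (a minor of the coordinate matrix). -/
def minorForm (𝕜 : Type) [RCLike 𝕜] (J : Fin k → Fin n) : (Rn n) [⋀^Fin k]→L[ℝ] 𝕜 :=
  { (RCLike.ofRealLI (K := 𝕜)).toLinearMap.compAlternatingMap
      ((Matrix.detRowAlternating (n := Fin k) (R := ℝ)).compLinearMap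
        (LinearMap.pi fun j => (EuclideanSpace.proj (𝕜 := ℝ) (J j)).toLinearMap)) with
    cont := by
      refine (RCLike.ofRealLI (K := 𝕜)).continuous.comp ?_
      refine Continuous.matrix_det (A := fun (v : Fin k → Rn n) i j => v i (J j)) ?_
      exact continuous_pi fun i => continuous_pi fun j => by fun_prop }

theorem minorForm_apply (J : Fin k → Fin n) (v : Fin k → Rn n) :
    minorForm 𝕜 J v = ((Matrix.det fun i j => v i (J j) : ℝ) : 𝕜) := rfl

/-- An injective choice of `m` out of `n = k + m` indices can be completed by `k` further ones. -/
theorem exists_sumEquiv (h : k + m = n) {I : Fin m → Fin n} (hI : Function.Injective I) :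
    ∃ π : Fin k ⊕ Fin m ≃ Fin n, ∀ j, π (Sum.inr j) = I j := by
  classical
  have hc : Fintype.card (Fin k) = Fintype.card ((Set.range I)ᶜ : Set (Fin n)) := by
    rw [Fintype.card_compl_set, Set.card_range_of_injective hI]
    simp
    omega
  refine ⟨((Fintype.equivOfCardEq hc).sumCongr (Equiv.ofInjective I hI)).trans
    ((Equiv.sumComm _ _).trans (Equiv.Set.sumCompl (Set.range I))), fun j => ?_⟩
  simp

/-- Pairing with the minor of the complementary indices extracts a coefficient of a form. -/
theorem wedge_minorForm (π : Fin k ⊕ Fin m ≃ Fin n) (b : (Rn n) [⋀^Fin m]→L[ℝ] 𝕜) :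
    wedge (minorForm 𝕜 fun j => π (Sum.inl j)) b
      (fun i => EuclideanSpace.basisFun (Fin n) ℝ (π i)) =
      b fun j => EuclideanSpace.basisFun (Fin n) ℝ (π (Sum.inr j)) := by
  refine (wedge_apply _ _ _).trans ((Finset.sum_eq_single
    (Quotient.mk'' (1 : Equiv.Perm (Fin k ⊕ Fin m))) ?_ ?_).trans ?_)
  · intro q _ hq
    induction q using Quotient.inductionOn' with
    | h σ =>
    rw [wedge_summand]
    suffices h : (minorForm 𝕜 fun j => π (Sum.inl j))
        (fun i => EuclideanSpace.basisFun (Fin n) ℝ (π (σ (Sum.inl i)))) = 0 by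
      rw [h, zero_mul, smul_zero]
    -- a permutation preserving the two blocks is trivial in the quotient
    have h2 : ¬ Set.MapsTo σ (Set.range Sum.inl) (Set.range Sum.inl) := fun h2 => by
      refine hq (Quotient.sound' ?_)
      rw [QuotientGroup.leftRel_apply, mul_one]
      exact inv_mem (Equiv.Perm.mem_sumCongrHom_range_of_perm_mapsTo_inl h2)
    have h3 : ∃ i l, σ (Sum.inl i) = Sum.inr l := by
      by_contra! h4
      refine h2 ?_
      rintro _ ⟨i, rfl⟩
      rcases h5 : σ (Sum.inl i) with j | j
      · exact ⟨j, rfl⟩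
      · exact (h4 i j h5).elim
    obtain ⟨i, l, hil⟩ := h3
    rw [minorForm_apply]
    refine (congrArg _ (Matrix.det_eq_zero_of_row_eq_zero i fun j => ?_)).trans RCLike.ofReal_zero
    rw [hil]
    simp [EuclideanSpace.basisFun_apply]
  · intro h
    exact (h (Finset.mem_univ _)).elim
  · rw [wedge_summand]
    have h1 : (minorForm 𝕜 fun j => π (Sum.inl j))
        (fun i => EuclideanSpace.basisFun (Fin n) ℝ (π (Sum.inl i))) = 1 := by
      rw [minorForm_apply]
      have : (fun i j : Fin k => (EuclideanSpace.basisFun (Fin n) ℝ (π (Sum.inl i)))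
          (π (Sum.inl j))) = (1 : Matrix (Fin k) (Fin k) ℝ) := by
        ext i j
        simp [EuclideanSpace.basisFun_apply, Matrix.one_apply, eq_comm]
      rw [this, Matrix.det_one, RCLike.ofReal_one]
    simp only [Equiv.Perm.coe_one, id]
    rw [h1, Equiv.Perm.sign_one, one_smul, one_mul]

/-- The wedge pairing represents every functional. -/
theorem exists_wedgeCoeff_eq (h : k + m = n) (l : ((Rn n) [⋀^Fin m]→L[ℝ] 𝕜) →ₗ[𝕜] 𝕜) :
    ∃ a : (Rn n) [⋀^Fin k]→L[ℝ] 𝕜, ∀ b, wedgeCoeff h a b = l b := by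
  let ev : (Fin m → Fin n) → ((Rn n) [⋀^Fin m]→L[ℝ] 𝕜) →ₗ[𝕜] 𝕜 := fun I =>
    { toFun := fun b => b fun j => EuclideanSpace.basisFun (Fin n) ℝ (I j)
      map_add' := fun _ _ => rfl
      map_smul' := fun _ _ => rfl }
  have hl : l ∈ Submodule.span 𝕜 (Set.range ev) := by
    refine mem_span_of_iInf_ker_le_ker fun b hb => ?_
    have hb0 : b = 0 := altCoords_injective (funext fun I =>
      (Submodule.mem_iInf _).1 hb I)
    rw [hb0]
    exact Submodule.zero_mem _
  let W : Submodule 𝕜 (((Rn n) [⋀^Fin m]→L[ℝ] 𝕜) →ₗ[𝕜] 𝕜) :=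
    { carrier := {l | ∃ a : (Rn n) [⋀^Fin k]→L[ℝ] 𝕜, ∀ b, wedgeCoeff h a b = l b}
      add_mem' := by
        rintro l l' ⟨a, ha⟩ ⟨a', ha'⟩
        exact ⟨a + a', fun b => by rw [wedgeCoeff_add_left, ha, ha']; rfl⟩
      zero_mem' := ⟨0, fun b => wedgeCoeff_zero_left h b⟩
      smul_mem' := by
        rintro r l ⟨a, ha⟩
        exact ⟨r • a, fun b => by rw [wedgeCoeff_smul_left, ha]; rfl⟩ }
  suffices hW : Submodule.span 𝕜 (Set.range ev) ≤ W from hW hl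
  rw [Submodule.span_le]
  rintro _ ⟨I, rfl⟩
  by_cases hI : Function.Injective I
  · obtain ⟨π, hπ⟩ := exists_sumEquiv h hI
    let σ : Equiv.Perm (Fin k ⊕ Fin m) := π.trans (finSumFinEquiv.trans (finCongr h)).symm
    refine ⟨((Equiv.Perm.sign σ : ℤ) : 𝕜) • minorForm 𝕜 fun j => π (Sum.inl j), fun b => ?_⟩
    rw [wedgeCoeff_smul_left]
    have h1 := (wedge (minorForm 𝕜 fun j => π (Sum.inl j)) b).map_perm
      (fun i => EuclideanSpace.basisFun (Fin n) ℝ (finCongr h (finSumFinEquiv i))) σ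
    have h2 : (fun i => EuclideanSpace.basisFun (Fin n) ℝ (finCongr h (finSumFinEquiv i))) ∘ σ =
        fun i => EuclideanSpace.basisFun (Fin n) ℝ (π i) := by
      funext i
      have : finCongr h (finSumFinEquiv (σ i)) = π i :=
        (finSumFinEquiv.trans (finCongr h)).apply_symm_apply (π i)
      simp only [Function.comp_apply, this]
    rw [h2, wedge_minorForm] at h1
    simp only [hπ] at h1
    rw [Units.smul_def, zsmul_eq_mul] at h1
    exact h1.symm
  · refine ⟨0, fun b => ?_⟩
    rw [wedgeCoeff_zero_left]
    rw [Function.Injective] at hI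
    push Not at hI
    obtain ⟨i, j, hij, hne⟩ := hI
    exact (b.map_eq_zero_of_eq _ (by rw [hij]) hne).symm

/-- A linear choice of forms representing functionals through the wedge pairing. -/
theorem exists_wedgeCoeff_linear (h : k + m = n) :
    ∃ Q : (((Rn n) [⋀^Fin m]→L[ℝ] 𝕜) →L[ℝ] 𝕜) →L[ℝ] (Rn n) [⋀^Fin k]→L[ℝ] 𝕜,
      ∀ l : ((Rn n) [⋀^Fin m]→L[ℝ] 𝕜) →L[ℝ] 𝕜, (∀ (r : 𝕜) b, l (r • b) = r * l b) →
        ∀ b, wedgeCoeff h (Q l) b = l b := by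
  have hs : ∀ (r : ℝ) (a : (Rn n) [⋀^Fin k]→L[ℝ] 𝕜) (b : (Rn n) [⋀^Fin m]→L[ℝ] 𝕜),
      wedgeCoeff h (r • a) b = r • wedgeCoeff h a b := fun r a b => by
    rw [RCLike.real_smul_eq_coe_smul (K := 𝕜) r a, wedgeCoeff_smul_left,
      RCLike.real_smul_eq_coe_mul]
  have hs' : ∀ (r : ℝ) (a : (Rn n) [⋀^Fin k]→L[ℝ] 𝕜) (b : (Rn n) [⋀^Fin m]→L[ℝ] 𝕜),
      wedgeCoeff h a (r • b) = r • wedgeCoeff h a b := fun r a b => by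
    rw [RCLike.real_smul_eq_coe_smul (K := 𝕜) r b, wedgeCoeff_smul_right,
      RCLike.real_smul_eq_coe_mul]
  let P : ((Rn n) [⋀^Fin k]→L[ℝ] 𝕜) →ₗ[ℝ] (((Rn n) [⋀^Fin m]→L[ℝ] 𝕜) →ₗ[ℝ] 𝕜) :=
    LinearMap.mk₂ ℝ (wedgeCoeff h) (wedgeCoeff_add_left h) hs (wedgeCoeff_add_right h) hs'
  obtain ⟨Q, hQ⟩ := P.rangeRestrict.exists_rightInverse_of_surjective P.range_rangeRestrict
  obtain ⟨Q', hQ'⟩ := Q.exists_extend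
  let c : (((Rn n) [⋀^Fin m]→L[ℝ] 𝕜) →L[ℝ] 𝕜) →ₗ[ℝ] (((Rn n) [⋀^Fin m]→L[ℝ] 𝕜) →ₗ[ℝ] 𝕜) :=
    ContinuousLinearMap.coeLM ℝ
  refine ⟨LinearMap.toContinuousLinearMap (E := ((Rn n) [⋀^Fin m]→L[ℝ] 𝕜) →L[ℝ] 𝕜)
    (F' := (Rn n) [⋀^Fin k]→L[ℝ] 𝕜) (Q' ∘ₗ c), fun l hl b => ?_⟩
  obtain ⟨a, ha⟩ := exists_wedgeCoeff_eq h
    { toFun := l, map_add' := map_add l, map_smul' := fun r b => hl r b }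
  have hr : c l ∈ LinearMap.range P := ⟨a, LinearMap.ext fun b => ha b⟩
  have h1 : Q' (c l) = Q ⟨c l, hr⟩ := LinearMap.congr_fun hQ' ⟨c l, hr⟩
  have h2 : P (Q ⟨c l, hr⟩) = c l := congrArg Subtype.val (LinearMap.congr_fun hQ ⟨c l, hr⟩)
  have h3 := LinearMap.congr_fun h2 b
  rw [← h1] at h3
  exact h3

end Wedge

/-! ### Currents with a smooth density -/

section ByParts

variable {n : ℕ} {𝕜 : Type} [RCLike 𝕜] {F G : Type*} [NormedAddCommGroup F] [NormedSpace ℝ F]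
  [NormedAddCommGroup G] [NormedSpace ℝ G]

/-- Integration by parts for a pairing. -/
theorem integral_clm_fderiv {M : Rn n → F →L[ℝ] 𝕜} {g : Rn n → F} (hM : ContDiff ℝ ∞ M)
    (hg : ContDiff ℝ ∞ g) (hgc : HasCompactSupport g) (v : Rn n) :
    ∫ y, M y (fderiv ℝ g y v) = -∫ y, fderiv ℝ M y v (g y) := by
  have hMd : ContDiff ℝ ∞ fun y => fderiv ℝ M y v :=
    (hM.fderiv_right (m := ∞) (by simp)).clm_apply contDiff_const
  have hgd : ContDiff ℝ ∞ fun y => fderiv ℝ g y v :=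
    (hg.fderiv_right (m := ∞) (by simp)).clm_apply contDiff_const
  refine integral_bilinear_fderiv_right_eq_neg_left_of_integrable
    (B := ContinuousLinearMap.id ℝ (F →L[ℝ] 𝕜)) ?_ ?_ ?_
    (fun x _ => hM.differentiable (by simp) x) (fun x _ => hg.differentiable (by simp) x)
  · refine (hMd.clm_apply hg).continuous.integrable_of_hasCompactSupport (hgc.mono' ?_)
    exact fun y hy => subset_tsupport _ fun h => hy (by simp [h])
  · refine (hM.clm_apply hgd).continuous.integrable_of_hasCompactSupport
      ((hgc.fderiv_apply (𝕜 := ℝ) v).mono' ?_)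
    exact fun y hy => subset_tsupport _ fun h => hy (by simp [h])
  · refine (hM.clm_apply hg).continuous.integrable_of_hasCompactSupport (hgc.mono' ?_)
    exact fun y hy => subset_tsupport _ fun h => hy (by simp [h])

theorem clm_eq_sum_smulRight (A : Rn n →L[ℝ] F) : A = ∑ i : Fin n,
    (EuclideanSpace.proj (𝕜 := ℝ) i : Rn n →L[ℝ] ℝ).smulRight
      (A (EuclideanSpace.basisFun (Fin n) ℝ i)) := by
  ext v
  conv_lhs => rw [← (EuclideanSpace.basisFun (Fin n) ℝ).sum_repr v, map_sum]
  simp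

/-- The formal adjoint of the first order operator `g ↦ A (Dg)`. -/
theorem exists_formal_adjoint (A : (Rn n →L[ℝ] F) →L[ℝ] G) {L : Rn n → G →L[ℝ] 𝕜}
    (hL : ContDiff ℝ ∞ L) : ∃ L' : Rn n → F →L[ℝ] 𝕜, ContDiff ℝ ∞ L' ∧
      (∀ y a, L' y a = -∑ i, fderiv ℝ L y (EuclideanSpace.basisFun (Fin n) ℝ i)
        (A ((EuclideanSpace.proj (𝕜 := ℝ) i : Rn n →L[ℝ] ℝ).smulRight a))) ∧
      ∀ g : Rn n → F, ContDiff ℝ ∞ g → HasCompactSupport g →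
        ∫ y, L y (A (fderiv ℝ g y)) = ∫ y, L' y (g y) := by
  let W : Fin n → F →L[ℝ] G := fun i =>
    A.comp (ContinuousLinearMap.smulRightL ℝ (Rn n) F (EuclideanSpace.proj (𝕜 := ℝ) i))
  have hW : ∀ i a, W i a = A ((EuclideanSpace.proj (𝕜 := ℝ) i : Rn n →L[ℝ] ℝ).smulRight a) :=
    fun _ _ => rfl
  let v : Fin n → Rn n := fun i => EuclideanSpace.basisFun (Fin n) ℝ i
  have hMi : ∀ i, ContDiff ℝ ∞ fun y => (L y).comp (W i) := fun i => hL.clm_comp contDiff_const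
  have hMd : ∀ i y, fderiv ℝ (fun y => (L y).comp (W i)) y (v i) =
      (fderiv ℝ L y (v i)).comp (W i) := fun i y => by
    have := ((((ContinuousLinearMap.compL ℝ F G 𝕜).flip (W i)).hasFDerivAt).comp y
      (hL.differentiable (by simp) y).hasFDerivAt).fderiv
    exact DFunLike.congr_fun this (v i)
  refine ⟨fun y => -∑ i, (fderiv ℝ L y (v i)).comp (W i), ?_, fun y a => ?_, fun g hg hgc => ?_⟩
  · refine (ContDiff.sum fun i _ => ?_).neg
    exact ((hL.fderiv_right (m := ∞) (by simp)).clm_apply contDiff_const).clm_comp contDiff_const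
  · simp [W, v]
  · have hgd : ∀ i, ContDiff ℝ ∞ fun y => fderiv ℝ g y (v i) := fun i =>
      (hg.fderiv_right (m := ∞) (by simp)).clm_apply contDiff_const
    have h1 : ∀ y, L y (A (fderiv ℝ g y)) = ∑ i, (L y).comp (W i) (fderiv ℝ g y (v i)) := by
      intro y
      conv_lhs => rw [clm_eq_sum_smulRight (fderiv ℝ g y)]
      simp [W, v]
    simp_rw [h1]
    rw [integral_finsetSum]
    · simp_rw [fun i => integral_clm_fderiv (hMi i) hg hgc (v i), hMd]
      rw [Finset.sum_neg_distrib, ← integral_finsetSum, ← integral_neg]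
      · simp
      · intro i _
        refine (ContDiff.clm_apply (f := fun y => (fderiv ℝ L y (v i)).comp (W i))
          ?_ hg).continuous.integrable_of_hasCompactSupport (hgc.mono' ?_)
        · exact ((hL.fderiv_right (m := ∞) (by simp)).clm_apply contDiff_const).clm_comp
            contDiff_const
        · exact fun y hy => subset_tsupport _ fun h => hy (by simp [h])
    · intro i _
      refine ((hMi i).clm_apply (hgd i)).continuous.integrable_of_hasCompactSupport
        ((hgc.fderiv_apply (𝕜 := ℝ) (v i)).mono' ?_)
      exact fun y hy => subset_tsupport _ fun h => hy (by simp [h])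

/-- If a current has a smooth density, so does its exterior derivative. -/
theorem exists_adjoint_extDeriv {m : ℕ} {L : Rn n → ((Rn n) [⋀^Fin (m + 1)]→L[ℝ] 𝕜) →L[ℝ] 𝕜}
    (hL : ContDiff ℝ ∞ L) (hLs : ∀ y (r : 𝕜) a, L y (r • a) = r * L y a) :
    ∃ L' : Rn n → ((Rn n) [⋀^Fin m]→L[ℝ] 𝕜) →L[ℝ] 𝕜, ContDiff ℝ ∞ L' ∧
      (∀ y (r : 𝕜) a, L' y (r • a) = r * L' y a) ∧
      ∀ g : Rn n → (Rn n) [⋀^Fin m]→L[ℝ] 𝕜, ContDiff ℝ ∞ g → HasCompactSupport g →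
        ∫ y, L y (extDeriv g y) = ∫ y, L' y (g y) := by
  obtain ⟨L', h1, h2, h3⟩ := exists_formal_adjoint
    (ContinuousAlternatingMap.alternatizeUncurryFinCLM ℝ (Rn n) 𝕜 (n := m)) hL
  refine ⟨L', h1, fun y r a => ?_, h3⟩
  have h4 : ∀ v b, fderiv ℝ L y v b = fderiv ℝ (fun y => L y b) y v := fun v b => by
    have := ((ContinuousLinearMap.apply ℝ 𝕜 b).hasFDerivAt.comp y
      (hL.differentiable (by simp) y).hasFDerivAt).fderiv
    exact (DFunLike.congr_fun this v).symm
  have h5 : ∀ v b, fderiv ℝ L y v (r • b) = r * fderiv ℝ L y v b := fun v b => by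
    rw [h4, h4]
    simp_rw [hLs]
    rw [fderiv_const_mul]
    · rfl
    · exact (hL.differentiable (by simp) y).clm_apply (differentiableAt_const b)
  rw [h2, h2, mul_neg, Finset.mul_sum]
  refine congrArg _ (Finset.sum_congr rfl fun i _ => ?_)
  rw [← h5]
  refine congrArg _ ?_
  have h6 : (EuclideanSpace.proj (𝕜 := ℝ) i : Rn n →L[ℝ] ℝ).smulRight (r • a) =
      r • (EuclideanSpace.proj (𝕜 := ℝ) i : Rn n →L[ℝ] ℝ).smulRight a :=
    ContinuousLinearMap.ext fun v => smul_comm (v i) r a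
  rw [h6]
  exact ContinuousAlternatingMap.alternatizeUncurryFin_smul r
    ((EuclideanSpace.proj (𝕜 := ℝ) i : Rn n →L[ℝ] ℝ).smulRight a)

end ByParts

section Density

variable {n m k : ℕ} {𝕜 : Type} [RCLike 𝕜] {X : Type u} [TopologicalSpace X]
  [ChartedSpace (Rn n) X] [IsManifold 𝓘(ℝ, Rn n) ∞ X]

/-- The chain rule for three charts. -/
theorem fderiv_transition_comp {e₁ e₂ e₃ : OpenPartialHomeomorph X (Rn n)}
    (h₁ : e₁ ∈ SmoothCharts n X) (h₂ : e₂ ∈ SmoothCharts n X) (h₃ : e₃ ∈ SmoothCharts n X) {x : X}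
    (hx₁ : x ∈ e₁.source) (hx₂ : x ∈ e₂.source) (hx₃ : x ∈ e₃.source) :
    fderiv ℝ (fun z => e₃ (e₁.symm z)) (e₁ x) =
      (fderiv ℝ (fun z => e₃ (e₂.symm z)) (e₂ x)).comp
        (fderiv ℝ (fun z => e₂ (e₁.symm z)) (e₁ x)) := by
  have hy := e₁.map_source hx₁
  have hl := e₁.left_inv hx₁
  have hy₂ : e₁.symm (e₁ x) ∈ e₂.source := by rwa [hl]
  have hd₁ := (DForm.contDiffAt_transition h₁ h₂ hy hy₂).differentiableAt (by simp)
  have hd₂ : DifferentiableAt ℝ (fun z => e₃ (e₂.symm z)) (e₂ (e₁.symm (e₁ x))) := by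
    rw [hl]
    refine (DForm.contDiffAt_transition h₂ h₃ (e₂.map_source hx₂) ?_).differentiableAt (by simp)
    rwa [e₂.left_inv hx₂]
  have h := fderiv_comp (e₁ x) hd₂ hd₁
  rw [hl] at h
  rw [← h]
  refine Filter.EventuallyEq.fderiv_eq ?_
  have : ∀ᶠ z in nhds (e₁ x), e₁.symm z ∈ e₂.source :=
    (e₁.symm.continuousAt hy).eventually (e₂.open_source.mem_nhds hy₂)
  filter_upwards [this] with z hz
  simp only [Function.comp_apply, e₂.left_inv hz]

theorem det_fderiv_transition_comp {e₁ e₂ e₃ : OpenPartialHomeomorph X (Rn n)}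
    (h₁ : e₁ ∈ SmoothCharts n X) (h₂ : e₂ ∈ SmoothCharts n X) (h₃ : e₃ ∈ SmoothCharts n X) {x : X}
    (hx₁ : x ∈ e₁.source) (hx₂ : x ∈ e₂.source) (hx₃ : x ∈ e₃.source) :
    (fderiv ℝ (fun z => e₃ (e₁.symm z)) (e₁ x)).det =
      (fderiv ℝ (fun z => e₃ (e₂.symm z)) (e₂ x)).det *
        (fderiv ℝ (fun z => e₂ (e₁.symm z)) (e₁ x)).det := by
  rw [fderiv_transition_comp h₁ h₂ h₃ hx₁ hx₂ hx₃]
  exact LinearMap.det_comp _ _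

theorem det_fderiv_transition_ne_zero {e₁ e₂ : OpenPartialHomeomorph X (Rn n)}
    (h₁ : e₁ ∈ SmoothCharts n X) (h₂ : e₂ ∈ SmoothCharts n X) {x : X}
    (hx₁ : x ∈ e₁.source) (hx₂ : x ∈ e₂.source) :
    (fderiv ℝ (fun z => e₂ (e₁.symm z)) (e₁ x)).det ≠ 0 := by
  intro h0
  have h := det_fderiv_transition_comp h₁ h₂ h₁ hx₁ hx₂ hx₁
  rw [h0, mul_zero] at h
  have h3 : (fun z => e₁ (e₁.symm z)) =ᶠ[nhds (e₁ x)] id := by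
    filter_upwards [e₁.open_target.mem_nhds (e₁.map_source hx₁)] with z hz using e₁.right_inv hz
  rw [h3.fderiv_eq, fderiv_id, ContinuousLinearMap.det] at h
  simp at h

/-- Near a point, a chart is either compatible with the orientation or reverses it. -/
theorem OrientedAtlas.exists_sign (𝒪 : OrientedAtlas n X) {e : OpenPartialHomeomorph X (Rn n)}
    (he : e ∈ SmoothCharts n X) {x : X} (hx : x ∈ e.source) :
    ∃ (ε : ℝ) (N : Opens X), x ∈ N ∧ (N : Set X) ⊆ e.source ∧ (ε = 1 ∨ ε = -1) ∧
      ∀ e' ∈ 𝒪.charts, ∀ x' ∈ N, x' ∈ e'.source →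
        |(fderiv ℝ (fun z => e (e'.symm z)) (e' x')).det| =
          ε * (fderiv ℝ (fun z => e (e'.symm z)) (e' x')).det := by
  obtain ⟨e₀, he₀, hx₀⟩ := 𝒪.cover x
  have hs := 𝒪.subset he₀
  set f : X → ℝ := fun x' => (fderiv ℝ (fun z => e (e₀.symm z)) (e₀ x')).det with hf
  have hc : ContinuousOn f (e₀.source ∩ e.source) := by
    have h1 : ContinuousOn (fun y => (fderiv ℝ (fun z => e (e₀.symm z)) y).det)
        (e₀.target ∩ e₀.symm ⁻¹' e.source) :=
      contDiff_clm_det.continuous.comp_continuousOn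
        ((contDiffOn_transition hs he).continuousOn_fderiv_of_isOpen (isOpen_overlap e₀ e)
          (by simp))
    refine h1.comp (e₀.continuousOn.mono Set.inter_subset_left) fun z hz =>
      ⟨e₀.map_source hz.1, ?_⟩
    rw [Set.mem_preimage, e₀.left_inv hz.1]
    exact hz.2
  have hO : IsOpen (e₀.source ∩ e.source) := e₀.open_source.inter e.open_source
  have hne : f x ≠ 0 := det_fderiv_transition_ne_zero hs he hx₀ hx
  obtain ⟨ε, hε, hpos⟩ : ∃ ε : ℝ, (ε = 1 ∨ ε = -1) ∧ 0 < ε * f x := by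
    rcases hne.lt_or_gt with h | h
    · exact ⟨-1, Or.inr rfl, by linarith⟩
    · exact ⟨1, Or.inl rfl, by linarith⟩
  refine ⟨ε, ⟨_, (continuousOn_const.mul hc).isOpen_inter_preimage hO
    (isOpen_Ioi (a := (0 : ℝ)))⟩, ⟨⟨hx₀, hx⟩, hpos⟩, fun z hz => hz.1.2, hε, ?_⟩
  rintro e' he' x' ⟨⟨hx'₀, hx'e⟩, hp⟩ hx'
  have h1 := det_fderiv_transition_comp (𝒪.subset he') hs he hx' hx'₀ hx'e
  have h2 := 𝒪.det_pos e' he' e₀ he₀ x' ⟨hx', hx'₀⟩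
  have h3 : 0 < ε * (fderiv ℝ (fun z => e (e'.symm z)) (e' x')).det := by
    rw [h1, ← mul_assoc]
    exact mul_pos hp h2
  have h4 : |ε| = 1 := by rcases hε with rfl | rfl <;> simp
  rw [← abs_of_pos h3, abs_mul, h4, one_mul]

omit [ChartedSpace (Rn n) X] [IsManifold 𝓘(ℝ, Rn n) ∞ X] in
theorem injOn_transition {e e' : OpenPartialHomeomorph X (Rn n)} :
    Set.InjOn (fun z => e (e'.symm z)) (e'.target ∩ e'.symm ⁻¹' e.source) := by
  intro y hy z hz h
  have h1 := e.injOn hy.2 hz.2 h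
  rw [← e'.right_inv hy.1, h1, e'.right_inv hz.1]

/-- A current which in a chart is given by a smooth density is a smooth form. -/
theorem CurrentSubsheaf.mem_of_density {𝒪 : OrientedAtlas n X} {hkm : k + m = n}
    {B : CurrentSubsheaf n 𝕜 X m} (hB : B.ContainsSmoothForms 𝒪 hkm)
    {e : OpenPartialHomeomorph X (Rn n)} (he : e ∈ SmoothCharts n X) {V : Opens X}
    (hV : (V : Set X) ⊆ e.source) (D : Current n 𝕜 m V)
    {L : Rn n → ((Rn n) [⋀^Fin m]→L[ℝ] 𝕜) →L[ℝ] 𝕜}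
    (hL : ContDiff ℝ ∞ L) (hLs : ∀ y (r : 𝕜) a, L y (r • a) = r * L y a)
    (hD : ∀ φ : TestForm n 𝕜 m V, D.1 φ = ∫ y, L y (φ.1.local e y)) : D ∈ B.sections V := by
  refine B.of_locally fun x hx => ?_
  obtain ⟨ε, N, hxN, hNe, hε, hsign⟩ := 𝒪.exists_sign he (hV hx)
  refine ⟨V ⊓ N, inf_le_left, ⟨hx, hxN⟩, ?_⟩
  obtain ⟨Q, hQ⟩ := exists_wedgeCoeff_linear (𝕜 := 𝕜) hkm
  set s : 𝕜 := (-1) ^ (k + 1).choose 2 with hs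
  have hss : s * s = 1 := by rw [hs, ← mul_pow]; simp
  -- the form whose wedge products with test forms give the density
  let a : Rn n → (Rn n) [⋀^Fin k]→L[ℝ] 𝕜 := fun y => (s * (ε : 𝕜)) • Q (L y)
  have ha : ContDiff ℝ ∞ a := (Q.contDiff.comp hL).const_smul (s * (ε : 𝕜))
  have haw : ∀ y b, wedgeCoeff hkm (a y) b = s * ε * L y b := fun y b => by
    rw [wedgeCoeff_smul_left, hQ _ (hLs y)]
  refine hB (V ⊓ N) _ (DForm.ofChart e a) (fun e' he' => ?_) fun e' he' β hβ => ?_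
  · refine fun y hy => ContDiffAt.contDiffWithinAt ?_
    have hy2 : e'.symm y ∈ e.source := hV hy.2.1
    refine DForm.contDiffAt_inChart_of_chart he' he ⟨hy.1, hy2⟩ ?_
    refine ha.contDiffAt.congr_of_eventuallyEq ?_
    filter_upwards [e.open_target.mem_nhds (e.map_source hy2)] with z hz
    exact DForm.inChart_ofChart he a hz
  · have he's := 𝒪.subset he'
    obtain ⟨K, hK, hKe', hβK⟩ := hβ
    obtain ⟨K', hK', hKV, hβK'⟩ := β.2.2
    set S : Set (Rn n) := e'.target ∩ e'.symm ⁻¹' (V ⊓ N : Opens X) with hSdef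
    have hSo : IsOpen S := e'.symm.isOpen_inter_preimage (V ⊓ N).isOpen
    have hSsub : S ⊆ e'.target ∩ e'.symm ⁻¹' e.source := fun z hz => ⟨hz.1, hV hz.2.1⟩
    have h1 : (Current.res inf_le_left D).1 β = ∫ y, L y (β.1.local e y) :=
      hD (TestForm.extend inf_le_left β)
    have h2 : ∫ y, L y (β.1.local e y) =
        ∫ y in (fun z => e (e'.symm z)) '' S, L y (β.1.local e y) := by
      refine (setIntegral_eq_integral_of_forall_compl_eq_zero fun y hy => ?_).symm
      have : β.1.local e y = 0 := by
        refine DForm.local_eq_zero (K := K ∩ K') (fun x hx => ?_) ?_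
        · by_cases h : x ∈ K
          · exact hβK' x fun h' => hx ⟨h, h'⟩
          · exact hβK x h
        · rintro ⟨x, ⟨hx, hx'⟩, rfl⟩
          refine hy ⟨e' x, ⟨e'.map_source (hKe' hx), ?_⟩, ?_⟩
          · rw [Set.mem_preimage, e'.left_inv (hKe' hx)]
            exact hKV hx'
          · simp only [e'.left_inv (hKe' hx)]
      rw [this, map_zero]
    rw [h1, h2, integral_image_eq_integral_abs_det_fderiv_smul volume hSo.measurableSet
      (f' := fderiv ℝ fun z => e (e'.symm z)) (fun z hz =>
        ((DForm.contDiffAt_transition he's he (hSsub hz).1 (hSsub hz).2).differentiableAt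
          (by simp)).hasFDerivAt.hasFDerivWithinAt) (injOn_transition.mono hSsub)]
    have h3 : ∫ y in e'.target, wedgeCoeff hkm ((DForm.ofChart e a).inChart e' y)
        (β.1.inChart e' y) = ∫ y in S, wedgeCoeff hkm ((DForm.ofChart e a).inChart e' y)
        (β.1.inChart e' y) := by
      refine setIntegral_eq_of_subset_of_forall_sdiff_eq_zero e'.open_target.measurableSet
        Set.inter_subset_left fun y hy => ?_
      have : β.1.inChart e' y = 0 := DForm.inChart_of_eq_zero e' (hβK' _ fun h =>
        hy.2 ⟨hy.1, hKV h⟩)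
      rw [this]
      have h0 := wedgeCoeff_smul_right hkm (0 : 𝕜) ((DForm.ofChart e a).inChart e' y)
        (0 : (Rn n) [⋀^Fin m]→L[ℝ] 𝕜)
      rw [zero_mul] at h0
      refine Eq.trans (congrArg _ ?_) h0
      exact (zero_smul 𝕜 (0 : (Rn n) [⋀^Fin m]→L[ℝ] 𝕜)).symm
    rw [h3, ← integral_const_mul]
    refine setIntegral_congr_fun hSo.measurableSet fun z hz => ?_
    have hz1 := (hSsub hz).1
    have hz2 : e'.symm z ∈ e.source := (hSsub hz).2
    have hzt := e.map_source hz2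
    have h4 := hsign e' he' (e'.symm z) hz.2.2 (e'.map_target hz1)
    rw [e'.right_inv hz1] at h4
    beta_reduce
    rw [DForm.inChart_change _ he's he hz1 hz2, DForm.inChart_change β.1 he's he hz1 hz2,
      wedgeCoeff_pullback, DForm.inChart_ofChart he a hzt, haw, DForm.local_eq _ hzt, h4,
      RCLike.real_smul_eq_coe_mul, RCLike.real_smul_eq_coe_mul, RCLike.ofReal_mul]
    linear_combination (-(ε : 𝕜) * ((fderiv ℝ (fun z => e (e'.symm z)) z).det : 𝕜) *
      L (e (e'.symm z)) (β.1.inChart e (e (e'.symm z)))) * hss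

/-- A current with a smooth density has a smooth derivative, and hence belongs to the preimage of
every sheaf of currents which contains the smooth forms. -/
theorem CurrentSubsheaf.mem_dPreimage_of_density [T2Space X] {𝒪 : OrientedAtlas n X}
    {hkm : k + m = n}
    {B : CurrentSubsheaf n 𝕜 X m} (hB : B.ContainsSmoothForms 𝒪 hkm)
    {e : OpenPartialHomeomorph X (Rn n)} (he : e ∈ SmoothCharts n X) {V : Opens X}
    (hV : (V : Set X) ⊆ e.source) (T : Current n 𝕜 (m + 1) V)
    {L : Rn n → ((Rn n) [⋀^Fin (m + 1)]→L[ℝ] 𝕜) →L[ℝ] 𝕜}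
    (hL : ContDiff ℝ ∞ L) (hLs : ∀ y (r : 𝕜) a, L y (r • a) = r * L y a)
    (hT : ∀ φ : TestForm n 𝕜 (m + 1) V, T.1 φ = ∫ y, L y (φ.1.local e y)) :
    T ∈ B.dPreimage V := by
  obtain ⟨L', h1, h2, h3⟩ := exists_adjoint_extDeriv hL hLs
  refine CurrentSubsheaf.mem_dPreimage.2 (B.mem_of_density hB he hV T.d h1 h2 fun φ => ?_)
  obtain ⟨K, hK, hKV, hφ⟩ := φ.2.2
  have hKe := hKV.trans hV
  rw [← h3 _ (φ.contDiff_local he hK hKe hφ)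
    (HasCompactSupport.intro (isCompact_chart_image hK hKe) fun y hy => DForm.local_eq_zero hφ hy)]
  refine (hT (TestForm.d φ)).trans ?_
  rw [TestForm.local_d he hV]

end Density

/-! ### The vanishing locus of a current -/

section Vanishing

variable {n m : ℕ} {𝕜 : Type} [RCLike 𝕜] {X : Type u} [TopologicalSpace X]
  [ChartedSpace (Rn n) X] {U : Opens X}

/-- The current `T` is zero near `x`. -/
def Current.VanishesAt (T : Current n 𝕜 m U) (x : X) : Prop :=
  ∃ (O : Opens X) (h : O ≤ U), x ∈ O ∧ Current.res h T = 0

theorem Current.VanishesAt.res {T : Current n 𝕜 m U} {x : X} (hT : T.VanishesAt x) {V : Opens X}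
    (h : V ≤ U) (hx : x ∈ V) : (Current.res h T).VanishesAt x := by
  obtain ⟨O, hO, hxO, h0⟩ := hT
  refine ⟨V ⊓ O, inf_le_left, ⟨hx, hxO⟩, ?_⟩
  change Current.res (inf_le_right : V ⊓ O ≤ O) (Current.res hO T) = 0
  rw [h0, map_zero]

theorem Current.VanishesAt.of_res {T : Current n 𝕜 m U} {x : X} {V : Opens X} {h : V ≤ U}
    (hT : (Current.res h T).VanishesAt x) : T.VanishesAt x := by
  obtain ⟨O, hO, hxO, h0⟩ := hT
  exact ⟨O, hO.trans h, hxO, h0⟩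

theorem Current.VanishesAt.of_res_eq {T : Current n 𝕜 m U} {x : X} (hT : T.VanishesAt x)
    {U' V : Opens X} {h : V ≤ U} {T' : Current n 𝕜 m U'} {h' : V ≤ U'}
    (hTT' : Current.res h' T' = Current.res h T) (hx : x ∈ V) : T'.VanishesAt x := by
  have h1 := hT.res h hx
  rw [← hTT'] at h1
  exact h1.of_res

theorem Current.eventually_vanishesAt {T : Current n 𝕜 m U} {x : X} (hT : T.VanishesAt x) :
    ∀ᶠ y in nhds x, T.VanishesAt y := by
  obtain ⟨O, hO, hxO, h0⟩ := hT
  filter_upwards [O.isOpen.mem_nhds hxO] with y hy using ⟨O, hO, hy, h0⟩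

variable [IsManifold 𝓘(ℝ, Rn n) ∞ X] [T2Space X]

theorem CurrentSubsheaf.mem_dPreimage_of_pair {B : CurrentSubsheaf n 𝕜 X m} {U V W : Opens X}
    (hU : U ≤ W) (hV : V ≤ W) (hW : (W : Set X) ⊆ U ∪ V) {T : Current n 𝕜 (m + 1) W}
    (h : Current.res hU T ∈ B.dPreimage U) (h' : Current.res hV T ∈ B.dPreimage V) :
    T ∈ B.dPreimage W := by
  refine CurrentSubsheaf.mem_dPreimage_of_locally fun x hx => ?_
  rcases hW hx with hx | hx
  · exact ⟨U, hU, hx, h⟩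
  · exact ⟨V, hV, hx, h'⟩

omit [IsManifold 𝓘(ℝ, Rn n) ∞ X] in
theorem Current.VanishesAt.mulExt {T : Current n 𝕜 m U} {x : X} (hT : T.VanishesAt x)
    (χ : SmoothFun n X) (h : tsupport χ ∩ U ⊆ U) : (Current.mulExt χ h T).VanishesAt x := by
  obtain ⟨O, hO, hxO, h0⟩ := hT
  refine ⟨O, hO, hxO, Current.ext fun φ => ?_⟩
  exact congrArg (fun S : Current n 𝕜 m O => S.1 (TestForm.mulExt χ Set.inter_subset_right φ)) h0

omit [IsManifold 𝓘(ℝ, Rn n) ∞ X] in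
theorem Current.vanishesAt_mulExt_of_eq_zero (T : Current n 𝕜 m U) {χ : SmoothFun n X}
    (h : tsupport χ ∩ U ⊆ U) {O : Opens X} (hO : O ≤ U) {x : X} (hx : x ∈ O)
    (hχ : ∀ y ∈ O, χ y = 0) : (Current.mulExt χ h T).VanishesAt x := by
  refine ⟨O, hO, hx, Current.ext fun φ => ?_⟩
  obtain ⟨K, hK, hKO, hφ⟩ := φ.2.2
  have h0 : TestForm.mulExt χ h (TestForm.extend hO φ) = 0 := TestForm.ext fun y =>
    TestForm.mulExt_eq_zero χ h _ <| by
      by_cases hy : y ∈ K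
      · exact Or.inl (hχ y (hKO hy))
      · exact Or.inr (hφ y hy)
  exact (congrArg T.1 h0).trans (map_zero T.1)

omit [IsManifold 𝓘(ℝ, Rn n) ∞ X] in
theorem Current.res_mulExt_of_eq_one (T : Current n 𝕜 m U) {χ : SmoothFun n X}
    (h : tsupport χ ∩ U ⊆ U) {O : Opens X} (hO : O ≤ U)
    (hχ : ∀ y ∈ O, χ y = 1) : Current.res hO (Current.mulExt χ h T) = Current.res hO T := by
  refine Current.ext fun φ => ?_
  obtain ⟨K, hK, hKO, hφ⟩ := φ.2.2
  have h0 : TestForm.mulExt χ h (TestForm.extend hO φ) = TestForm.extend hO φ :=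
    TestForm.ext fun y => TestForm.mulExt_eq_self χ h _ <| by
      by_cases hy : y ∈ K
      · exact Or.inl (hχ y (hKO hy))
      · exact Or.inr (hφ y hy)
  exact congrArg T.1 h0

variable [SigmaCompactSpace X]

theorem Current.eq_zero_of_vanishesAt {T : Current n 𝕜 m U} (h : ∀ x ∈ U, T.VanishesAt x) :
    T = 0 := by
  choose O hO hxO h0 using h
  refine Current.ext_of_cover (ι := U) (fun x => O x.1 x.2) (fun x => hO x.1 x.2)
    (fun x hx => Set.mem_iUnion.2 ⟨⟨x, hx⟩, hxO x hx⟩) fun x => ?_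
  rw [h0, map_zero]

theorem Current.apply_eq_zero_of_vanishesAt {T : Current n 𝕜 m U} {V : Opens X} (hV : V ≤ U)
    (h : ∀ x ∈ V, T.VanishesAt x) (φ : TestForm n 𝕜 m U) (hφ : φ.1.CompactlySupportedIn V) :
    T.1 φ = 0 := by
  have h0 : Current.res hV T = 0 := Current.eq_zero_of_vanishesAt fun x hx => (h x hx).res hV hx
  exact congrArg (fun S : Current n 𝕜 m V => S.1 ⟨φ.1, φ.2.1, hφ⟩) h0

theorem Current.exists_glue_pair {U V W : Opens X} (hU : U ≤ W) (hV : V ≤ W)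
    (hW : (W : Set X) ⊆ U ∪ V) (S : Current n 𝕜 m U) (T : Current n 𝕜 m V)
    (h : Current.res (inf_le_left : U ⊓ V ≤ U) S = Current.res (inf_le_right : U ⊓ V ≤ V) T) :
    ∃ G : Current n 𝕜 m W, Current.res hU G = S ∧ Current.res hV G = T := by
  let U' : ULift.{u} Bool → Opens X := fun i => Bool.rec V U i.down
  let T' : ∀ i, Current n 𝕜 m (U' i) := fun i => match i with
    | ⟨true⟩ => S
    | ⟨false⟩ => T
  obtain ⟨G, hG⟩ := Current.exists_glue U' T' <| by
    rintro ⟨_ | _⟩ ⟨_ | _⟩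
    · rfl
    · exact Current.ext fun φ =>
        (congrArg (fun R : Current n 𝕜 m (U ⊓ V) =>
          R.1 (TestForm.extend (inf_comm V U).le φ)) h).symm
    · exact h
    · rfl
  have hWU : W ≤ iSup U' := fun x hx => by
    rcases hW hx with h | h
    · exact Opens.mem_iSup.2 ⟨⟨true⟩, h⟩
    · exact Opens.mem_iSup.2 ⟨⟨false⟩, h⟩
  exact ⟨Current.res hWU G, hG ⟨true⟩, hG ⟨false⟩⟩

end Vanishing

namespace SmearData

variable {n m k : ℕ} {𝕜 : Type} [RCLike 𝕜] {X : Type u} [TopologicalSpace X]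
  [ChartedSpace (Rn n) X] [IsManifold 𝓘(ℝ, Rn n) ∞ X] [T2Space X]
  {e : OpenPartialHomeomorph X (Rn n)} {U : Opens X} (s : SmearData e U)

/-- Where the flow does not move anything, the smear is the identity. -/
theorem res_smear_eq_self (hρ : ∫ t, s.ρ t = 1) {O : Opens X} (hO : O ≤ U)
    (hfix : ∀ x ∈ O, ∀ i, e x i ∉ Set.Ioo (s.c i) (s.d i)) (T : Current n 𝕜 m U) :
    Current.res hO (s.smear T) = Current.res hO T := by
  refine Current.ext fun φ => congrArg T.1 (Subtype.ext ?_)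
  obtain ⟨K, hK, hKO, hφ⟩ := φ.2.2
  have hKe : K ⊆ e.source := (hKO.trans hO).trans s.subset_source
  have hz : ∀ (ψ : TestForm n 𝕜 m U), ∀ x ∉ e.source, ψ.1 x = 0 := fun ψ x hx => by
    obtain ⟨K, hK, hKU, hψ⟩ := ψ.2.2
    exact hψ x fun h => hx (s.subset_source (hKU h))
  refine DForm.ext_inChart s.isNBox.chart (fun y hy => ?_) (hz _) (hz _)
  refine (s.inChart_smearTest (TestForm.extend hO φ) hy).trans ?_
  rw [← DForm.local_eq (TestForm.extend hO φ).1 hy]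
  have hfix' : ∀ t, ∀ y ∈ e.target ∩ e.symm ⁻¹' O, s.flow t y = y := fun t y hy => by
    refine backFlow_eq_self s.lt (fun i => ?_) t
    have := hfix _ hy.2 i
    rwa [e.right_inv hy.1] at this
  by_cases hyO : e.symm y ∈ O
  · exact pullbackIntegral_eq_self (e.symm.isOpen_inter_preimage O.isOpen) hfix' hρ ⟨hy, hyO⟩
  · have hyK : y ∉ e '' K := by
      rintro ⟨x, hx, rfl⟩
      rw [e.left_inv (hKe hx)] at hyO
      exact hyO (hKO hx)
    have h0 : (TestForm.extend hO φ).1.local e y = 0 := DForm.local_eq_zero hφ hyK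
    rw [h0]
    refine s.smearForm_eq_zero (S := e '' K) (fun z hz => DForm.local_eq_zero hφ hz) ?_
    rintro ⟨⟨t, z⟩, ⟨_, hzK⟩, hzy⟩
    obtain ⟨x, hx, rfl⟩ := hzK
    have h1 : s.flow (-t) (e x) = e x := hfix' _ _ ⟨e.map_source (hKe hx), by
      rw [Set.mem_preimage, e.left_inv (hKe hx)]
      exact hKO hx⟩
    refine hyK ⟨x, hx, ?_⟩
    rw [← h1]
    exact hzy

/-- The germ of the smear at a point depends only on the germs of the current at the points which
the flow reaches. -/
theorem vanishesAt_smear [SigmaCompactSpace X] {T : Current n 𝕜 m U} {x : X} (hx : x ∈ U)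
    (h : ∀ t ∈ tsupport s.ρ, T.VanishesAt (e.symm (s.flow (-t) (e x)))) :
    (s.smear T).VanishesAt x := by
  have hxe := s.subset_source hx
  have hbox : ∀ z ∈ U, ∀ t, s.flow t (e z) ∈ openBox s.a s.b := fun z hz t =>
    (s.flow_mem_iff _ _).2 (s.image_subset Set.Subset.rfl ⟨z, hz, rfl⟩)
  let Z : Opens X := ⟨{z | z ∈ U ∧ T.VanishesAt z}, isOpen_iff_eventually.2 fun z hz =>
    (U.isOpen.eventually_mem hz.1).and (Current.eventually_vanishesAt hz.2)⟩
  have hev : ∀ᶠ z in nhds x, ∀ t ∈ tsupport s.ρ, T.VanishesAt (e.symm (s.flow (-t) (e z))) := by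
    refine s.hasCompactSupport.isCompact.eventually_forall_of_forall_eventually fun t ht => ?_
    have hc : ContinuousAt (fun p : X × Rn n => e.symm (s.flow (-p.2) (e p.1))) (x, t) := by
      have h1 : ContinuousAt (fun p : X × Rn n => e p.1) (x, t) :=
        (e.continuousAt hxe).comp_of_eq continuousAt_fst rfl
      have h2 : ContinuousAt (fun p : X × Rn n => s.flow (-p.2) (e p.1)) (x, t) :=
        s.contDiff_flow.continuous.continuousAt.comp_of_eq
          (f := fun p : X × Rn n => (-p.2, e p.1)) (continuousAt_snd.neg.prodMk h1) rfl
      exact (e.symm.continuousAt (s.box_subset (hbox x hx (-t)))).comp_of_eq h2 rfl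
    exact hc.eventually (Current.eventually_vanishesAt (h t ht))
  obtain ⟨O, hO, hOo, hxO⟩ := eventually_nhds_iff.1 (hev.and (U.isOpen.mem_nhds hx))
  refine ⟨⟨O, hOo⟩, fun z hz => (hO z hz).2, hxO, Current.ext fun φ => ?_⟩
  obtain ⟨K, hK, hKO, hφ⟩ := φ.2.2
  have hKU : K ⊆ U := fun z hz => (hO z (hKO hz)).2
  refine Current.apply_eq_zero_of_vanishesAt (V := Z) (fun z hz => hz.1) (fun z hz => hz.2) _
    ⟨_, s.isCompact_spread_image hK hKU, ?_, s.smearTest_eq_zero _ hK hKU hφ⟩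
  rintro _ ⟨_, ⟨⟨t, _⟩, ⟨ht, z, hz, rfl⟩, rfl⟩, rfl⟩
  have h1 := hbox z (hKU hz) (-t)
  exact ⟨(s.mem_iff (s.box_subset h1)).2 h1, (hO z (hKO hz)).1 t ht⟩

/-- Inside the box of the flow, products of a smear with smooth functions are smooth. -/
theorem exists_res_mulExt_smear_mem {𝒪 : OrientedAtlas n X} {hkm : k + m = n}
    {B : CurrentSubsheaf n 𝕜 X m} (hB : B.ContainsSmoothForms 𝒪 hkm)
    (T : Current n 𝕜 (m + 1) U) (χ : SmoothFun n X) (hχ : tsupport χ ∩ U ⊆ U) {x : X} (hx : x ∈ U)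
    (hxD : e x ∈ openBox s.c s.d) : ∃ (V : Opens X) (hV : V ≤ U), x ∈ V ∧
      Current.res hV (Current.mulExt χ hχ (s.smear T)) ∈ B.dPreimage V := by
  have hxe := s.subset_source hx
  have hD : openBox s.c s.d ⊆ e.target := s.box_le.trans s.box_subset
  obtain ⟨r, hr, hrD⟩ := Metric.nhds_basis_closedBall.mem_iff.1
    ((isOpen_openBox s.c s.d).mem_nhds hxD)
  let b : ContDiffBump (e x) := ⟨r / 2, r, by positivity, by linarith⟩
  have hbs : tsupport b = Metric.closedBall (e x) r := b.tsupport_eq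
  -- the product of the smear with `χ` only matters near `x`, which permits a compact support
  let κ : Rn n → ℝ := fun y => b y * χ (e.symm y)
  have hκs : tsupport κ ⊆ Metric.closedBall (e x) r := by
    rw [← hbs]
    exact closure_mono fun y hy => left_ne_zero_of_mul hy
  have hκ : ContDiff ℝ ∞ κ := by
    refine contDiff_iff_contDiffAt.2 fun y => ?_
    by_cases hy : y ∈ e.target
    · exact b.contDiff.contDiffAt.mul
        ((χ.contDiffOn s.isNBox.chart).contDiffAt (e.open_target.mem_nhds hy))
    · have h1 : y ∉ tsupport κ := fun h => hy (hD (hrD (hκs h)))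
      refine (contDiffAt_const (c := 0)).congr_of_eventuallyEq ?_
      filter_upwards [(isClosed_tsupport κ).isOpen_compl.mem_nhds h1] with z hz
      exact image_eq_zero_of_notMem_tsupport hz
  obtain ⟨L, hL, hLs, hLT⟩ := s.exists_density hκ
    ((isCompact_closedBall _ _).of_isClosed_subset (isClosed_tsupport κ) hκs) (hκs.trans hrD) T
  let V : Opens X := ⟨e.source ∩ e ⁻¹' Metric.ball (e x) (r / 2),
    e.isOpen_inter_preimage Metric.isOpen_ball⟩
  have hV : V ≤ U := fun z (hz : z ∈ e.source ∩ e ⁻¹' Metric.ball (e x) (r / 2)) => by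
    have h1 : e z ∈ openBox s.a s.b := s.box_le (hrD (Metric.ball_subset_closedBall
      (Metric.ball_subset_ball (by linarith) hz.2)))
    have h2 := (s.mem_iff (e.map_source hz.1)).2 h1
    rwa [e.left_inv hz.1] at h2
  refine ⟨V, hV, ⟨hxe, Metric.mem_ball_self (by positivity)⟩, ?_⟩
  refine CurrentSubsheaf.mem_dPreimage_of_density hB s.isNBox.chart Set.inter_subset_left _ hL hLs
    fun φ => ?_
  refine hLT (TestForm.extend hV φ) (TestForm.mulExt χ hχ (TestForm.extend hV φ)) fun y => ?_
  obtain ⟨K, hK, hKV, hφ⟩ := φ.2.2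
  by_cases hy : y ∈ e.target
  · rw [DForm.local_eq _ hy, DForm.local_eq _ hy]
    refine (DForm.inChart_mul χ φ.1 e y).trans ?_
    by_cases hyK : e.symm y ∈ K
    · have h1 : b y = 1 := b.one_of_mem_closedBall (by
        have := (hKV hyK).2
        rw [Set.mem_preimage, e.right_inv hy] at this
        exact Metric.ball_subset_closedBall this)
      change _ = (b y * χ (e.symm y)) • φ.1.inChart e y
      rw [h1, one_mul]
    · have h0 : φ.1.inChart e y = 0 := DForm.inChart_of_eq_zero e (hφ _ hyK)
      change _ = κ y • φ.1.inChart e y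
      rw [h0]
      exact (smul_zero (M := ℝ) (A := (Rn n) [⋀^Fin (m + 1)]→L[ℝ] 𝕜) _).trans
        (smul_zero (M := ℝ) (A := (Rn n) [⋀^Fin (m + 1)]→L[ℝ] 𝕜) _).symm
  · have h0 : ∀ η : DForm n 𝕜 X (m + 1), η.local e y = 0 := fun η => Set.indicator_of_notMem hy _
    rw [h0, h0]
    exact (smul_zero (M := ℝ) (A := (Rn n) [⋀^Fin (m + 1)]→L[ℝ] 𝕜) _).symm

end SmearData

/-- For small parameters the flow does not move a compact set out of a given neighbourhood. -/
theorem eventually_backFlow {n : ℕ} {c d : Fin n → ℝ} (hcd : ∀ i, c i < d i) {K Z : Set (Rn n)}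
    (hK : IsCompact K) (hZ : IsOpen Z) (hKZ : K ⊆ Z) :
    ∀ᶠ t in nhds (0 : Rn n), ∀ y ∈ K, backFlow c d t y ∈ Z := by
  refine hK.eventually_forall_of_forall_eventually fun y hy => ?_
  have h0 : Function.uncurry (backFlow c d) (0, y) = y := by
    ext i
    obtain ⟨σ, -, -, -, h⟩ := isIntervalFlow_ioFlow (hcd i)
    exact (congrArg (ioFlow (c i) (d i) (y i)) (neg_zero (G := ℝ))).trans (h (y i)).1
  refine (contDiff_backFlow c d).continuous.continuousAt.eventually ?_
  rw [h0]
  exact hZ.mem_nhds (hKZ hy)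

/-! ### Cutting off along a hyperplane -/

section Wall

variable {n m k : ℕ} {𝕜 : Type} [RCLike 𝕜] {X : Type u} [TopologicalSpace X]
  [ChartedSpace (Rn n) X] [IsManifold 𝓘(ℝ, Rn n) ∞ X] [T2Space X]

/-- The open set of the points whose coordinates in the chart `e` lie in the open set `A`. -/
def chartOpen (e : OpenPartialHomeomorph X (Rn n)) {A : Set (Rn n)} (hA : IsOpen A) : Opens X :=
  ⟨e.source ∩ e ⁻¹' A, e.isOpen_inter_preimage hA⟩

omit [IsManifold 𝓘(ℝ, Rn n) ∞ X] [T2Space X] in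
theorem isNBox_chartOpen {e : OpenPartialHomeomorph X (Rn n)} (he : e ∈ SmoothCharts n X)
    {a b : Fin n → ℝ} (hab : ∀ i, a i < b i) (h : closedBox a b ⊆ e.target) :
    IsNBox e a b (chartOpen e (isOpen_openBox a b)) where
  chart := he
  lt := hab
  closedBox_subset := h
  eq_image := (e.symm_image_eq_source_inter_preimage fun _ hy =>
    h fun i => ⟨(hy i).1.le, (hy i).2.le⟩).symm

/-- The weights of the smears in use. The sign fits the flow for the parameter `-t`. -/
theorem exists_bump_integral_one {Z : Set (Rn n)} (hZ : Z ∈ nhds (0 : Rn n)) :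
    ∃ ρ : Rn n → ℝ, ContDiff ℝ ∞ ρ ∧ HasCompactSupport ρ ∧ ∫ t, ρ t = 1 ∧
      ∀ t ∈ tsupport ρ, -t ∈ Z := by
  obtain ⟨r, hr, hrZ⟩ := Metric.nhds_basis_closedBall.mem_iff.1 hZ
  let b : ContDiffBump (0 : Rn n) := ⟨r / 2, r, by positivity, by linarith⟩
  refine ⟨b.normed volume, b.contDiff_normed, b.hasCompactSupport_normed, b.integral_normed,
    fun t ht => hrZ ?_⟩
  rw [b.tsupport_normed_eq] at ht
  simpa using ht

variable [SigmaCompactSpace X]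

/-- Let `T` be a current whose derivative belongs to `B`. If all coordinates are close to the
coordinate `zᵢ` on `V`, then `T` can be cut off on `V` along the hypersurface `zᵢ = s`: a smear in
a box around the hypersurface is smooth near the hypersurface and is equal to `T` away from it. -/
theorem exists_cut_hyperplane {𝒪 : OrientedAtlas n X} {hkm : k + m = n}
    {B : CurrentSubsheaf n 𝕜 X m} (hB : B.ContainsSmoothForms 𝒪 hkm) (hB' : B.ClosedUnderSmears)
    {e : OpenPartialHomeomorph X (Rn n)} (he : e ∈ SmoothCharts n X) (i : Fin n) {s η : ℝ}
    (hη : 0 < η) {Ω V : Opens X} (hV : V ≤ Ω) {C : Set X} (hC : IsCompact C) (hCe : C ⊆ e.source)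
    (hVC : (V : Set X) ⊆ C) (hclose : ∀ x ∈ V, ∀ j, |e x j - e x i| < η)
    (hbox : closedBox (fun _ => s - 5 * η) (fun _ => s + 5 * η) ⊆ e.target)
    (hU : chartOpen e (isOpen_openBox (fun _ => s - 5 * η) (fun _ => s + 5 * η)) ≤ Ω)
    {T : Current n 𝕜 (m + 1) Ω} (hT : T ∈ B.dPreimage Ω) {K : Set X} (hK : IsClosed K)
    (hTK : ∀ x ∈ K, x ∈ Ω → T.VanishesAt x) :
    ∃ T' ∈ B.dPreimage V, (∀ (O : Opens X) (hO : O ≤ V), (∀ x ∈ O, e x i < s - 3 * η) →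
        Current.res hO T' = Current.res (hO.trans hV) T) ∧
      (∀ x ∈ V, s + η ≤ e x i → T'.VanishesAt x) ∧ ∀ x ∈ K, x ∈ V → T'.VanishesAt x := by
  have hVe : (V : Set X) ⊆ e.source := hVC.trans hCe
  set U := chartOpen e (isOpen_openBox (fun _ : Fin n => s - 5 * η) (fun _ => s + 5 * η)) with hUdef
  have hcd : ∀ _ : Fin n, s - 2 * η < s + 2 * η := fun _ => by linarith
  have hec : ∀ j, ContinuousOn (fun x => e x j) e.source := fun j =>
    (EuclideanSpace.proj (𝕜 := ℝ) j).continuous.comp_continuousOn e.continuousOn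
  -- the parameters of the flow are chosen so small that zeros of `T` on `K` are preserved
  obtain ⟨ρ, hρ, hρc, hρ1, hρK⟩ : ∃ ρ : Rn n → ℝ, ContDiff ℝ ∞ ρ ∧ HasCompactSupport ρ ∧
      ∫ t, ρ t = 1 ∧ ∀ t ∈ tsupport ρ, ∀ x ∈ K, x ∈ C → (∀ j, |e x j - s| ≤ 4 * η) →
        T.VanishesAt
          (e.symm (backFlow (fun _ => s - 2 * η) (fun _ => s + 2 * η) (-t) (e x))) := by
    let K₁ : Set X := K ∩ (C ∩ (fun x j => e x j) ⁻¹' {z | ∀ j, |z j - s| ≤ 4 * η})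
    have hK₁ : IsCompact K₁ := by
      refine hC.of_isClosed_subset (hK.inter (ContinuousOn.preimage_isClosed_of_isClosed
        (continuousOn_pi.2 fun j => (hec j).mono hCe) hC.isClosed ?_)) fun x hx => hx.2.1
      simp only [Set.ofPred_forall]
      exact isClosed_iInter fun j => isClosed_le (by fun_prop) (by fun_prop)
    have hK₁e : K₁ ⊆ e.source := fun x hx => hCe hx.2.1
    obtain ⟨ρ, h1, h2, h3, h4⟩ := exists_bump_integral_one (eventually_backFlow hcd
      (isCompact_chart_image hK₁ hK₁e) (Z := e.target ∩ e.symm ⁻¹' {x | T.VanishesAt x})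
      (e.symm.isOpen_inter_preimage (isOpen_iff_eventually.2 fun z hz =>
        Current.eventually_vanishesAt hz)) (by
          rintro _ ⟨x, hx, rfl⟩
          refine ⟨e.map_source (hK₁e hx), ?_⟩
          rw [Set.mem_preimage, e.left_inv (hK₁e hx)]
          refine hTK x hx.1 (hU ⟨hK₁e hx, fun j => ?_⟩)
          have := abs_le.1 (hx.2.2 j)
          exact ⟨by linarith, by linarith⟩))
    exact ⟨ρ, h1, h2, h3, fun t ht x hxK hxC hx => (h4 t ht (e x) ⟨x, ⟨hxK, hxC, hx⟩, rfl⟩).2⟩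
  let σ : SmearData e U :=
    { a := fun _ => s - 5 * η
      b := fun _ => s + 5 * η
      c := fun _ => s - 2 * η
      d := fun _ => s + 2 * η
      ρ := ρ
      isNBox := isNBox_chartOpen he (fun _ => by linarith) hbox
      le := fun _ => ⟨by linarith, by linarith, by linarith⟩
      contDiff := hρ
      hasCompactSupport := hρc }
  let S := σ.smear (Current.res hU T)
  have hS : S ∈ B.dPreimage U := σ.smear_mem_dPreimage hB' (B.res_mem_dPreimage hU hT)
  have hopen : ∀ {A : Set ℝ}, IsOpen A → IsOpen {z : Rn n | z i ∈ A} := fun hA =>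
    hA.preimage (by fun_prop)
  let Vout : Opens X := V ⊓ chartOpen e (hopen
    (isOpen_lt continuous_const (by fun_prop : Continuous fun r : ℝ => |r - s|) :
      IsOpen {r : ℝ | 3 * η < |r - s|}))
  let Vin : Opens X := V ⊓ chartOpen e (hopen
    (isOpen_lt (by fun_prop : Continuous fun r : ℝ => |r - s|) continuous_const :
      IsOpen {r : ℝ | |r - s| < 4 * η}))
  have hout : ∀ {x}, x ∈ V → 3 * η < |e x i - s| → x ∈ Vout := fun h h' => ⟨h, hVe h, h'⟩
  have hin : ∀ {x}, x ∈ V → |e x i - s| < 4 * η → x ∈ Vin := fun h h' => ⟨h, hVe h, h'⟩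
  have hVinU : Vin ≤ U := fun x hx => ⟨hVe hx.1, fun j => by
    have h1 := abs_lt.1 (hclose x hx.1 j)
    have h2 := abs_lt.1 (show |e x i - s| < 4 * η from hx.2.2)
    exact ⟨by linarith, by linarith⟩⟩
  have hcov : (V : Set X) ⊆ Vout ∪ Vin := fun x hx => by
    rcases lt_or_ge (3 * η) |e x i - s| with h | h
    · exact Or.inl (hout hx h)
    · exact Or.inr (hin hx (by linarith))
  -- on the overlap the coordinate `zᵢ` is further than `3 η` from `s`, and all coordinates are
  -- further than `2 η` from `s`, where the flow is trivial
  obtain ⟨G, hGout, hGin⟩ := Current.exists_glue_pair (inf_le_left : Vout ≤ V)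
    (inf_le_left : Vin ≤ V) hcov (Current.res (inf_le_left.trans hV) T) (Current.res hVinU S) <| by
      refine (σ.res_smear_eq_self hρ1 (O := Vout ⊓ Vin) (inf_le_right.trans hVinU)
        (fun x hx j hj => ?_) (Current.res hU T)).symm
      have h1 := abs_lt.1 (hclose x hx.1.1 j)
      have h2 : 3 * η < |e x i - s| := hx.1.2.2
      have h3 : s - 2 * η < e x j := hj.1
      have h4 : e x j < s + 2 * η := hj.2
      exact absurd h2 (not_lt.2 (abs_le.2 ⟨by linarith, by linarith⟩))
  have hG : G ∈ B.dPreimage V := by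
    refine CurrentSubsheaf.mem_dPreimage_of_pair (inf_le_left : Vout ≤ V)
      (inf_le_left : Vin ≤ V) hcov ?_ ?_
    · rw [hGout]
      exact B.res_mem_dPreimage _ hT
    · rw [hGin]
      exact B.res_mem_dPreimage _ hS
  -- a cut-off function varying only in the strip `|zᵢ - s| ≤ η / 2`, where all coordinates are
  -- within `2 η` of `s`, so that the glued current has a smooth density there
  obtain ⟨χ, hχ0, hχ1, -⟩ := exists_contMDiffMap_zero_one_of_isClosed 𝓘(ℝ, Rn n) (n := ⊤)
    (s := C ∩ (fun x => e x i) ⁻¹' Set.Ici (s + η / 2))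
    (t := C ∩ (fun x => e x i) ⁻¹' Set.Iic (s - η / 2))
    (((hec i).mono hCe).preimage_isClosed_of_isClosed hC.isClosed isClosed_Ici)
    (((hec i).mono hCe).preimage_isClosed_of_isClosed hC.isClosed isClosed_Iic)
    (Set.disjoint_left.2 fun x hx hx' => by
      have h1 : s + η / 2 ≤ e x i := hx.2
      have h2 : e x i ≤ s - η / 2 := hx'.2
      linarith)
  have hχV : tsupport χ ∩ V ⊆ V := Set.inter_subset_right
  -- where `χ` is constant
  have hone : ∀ (O : Opens X) (hO : O ≤ V), (∀ x ∈ O, e x i < s - η / 2) →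
      Current.res hO (Current.mulExt χ hχV G) = Current.res hO G := fun O hO h =>
    G.res_mulExt_of_eq_one hχV hO fun x hx => hχ1 ⟨hVC (hO hx), (h x hx).le⟩
  have hzero : ∀ x ∈ V, s + η / 2 < e x i → (Current.mulExt χ hχV G).VanishesAt x :=
    fun x hx h => G.vanishesAt_mulExt_of_eq_zero hχV
      (O := V ⊓ chartOpen e (hopen (isOpen_Ioi (a := s + η / 2)))) inf_le_left ⟨hx, hVe hx, h⟩
      fun y hy => hχ0 ⟨hVC hy.1, le_of_lt (show s + η / 2 < e y i from hy.2.2)⟩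
  refine ⟨Current.mulExt χ hχV G, ?_, fun O hO h => ?_, fun x hx h => hzero x hx (by linarith),
    fun x hxK hx => ?_⟩
  · refine CurrentSubsheaf.mem_dPreimage_of_locally fun x hx => ?_
    rcases lt_or_ge (e x i) (s - η / 2) with h1 | h1
    · refine ⟨V ⊓ chartOpen e (hopen (isOpen_Iio (a := s - η / 2))), inf_le_left,
        ⟨hx, hVe hx, h1⟩, ?_⟩
      exact (hone _ inf_le_left fun y (hy : y ∈ V ⊓ chartOpen e
        (hopen (isOpen_Iio (a := s - η / 2)))) => hy.2.2) ▸ B.res_mem_dPreimage inf_le_left hG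
    rcases lt_or_ge (s + η / 2) (e x i) with h2 | h2
    · obtain ⟨O, hO, hxO, h0⟩ := hzero x hx h2
      refine ⟨O, hO, hxO, ?_⟩
      rw [h0]
      exact Submodule.zero_mem _
    have hxin : x ∈ Vin := hin hx (abs_lt.2 ⟨by linarith, by linarith⟩)
    obtain ⟨W, hW, hxW, hWB⟩ := σ.exists_res_mulExt_smear_mem hB (Current.res hU T) χ
      Set.inter_subset_right (hVinU hxin) fun j => by
        have h3 := abs_lt.1 (hclose x hx j)
        exact ⟨show s - 2 * η < e x j by linarith, show e x j < s + 2 * η by linarith⟩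
    refine ⟨Vin ⊓ W, inf_le_left.trans inf_le_left, ⟨hxin, hxW⟩, ?_⟩
    have h4 := B.res_mem_dPreimage (inf_le_right : Vin ⊓ W ≤ W) hWB
    refine (congrArg (· ∈ B.dPreimage (Vin ⊓ W)) (Current.ext fun φ => ?_)).mpr h4
    exact congrArg (fun R : Current n 𝕜 (m + 1) Vin => R.1 (TestForm.mulExt χ
      (Set.inter_subset_right) (TestForm.extend inf_le_left φ))) hGin
  · rw [hone O hO fun x hx => by linarith [h x hx]]
    have hOV : O ≤ Vout := fun x hx => hout (hO hx) (lt_of_lt_of_le (by linarith [h x hx])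
      (neg_le_abs _))
    exact congrArg (Current.res hOV) hGout
  · refine Current.VanishesAt.mulExt ?_ χ hχV
    rcases lt_or_ge (3 * η) |e x i - s| with h | h
    · exact (hTK x hxK (hV hx)).of_res_eq hGout (hout hx h)
    · have hxin : x ∈ Vin := hin hx (by linarith)
      refine Current.VanishesAt.of_res_eq (T := S) ?_ hGin hxin
      refine σ.vanishesAt_smear (hVinU hxin) fun t ht => ?_
      have h1 : ∀ j, |e x j - s| ≤ 4 * η := fun j => by
        have h2 := abs_lt.1 (hclose x hx j)
        have h3 := abs_le.1 h
        exact abs_le.2 ⟨by linarith, by linarith⟩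
      refine (hρK t ht x hxK (hVC hx) h1).res hU ?_
      have h5 := (σ.flow_mem_iff (-t) (e x)).2 (σ.image_subset Set.Subset.rfl
        ⟨x, hVinU hxin, rfl⟩)
      exact (σ.mem_iff (σ.box_subset h5)).2 h5

end Wall

/-! ### Cutting off around a point -/

section Cube

variable {n m k : ℕ} {𝕜 : Type} [RCLike 𝕜] {X : Type u} [TopologicalSpace X]
  [ChartedSpace (Rn n) X] [IsManifold 𝓘(ℝ, Rn n) ∞ X]

theorem transHomeomorph_mem_smoothCharts {e : OpenPartialHomeomorph X (Rn n)}
    (he : e ∈ SmoothCharts n X) (h : Rn n ≃ₜ Rn n) (h1 : ContDiff ℝ ∞ h)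
    (h2 : ContDiff ℝ ∞ h.symm) : e.transHomeomorph h ∈ SmoothCharts n X := by
  refine OpenPartialHomeomorph.mem_maximalAtlas_of_contMDiffOn _ ?_ ?_
  · exact h1.contMDiff.comp_contMDiffOn (contMDiffOn_of_mem_maximalAtlas he)
  · exact (contMDiffOn_symm_of_mem_maximalAtlas he).comp h2.contMDiff.contMDiffOn fun _ hz => hz

/-- The linear change of coordinates `zᵢ = σ yᵢ`, `zⱼ = σ yᵢ + ε yⱼ` for `j ≠ i`, where `σ = ± 1`.
For small `ε` all the new coordinates are close to `σ yᵢ`. -/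
def tiltHomeomorph (i : Fin n) {σ ε : ℝ} (hσ : σ * σ = 1) (hε : ε ≠ 0) : Rn n ≃ₜ Rn n where
  toFun y := WithLp.toLp 2 fun j => if j = i then σ * y i else σ * y i + ε * y j
  invFun z := WithLp.toLp 2 fun j => if j = i then σ * z i else (z j - z i) / ε
  left_inv y := by
    ext j
    by_cases h : j = i
    · subst h
      simp [← mul_assoc, hσ]
    · simp [h, hε]
  right_inv z := by
    ext j
    by_cases h : j = i
    · subst h
      simp [← mul_assoc, hσ]
    · simp [h, hε, ← mul_assoc, hσ, mul_div_cancel₀]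
  continuous_toFun := (PiLp.continuous_toLp 2 _).comp (continuous_pi fun j => by
    split_ifs <;> fun_prop)
  continuous_invFun := (PiLp.continuous_toLp 2 _).comp (continuous_pi fun j => by
    split_ifs <;> fun_prop)

section
variable (i : Fin n) {σ ε : ℝ} (hσ : σ * σ = 1) (hε : ε ≠ 0)

theorem tiltHomeomorph_apply (y : Rn n) (j : Fin n) : tiltHomeomorph i hσ hε y j =
    if j = i then σ * y i else σ * y i + ε * y j := rfl

theorem tiltHomeomorph_symm_apply (z : Rn n) (j : Fin n) : (tiltHomeomorph i hσ hε).symm z j =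
    if j = i then σ * z i else (z j - z i) / ε := rfl

theorem contDiff_tiltHomeomorph : ContDiff ℝ ∞ (tiltHomeomorph i hσ hε) := by
  rw [contDiff_euclidean]
  intro j
  simp only [tiltHomeomorph_apply]
  split_ifs <;> fun_prop

theorem contDiff_tiltHomeomorph_symm : ContDiff ℝ ∞ (tiltHomeomorph i hσ hε).symm := by
  rw [contDiff_euclidean]
  intro j
  simp only [tiltHomeomorph_symm_apply]
  split_ifs
  · fun_prop
  · simp only [div_eq_mul_inv]
    fun_prop

end

/-- The cube `|yⱼ| < r` in the chart `e`. -/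
def cube (e : OpenPartialHomeomorph X (Rn n)) (r : ℝ) : Opens X :=
  chartOpen e (isOpen_openBox (fun _ => -r) (fun _ => r))

omit [ChartedSpace (Rn n) X] [IsManifold 𝓘(ℝ, Rn n) ∞ X] in
theorem cube_mono (e : OpenPartialHomeomorph X (Rn n)) {r r' : ℝ} (h : r ≤ r') :
    cube e r ≤ cube e r' := fun _ hx => ⟨hx.1, fun j =>
  ⟨(neg_le_neg h).trans_lt (hx.2 j).1, (hx.2 j).2.trans_le h⟩⟩

omit [ChartedSpace (Rn n) X] [IsManifold 𝓘(ℝ, Rn n) ∞ X] in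
theorem abs_lt_of_mem_cube {e : OpenPartialHomeomorph X (Rn n)} {r : ℝ} {x : X}
    (hx : x ∈ cube e r) (j : Fin n) : |e x j| < r := abs_lt.2 (hx.2 j)

theorem closedBox_mono {r r' : ℝ} (h : r ≤ r') :
    closedBox (fun _ : Fin n => -r) (fun _ => r) ⊆ closedBox (fun _ => -r') (fun _ => r') :=
  fun _ hy j => ⟨(neg_le_neg h).trans (hy j).1, (hy j).2.trans h⟩

theorem isCompact_closedBox (a b : Fin n → ℝ) : IsCompact (closedBox a b) := by
  have h := (isCompact_univ_pi fun i : Fin n => isCompact_Icc (a := a i) (b := b i)).image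
    (PiLp.continuous_toLp 2 fun _ : Fin n => ℝ)
  convert h using 1
  ext y
  refine ⟨fun hy => ⟨fun i => y i, fun i _ => hy i, rfl⟩, ?_⟩
  rintro ⟨z, hz, rfl⟩ i
  exact hz i trivial

omit [ChartedSpace (Rn n) X] [IsManifold 𝓘(ℝ, Rn n) ∞ X] in
theorem cube_subset_image {e : OpenPartialHomeomorph X (Rn n)} (r : ℝ) :
    (cube e r : Set X) ⊆ e.symm '' closedBox (fun _ => -r) (fun _ => r) := fun x hx =>
  ⟨e x, fun j => ⟨(hx.2 j).1.le, (hx.2 j).2.le⟩, e.left_inv hx.1⟩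

omit [ChartedSpace (Rn n) X] [IsManifold 𝓘(ℝ, Rn n) ∞ X] in
theorem isCompact_cube_closure {e : OpenPartialHomeomorph X (Rn n)} {r : ℝ}
    (h : closedBox (fun _ => -r) (fun _ => r) ⊆ e.target) :
    IsCompact (e.symm '' closedBox (fun _ => -r) (fun _ => r)) :=
  (isCompact_closedBox _ _).image_of_continuousOn (e.continuousOn_symm.mono h)

omit [ChartedSpace (Rn n) X] [IsManifold 𝓘(ℝ, Rn n) ∞ X] in
theorem cube_closure_subset_source {e : OpenPartialHomeomorph X (Rn n)} {r : ℝ}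
    (h : closedBox (fun _ => -r) (fun _ => r) ⊆ e.target) :
    e.symm '' closedBox (fun _ => -r) (fun _ => r) ⊆ e.source := by
  rintro _ ⟨y, hy, rfl⟩
  exact e.map_target (h hy)

variable [T2Space X] [SigmaCompactSpace X]
  {𝒪 : OrientedAtlas n X} {hkm : k + m = n} {B : CurrentSubsheaf n 𝕜 X m}
  (hB : B.ContainsSmoothForms 𝒪 hkm) (hB' : B.ClosedUnderSmears)
  {e : OpenPartialHomeomorph X (Rn n)} (he : e ∈ SmoothCharts n X)
include hB hB' he

/-- Currents in a cube can be cut off along a coordinate hyperplane, at the price of passing to a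
smaller cube. -/
theorem exists_cut_cube (i : Fin n) {σ R s s' : ℝ} (hσ : σ = 1 ∨ σ = -1) (hs : 0 < s)
    (hss' : s < s') (hs' : s' < R)
    (hR : closedBox (fun _ => -(10 * R)) (fun _ => 10 * R) ⊆ e.target)
    {T : Current n 𝕜 (m + 1) (cube e (10 * R))} (hT : T ∈ B.dPreimage _) {K : Set X}
    (hK : IsClosed K) (hTK : ∀ x ∈ K, x ∈ cube e (10 * R) → T.VanishesAt x)
    (hV : cube e R ≤ cube e (10 * R)) :
    ∃ T' ∈ B.dPreimage (cube e R), (∀ (O : Opens X) (hO : O ≤ cube e R),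
        (∀ x ∈ O, σ * e x i < s) → Current.res hO T' = Current.res (hO.trans hV) T) ∧
      (∀ x ∈ cube e R, s' ≤ σ * e x i → T'.VanishesAt x) ∧
      ∀ x ∈ K, x ∈ cube e R → T'.VanishesAt x := by
  have hR0 : 0 < R := by linarith
  -- the hyperplane is `zᵢ = s + 4 η`: what happens there leaves the region `zᵢ < s + η` alone and
  -- ends before `zᵢ = s + 5 η < s'`
  obtain ⟨η, hη⟩ : ∃ η, η = (s' - s) / 8 := ⟨_, rfl⟩
  have hη0 : 0 < η := by rw [hη]; linarith
  have hσσ : σ * σ = 1 := by rcases hσ with rfl | rfl <;> norm_num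
  have hσa : |σ| = 1 := by rcases hσ with rfl | rfl <;> simp
  have hε : 0 < η / R := div_pos hη0 hR0
  -- on the small cube the new coordinates differ from `σ yᵢ` by `ε |yⱼ| < η` for `ε = η / R`
  let h := tiltHomeomorph i hσσ hε.ne'
  let e' := e.transHomeomorph h
  have he' : e' ∈ SmoothCharts n X := transHomeomorph_mem_smoothCharts he h
    (contDiff_tiltHomeomorph ..) (contDiff_tiltHomeomorph_symm ..)
  have hei : ∀ x, e' x i = σ * e x i := fun x => if_pos rfl
  have hRsub : closedBox (fun _ : Fin n => -R) (fun _ => R) ⊆ e.target :=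
    (closedBox_mono (by linarith)).trans hR
  -- the box of the smear is contained in the large cube, as its points have `|yⱼ| ≤ 10 η / ε`
  have hinv : ∀ z : Rn n, (∀ j, |z j - (s + 4 * η)| ≤ 5 * η) → ∀ j, |h.symm z j| ≤ 10 * R ∧
      ((∀ j, |z j - (s + 4 * η)| < 5 * η) → |h.symm z j| < 10 * R) := by
    intro z hz' j
    rw [tiltHomeomorph_symm_apply]
    split_ifs with hj
    · have h1 := abs_le.1 (hz' i)
      have h2 : |σ * z i| < 10 * R := by
        rw [abs_mul, hσa, one_mul]
        exact abs_lt.2 ⟨by linarith, by linarith⟩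
      exact ⟨h2.le, fun _ => h2⟩
    · have h3 : 10 * R = 10 * η / (η / R) := by field_simp
      rw [abs_div, abs_of_pos hε, h3]
      refine ⟨div_le_div_of_nonneg_right ?_ hε.le, fun hz'' => div_lt_div_of_pos_right ?_ hε⟩
      · have h1 := abs_le.1 (hz' i)
        have h2 := abs_le.1 (hz' j)
        exact abs_le.2 ⟨by linarith, by linarith⟩
      · have h1 := abs_lt.1 (hz'' i)
        have h2 := abs_lt.1 (hz'' j)
        exact abs_lt.2 ⟨by linarith, by linarith⟩
  have hVs : (cube e R : Set X) ⊆ e.symm '' closedBox (fun _ => -R) (fun _ => R) :=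
    cube_subset_image R
  obtain ⟨T', hT', h1, h2, h3⟩ := exists_cut_hyperplane hB hB' he' i (s := s + 4 * η) hη0 hV
    (isCompact_cube_closure hRsub) (cube_closure_subset_source hRsub) hVs (fun x hx j => by
      rw [hei]
      change |tiltHomeomorph i hσσ hε.ne' (e x) j - _| < η
      rw [tiltHomeomorph_apply]
      split_ifs with hj
      · simpa using hη0
      · rw [add_sub_cancel_left, abs_mul, abs_of_pos hε]
        calc η / R * |e x j| < η / R * R := by
              have := abs_lt_of_mem_cube hx j
              gcongr
          _ = η := div_mul_cancel₀ _ hR0.ne') (fun z hz => hR fun j => abs_le.1 (hinv z (fun j =>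
        abs_le.2 ⟨by linarith [(hz j).1], by linarith [(hz j).2]⟩) j).1) (fun x hx => by
      refine ⟨hx.1, fun j => ?_⟩
      have hz : ∀ j, |e' x j - (s + 4 * η)| < 5 * η := fun j => by
        have h4 := (hx.2 j).1
        have h5 := (hx.2 j).2
        exact abs_lt.2 ⟨by linarith, by linarith⟩
      have h6 := (hinv (e' x) (fun j => (hz j).le) j).2 hz
      rw [show h.symm (e' x) = e x from h.symm_apply_apply (e x)] at h6
      exact abs_lt.1 h6) hT hK hTK
  refine ⟨T', hT', fun O hO hx => h1 O hO fun x hxO => ?_, fun x hx hxs => h2 x hx ?_, h3⟩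
  · rw [hei]
    linarith [hx x hxO]
  · rw [hei]
    linarith

/-- Cutting along several hyperplanes in turn; a hyperplane is given by a coordinate and a sign. -/
theorem exists_cut_list (l : List (Fin n × ℝ)) (hl : ∀ p ∈ l, p.2 = 1 ∨ p.2 = -1) {R s s' : ℝ}
    (hs : 0 < s) (hss' : s < s') (hs' : s' < R) {R₀ : ℝ} (hR₀ : R₀ = 10 ^ l.length * R)
    (hR : closedBox (fun _ => -R₀) (fun _ => R₀) ⊆ e.target)
    {T : Current n 𝕜 (m + 1) (cube e R₀)} (hT : T ∈ B.dPreimage _) {K : Set X}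
    (hK : IsClosed K) (hTK : ∀ x ∈ K, x ∈ cube e R₀ → T.VanishesAt x) (hV : cube e R ≤ cube e R₀) :
    ∃ T' ∈ B.dPreimage (cube e R), (∀ (O : Opens X) (hO : O ≤ cube e R),
        (∀ x ∈ O, ∀ p ∈ l, p.2 * e x p.1 < s) →
          Current.res hO T' = Current.res (hO.trans hV) T) ∧
      (∀ x ∈ cube e R, ∀ p ∈ l, s' ≤ p.2 * e x p.1 → T'.VanishesAt x) ∧
      ∀ x ∈ K, x ∈ cube e R → T'.VanishesAt x := by
  induction l generalizing R₀ K with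
  | nil =>
    exact ⟨Current.res hV T, B.res_mem_dPreimage hV hT, fun _ _ _ => rfl, by simp,
      fun x hxK hx => (hTK x hxK (hV hx)).res hV hx⟩
  | cons p l ih =>
    obtain ⟨R₁, hR₁⟩ : ∃ R₁, R₁ = 10 ^ l.length * R := ⟨_, rfl⟩
    obtain rfl : R₀ = 10 * R₁ := by rw [hR₀, hR₁, List.length_cons]; ring
    have hRR₁ : R ≤ R₁ := by
      rw [hR₁]
      exact le_mul_of_one_le_left (by linarith) (one_le_pow₀ (by norm_num))
    have hV₁ : cube e R ≤ cube e R₁ := cube_mono e hRR₁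
    have hV₂ : cube e R₁ ≤ cube e (10 * R₁) := cube_mono e (by linarith)
    have hbox : closedBox (fun _ : Fin n => -R₁) (fun _ => R₁) ⊆ e.target :=
      (closedBox_mono (by linarith)).trans hR
    obtain ⟨T₁, hT₁, h1, h2, h3⟩ := exists_cut_cube hB hB' he p.1 (hl p List.mem_cons_self) hs hss'
      (hs'.trans_le hRR₁) hR hT hK hTK hV₂
    -- the zeros already achieved are protected by adding them to the closed set `K`
    have hc : IsClosed (e.symm '' closedBox (fun _ => -R₁) (fun _ => R₁) ∩
        (fun x => p.2 * e x p.1) ⁻¹' Set.Ici s') := by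
      refine ContinuousOn.preimage_isClosed_of_isClosed (continuousOn_const.mul
        ((EuclideanSpace.proj (𝕜 := ℝ) p.1).continuous.comp_continuousOn
          (e.continuousOn.mono (cube_closure_subset_source hbox))))
        (isCompact_cube_closure hbox).isClosed isClosed_Ici
    obtain ⟨T', hT', h4, h5, h6⟩ := ih (fun q hq => hl q (List.mem_cons_of_mem _ hq)) hR₁ hbox hT₁
      (hK.union hc) (by
        rintro x (hx | hx) hxR
        · exact h3 x hx hxR
        · exact h2 x hxR hx.2) hV₁
    refine ⟨T', hT', fun O hO h => ?_, fun x hx q hq h => ?_, fun x hxK hx => h6 x (Or.inl hxK) hx⟩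
    · exact (h4 O hO fun x hx q hq => h x hx q (List.mem_cons_of_mem _ hq)).trans
        (h1 O (hO.trans hV₁) fun x hx => h x hx p List.mem_cons_self)
    · rcases List.mem_cons.1 hq with rfl | hq
      · exact h6 x (Or.inr ⟨cube_subset_image R₁ (hV₁ hx), h⟩) hx
      · exact h5 x hx q hq h

omit he in
/-- Currents whose derivative belongs to `B` can be cut off around every point. -/
theorem exists_cutoff {W : Opens X} {p : X} (hp : p ∈ W) : ∃ (N U : Opens X) (hNU : N ≤ U),
    p ∈ N ∧ U ≤ W ∧ ∀ T ∈ B.dPreimage U, ∀ L : Set X, IsClosed L →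
      (∀ x ∈ L, x ∈ U → T.VanishesAt x) → ∃ G ∈ B.dPreimage ⊤,
        Current.res le_top G = Current.res hNU T ∧ (∀ x ∈ L, G.VanishesAt x) ∧
        ∀ x ∉ U, G.VanishesAt x := by
  -- a chart centred at the point
  let e := (chartAt (Rn n) p).transHomeomorph (Homeomorph.addRight (-chartAt (Rn n) p p))
  have he : e ∈ SmoothCharts n X :=
    transHomeomorph_mem_smoothCharts (IsManifold.chart_mem_maximalAtlas p) _
      (contDiff_id.add contDiff_const) (contDiff_id.add contDiff_const)
  have hpe : p ∈ e.source := mem_chart_source (Rn n) p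
  have hep : e p = 0 := add_neg_cancel _
  have hnhds : WithLp.toLp 2 ⁻¹' (e.target ∩ e.symm ⁻¹' W) ∈ nhds (0 : Fin n → ℝ) := by
    refine (PiLp.continuous_toLp 2 _).continuousAt.preimage_mem_nhds
      ((e.symm.isOpen_inter_preimage W.isOpen).mem_nhds ?_)
    rw [WithLp.toLp_zero, ← hep]
    refine ⟨e.map_source hpe, ?_⟩
    rw [Set.mem_preimage, e.left_inv hpe]
    exact hp
  obtain ⟨R₀, hR₀, hR₀W⟩ := Metric.nhds_basis_closedBall.mem_iff.1 hnhds
  have hbox : closedBox (fun _ => -R₀) (fun _ => R₀) ⊆ e.target ∩ e.symm ⁻¹' W := fun y hy =>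
    hR₀W (a := fun i => y i) (mem_closedBall_zero_iff.2
      ((pi_norm_le_iff_of_nonneg hR₀.le).2 fun i => abs_le.2 (hy i)))
  -- the faces of a cube, each of which costs a factor of `10` in the size of the cube
  let l : List (Fin n × ℝ) := (Finset.univ ×ˢ {1, -1} : Finset (Fin n × ℝ)).toList
  have hl : ∀ q : Fin n × ℝ, q ∈ l ↔ q.2 = 1 ∨ q.2 = -1 := fun q => by
    simp [l]
  obtain ⟨R, hR⟩ : ∃ R, R = R₀ / 10 ^ l.length := ⟨_, rfl⟩
  have hR0 : 0 < R := by rw [hR]; positivity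
  have hRR₀ : R₀ = 10 ^ l.length * R := by rw [hR]; field_simp
  have hRle : R ≤ R₀ := by
    rw [hRR₀]
    exact le_mul_of_one_le_left hR0.le (one_le_pow₀ (by norm_num))
  have hsR : cube e (R / 3) ≤ cube e R := cube_mono e (by linarith)
  have hV := cube_mono e hRle
  have hbox' : closedBox (fun _ : Fin n => -(R / 2)) (fun _ => R / 2) ⊆ e.target :=
    (closedBox_mono (by linarith)).trans (hbox.trans Set.inter_subset_left)
  refine ⟨cube e (R / 3), cube e R₀, hsR.trans hV, ⟨hpe, fun j => ?_⟩, fun x hx => ?_,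
    fun T hT L hL hTL => ?_⟩
  · rw [hep]
    exact ⟨show -(R / 3) < 0 by linarith, show 0 < R / 3 by linarith⟩
  · obtain ⟨y, hy, rfl⟩ := cube_subset_image R₀ hx
    exact (hbox hy).2
  obtain ⟨T', hT', h1, h2, h3⟩ := exists_cut_list hB hB' he l (fun q hq => (hl q).1 hq)
    (R := R) (s := R / 3) (s' := R / 2) (by linarith) (by linarith) (by linarith) hRR₀
    (hbox.trans Set.inter_subset_left) hT hL hTL hV
  let V : Opens X := ⟨(e.symm '' closedBox (fun _ => -(R / 2)) (fun _ => R / 2))ᶜ,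
    (isCompact_cube_closure hbox').isClosed.isOpen_compl⟩
  have hcov : ((⊤ : Opens X) : Set X) ⊆ cube e R ∪ V := fun x _ => by
    by_cases hx : x ∈ V
    · exact Or.inr hx
    · obtain ⟨y, hy, rfl⟩ := not_not.1 hx
      refine Or.inl ⟨e.map_target (hbox' hy), fun j => ?_⟩
      rw [e.right_inv (hbox' hy)]
      exact ⟨by linarith [(hy j).1], by linarith [(hy j).2]⟩
  have hzero : ∀ x ∈ cube e R, x ∈ V → T'.VanishesAt x := fun x hx hxV => by
    by_contra hcon
    refine hxV ⟨e x, fun j => ?_, e.left_inv hx.1⟩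
    have h4 : ∀ q, (q = 1 ∨ q = -1) → q * e x j < R / 2 := fun q hq =>
      lt_of_not_ge fun h => hcon (h2 x hx (j, q) ((hl _).2 hq) h)
    have h5 := h4 1 (Or.inl rfl)
    have h6 := h4 (-1) (Or.inr rfl)
    exact ⟨by linarith, by linarith⟩
  obtain ⟨G, hG1, hG2⟩ := Current.exists_glue_pair (le_top : cube e R ≤ ⊤) (le_top : V ≤ ⊤) hcov
    T' 0 <| by
      rw [map_zero]
      exact Current.eq_zero_of_vanishesAt fun x hx => (hzero x hx.1 hx.2).res _ hx
  have hGV : ∀ x ∈ V, G.VanishesAt x := fun x hx => ⟨V, le_top, hx, hG2⟩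
  have hGR : ∀ x ∈ cube e R, T'.VanishesAt x → G.VanishesAt x := fun x hx h => by
    rw [← hG1] at h
    exact h.of_res
  refine ⟨G, CurrentSubsheaf.mem_dPreimage_of_pair (le_top : cube e R ≤ ⊤) (le_top : V ≤ ⊤) hcov
    (hG1 ▸ hT') (hG2 ▸ Submodule.zero_mem _), ?_, fun x hx => ?_, fun x hx => ?_⟩
  · refine (congrArg (Current.res hsR) hG1).trans (h1 _ hsR fun x hx q hq => ?_)
    have h7 := abs_lt_of_mem_cube hx q.1
    refine lt_of_le_of_lt (le_abs_self _) ?_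
    rcases (hl q).1 hq with h | h <;> simpa [h] using h7
  · rcases hcov (Set.mem_univ x) with h | h
    · exact hGR x h (h3 x hx h)
    · exact hGV x h
  · rcases hcov (Set.mem_univ x) with h | h
    · exact (hx (hV h)).elim
    · exact hGV x h

end Cube

/-! ### Softness of the preimage sheaf -/

section Germs

variable {n m k : ℕ} {𝕜 : Type} [RCLike 𝕜] {X : Type u} [TopologicalSpace X] [T2Space X]
  [ChartedSpace (Rn n) X] [IsManifold 𝓘(ℝ, Rn n) ∞ X] {B : CurrentSubsheaf n 𝕜 X m}
  (hF : B.dPreimagePresheaf.IsSheaf)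

include hF

theorem germ_dPreimage_eq_zero_iff {U : Opens X} {x : X} (hx : x ∈ U) (t : B.dPreimage U) :
    B.dPreimagePresheaf.germ U x hx t = 0 ↔ t.1.VanishesAt x := by
  let F : TopCat.Sheaf AddCommGrpCat.{u} (TopCat.of X) := ⟨B.dPreimagePresheaf, hF⟩
  constructor
  · intro h
    obtain ⟨O, hO, hO', hxO, h1⟩ := exists_map_eq_of_germ_eq F (U := U) (V := U) hx hx (s := t)
      (t := 0) (h.trans (map_zero _).symm)
    refine ⟨O, hO, hxO, ?_⟩
    have h2 := h1.trans (map_zero (F.presheaf.map (homOfLE hO').op).hom)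
    exact congrArg Subtype.val h2
  · rintro ⟨O, hO, hxO, h⟩
    have h1 := germ_map F hO x hxO t
    refine h1.symm.trans ?_
    have h2 : F.presheaf.map (homOfLE hO).op t = 0 := Subtype.ext h
    rw [h2]
    exact map_zero _

/-- Cutting off in terms of currents and in terms of germs of sections. -/
theorem hasCutoff_dPreimage {N U : Opens X} (hNU : N ≤ U)
    (h : ∀ T ∈ B.dPreimage U, ∀ L : Set X, IsClosed L →
      (∀ x ∈ L, x ∈ U → T.VanishesAt x) → ∃ G ∈ B.dPreimage ⊤,
        Current.res le_top G = Current.res hNU T ∧ (∀ x ∈ L, G.VanishesAt x) ∧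
        ∀ x ∉ U, G.VanishesAt x) :
    HasCutoff (X := TopCat.of X) ⟨B.dPreimagePresheaf, hF⟩ N U := by
  let F : TopCat.Sheaf AddCommGrpCat.{u} (TopCat.of X) := ⟨B.dPreimagePresheaf, hF⟩
  rintro ⟨T, hT⟩ L hL hTL
  obtain ⟨G, hG, h1, h2, h3⟩ := h T hT L hL fun x hx hU =>
    (germ_dPreimage_eq_zero_iff hF hU ⟨T, hT⟩).1 (hTL x hU hx)
  refine ⟨⟨G, hG⟩, fun x hU hN => ?_, fun x hx => (germ_dPreimage_eq_zero_iff hF _ _).2 (h2 x hx),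
    fun x hx => (germ_dPreimage_eq_zero_iff hF _ _).2 (h3 x hx)⟩
  have h4 := germ_map F (le_top : N ≤ ⊤) x hN ⟨G, hG⟩
  have h5 := germ_map F hNU x hN ⟨T, hT⟩
  refine h4.symm.trans (Eq.trans ?_ h5)
  exact congrArg _ (Subtype.ext h1)

end Germs

theorem mainTheorem6 {n : ℕ} {𝕜 : Type} [RCLike 𝕜]
    {X : Type u} [TopologicalSpace X] [T2Space X] [SecondCountableTopology X]
    [ChartedSpace (Rn n) X] [IsManifold 𝓘(ℝ, Rn n) ∞ X] (𝒪 : OrientedAtlas n X)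
    {k m : ℕ} (hk : 1 ≤ k) (hkm : k + m = n)
    (B : CurrentSubsheaf n 𝕜 X m)
    (hB_smooth : B.ContainsSmoothForms 𝒪 hkm)
    (hB_smear : B.ClosedUnderSmears) :
    ∃ hB' : B.dPreimagePresheaf.IsSheaf,
      IsSoft ⟨B.dPreimagePresheaf, hB'⟩ ∧ IsGammaAcyclic ⟨B.dPreimagePresheaf, hB'⟩ := by
  have : LocallyCompactSpace X := ChartedSpace.locallyCompactSpace (Rn n) X
  have hB' := B.isSheaf_dPreimagePresheaf
  have hsoft : IsSoft (X := TopCat.of X) ⟨B.dPreimagePresheaf, hB'⟩ := by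
    have : T2Space (TopCat.of X) := ‹T2Space X›
    have : LocallyCompactSpace (TopCat.of X) := ‹LocallyCompactSpace X›
    have : SigmaCompactSpace (TopCat.of X) := inferInstanceAs (SigmaCompactSpace X)
    refine isSoft_of_hasCutoff _ fun x W hx => ?_
    obtain ⟨N, U, hNU, hxN, hUW, h⟩ := exists_cutoff hB_smooth hB_smear hx
    exact ⟨N, U, hxN, hNU, hUW, hasCutoff_dPreimage hB' hNU h⟩
  have : T2Space (TopCat.of X) := ‹T2Space X›
  have : LocallyCompactSpace (TopCat.of X) := ‹LocallyCompactSpace X›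
  have : SigmaCompactSpace (TopCat.of X) := inferInstanceAs (SigmaCompactSpace X)
  exact ⟨hB', hsoft, hsoft.isGammaAcyclic⟩

end
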